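/- Let $M$ be the interval $[0,1]$ or the circle $\mathbb{R}/\mathbb{Z}$. For a $C^2$ diffeomorphism $f$ of $M$, denote by $\mathrm{var}(\log|Df|)$ the total variation on $M$ of the function $\log |Df|$ (on the circle, the derivative is that of a lift of $f$ to $\mathbb{R}$, and the variation is taken once around the circle). Define the asymptotic distortion of $f$ as $$\mathrm{dist}_\infty(f) := \lim_{n\to\infty} \frac{1}{n}\,\mathrm{var}\big(\log |Df^n|\big),$$ where $f^n$ is the $n$-th iterate of $f$; this limit exists and is finite. If $f$ and $g$ are $C^2$ diffeomorphisms of $M$ for which there exists a $C^1$ diffeomorphism $h$ of $M$ such that $f = h g h^{-1}$, then $\mathrm{dist}_\infty(f) = \mathrm{dist}_\infty(g)$. -/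

import Mathlib

open Set Filter Topology
open scoped ENNReal unitInterval

noncomputable section

namespace AsympDist

/-! ### The interval `[0,1]` -/

/-- A self-map of `[0,1]` as a real function on the line; only its values on `[0,1]` matter below. -/
def intervalFun (f : I → I) : ℝ → ℝ :=
  IccExtend (zero_le_one' ℝ) (fun x => (f x : ℝ))

/-- `f` is a `C^r` diffeomorphism of `[0,1]` (of either orientation): a bijection such that `f` and
`f⁻¹` are of class `C^r` on the closed interval, with one-sided derivatives at the endpoints. -/
def IsIntervalDiffeo (r : WithTop ℕ∞) (f : Equiv.Perm I) : Prop :=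
  ContDiffOn ℝ r (intervalFun f) (Icc 0 1) ∧ ContDiffOn ℝ r (intervalFun ⇑f⁻¹) (Icc 0 1)

/-- `var (log |Df|)`, the total variation over `[0,1]`. -/
def intervalVarLog (f : Equiv.Perm I) : ℝ≥0∞ :=
  eVariationOn (fun x => Real.log |derivWithin (intervalFun f) (Icc 0 1) x|) (Icc 0 1)

/-- The asymptotic distortion `lim (1/n) var (log |Df^n|)` of a diffeomorphism of `[0,1]`. -/
def intervalDist (f : Equiv.Perm I) : ℝ≥0∞ :=
  limUnder atTop (fun n : ℕ => intervalVarLog (f ^ n) / n)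

/-! ### The circle `ℝ / ℤ` -/

/-- `F : ℝ → ℝ` is a lift of the circle map `f` through the projection `ℝ → ℝ / ℤ`. -/
def IsLift (f : UnitAddCircle → UnitAddCircle) (F : ℝ → ℝ) : Prop :=
  ∀ x : ℝ, (F x : UnitAddCircle) = f (x : UnitAddCircle)

/-- `f` is of class `C^r`: it has a lift of class `C^r`. -/
def IsCircleContDiff (r : WithTop ℕ∞) (f : UnitAddCircle → UnitAddCircle) : Prop :=
  ∃ F : ℝ → ℝ, ContDiff ℝ r F ∧ IsLift f F

/-- `f` is a `C^r` diffeomorphism of the circle (of either orientation). -/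
def IsCircleDiffeo (r : WithTop ℕ∞) (f : Equiv.Perm UnitAddCircle) : Prop :=
  IsCircleContDiff r f ∧ IsCircleContDiff r ⇑f⁻¹

open Classical in
/-- A continuous lift of `f` (zero if there is none); unique up to an additive constant. -/
def circleLift (f : UnitAddCircle → UnitAddCircle) : ℝ → ℝ :=
  if h : ∃ F : ℝ → ℝ, Continuous F ∧ IsLift f F then h.choose else 0

/-- The derivative of a circle map at the point `x` mod `1`, through a continuous lift. -/
def circleDeriv (f : UnitAddCircle → UnitAddCircle) (x : ℝ) : ℝ :=
  deriv (circleLift f) x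

/-- The derivative of a circle map may be computed with any continuous lift. -/
theorem circleDeriv_eq {f : UnitAddCircle → UnitAddCircle} {F : ℝ → ℝ}
    (hF : Continuous F) (hl : IsLift f F) (x : ℝ) : circleDeriv f x = deriv F x := by
  have h : ∃ F : ℝ → ℝ, Continuous F ∧ IsLift f F := ⟨F, hF, hl⟩
  obtain ⟨hG, hGl⟩ : Continuous (circleLift f) ∧ IsLift f (circleLift f) := by
    unfold circleLift
    rw [dif_pos h]
    exact h.choose_spec
  have hk : ∀ y, ∃ k : ℤ, (k : ℝ) = circleLift f y - F y := by
    intro y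
    have h0 : ((circleLift f y - F y : ℝ) : UnitAddCircle) = 0 := by
      rw [AddCircle.coe_sub, hGl y, hl y, sub_self]
    obtain ⟨k, hk⟩ := (AddCircle.coe_eq_zero_iff (1 : ℝ)).1 h0
    exact ⟨k, by simpa using hk⟩
  choose k hk using hk
  have hc : Continuous k := by
    rw [Int.isClosedEmbedding_coe_real.isEmbedding.continuous_iff]
    have : (Int.cast ∘ k : ℝ → ℝ) = fun y => circleLift f y - F y := funext hk
    rw [this]
    exact hG.sub hF
  have hconst : ∀ y, k y = k 0 := fun y =>
    PreconnectedSpace.constant inferInstance hc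
  have : circleLift f = fun y => F y + (k 0 : ℝ) := by
    funext y
    have := hk y
    rw [hconst y] at this
    linarith
  unfold circleDeriv
  rw [this, deriv_add_const]

/-- `var (log |Df|)`, the total variation once around the circle. -/
def circleVarLog (f : Equiv.Perm UnitAddCircle) : ℝ≥0∞ :=
  eVariationOn (fun x : ℝ => Real.log |circleDeriv f x|) (Icc 0 1)

/-- The asymptotic distortion `lim (1/n) var (log |Df^n|)` of a diffeomorphism of the circle. -/
def circleDist (f : Equiv.Perm UnitAddCircle) : ℝ≥0∞ :=
  limUnder atTop (fun n : ℕ => circleVarLog (f ^ n) / n)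

end AsympDist

end

namespace AsympDist

open MeasureTheory

/-! ### Variation -/

theorem eVariationOn_add_le {f g : ℝ → ℝ} (s : Set ℝ) :
    eVariationOn (fun x => f x + g x) s ≤ eVariationOn f s + eVariationOn g s := by
  refine iSup_le fun ⟨n, u, hu, us⟩ => ?_
  calc _ ≤ ∑ i ∈ Finset.range n, (edist (f (u (i + 1))) (f (u i)) +
        edist (g (u (i + 1))) (g (u i))) := Finset.sum_le_sum fun i _ => edist_add_add_le _ _ _ _
    _ = _ := Finset.sum_add_distrib
    _ ≤ _ := add_le_add (eVariationOn.sum_le hu us) (eVariationOn.sum_le hu us)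

theorem eVariationOn_neg (f : ℝ → ℝ) (s : Set ℝ) :
    eVariationOn (fun x => -f x) s = eVariationOn f s := by
  simp only [eVariationOn, edist_neg_neg]

theorem eVariationOn_const_sub (f : ℝ → ℝ) (c : ℝ) (s : Set ℝ) :
    eVariationOn (fun x => c - f x) s = eVariationOn f s := by
  simp only [eVariationOn, edist_sub_left]

theorem eVariationOn_sub_le {f g : ℝ → ℝ} (s : Set ℝ) :
    eVariationOn (fun x => f x - g x) s ≤ eVariationOn f s + eVariationOn g s := by
  simpa only [sub_eq_add_neg, eVariationOn_neg] using
    eVariationOn_add_le (f := f) (g := fun x => -g x) s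

theorem eVariationOn_sum_le {ι : Type*} (t : Finset ι) (f : ι → ℝ → ℝ) (s : Set ℝ) :
    eVariationOn (fun x => ∑ i ∈ t, f i x) s ≤ ∑ i ∈ t, eVariationOn (f i) s := by
  classical
  induction t using Finset.induction_on with
  | empty =>
    simp only [Finset.sum_empty]
    refine (eVariationOn.constant_on ?_).le
    rintro _ ⟨_, _, rfl⟩ _ ⟨_, _, rfl⟩
    rfl
  | insert i t hi ih =>
    simp only [Finset.sum_insert hi]
    exact (eVariationOn_add_le s).trans (by gcongr)

theorem eVariationOn_Icc_add (f : ℝ → ℝ) {a b c : ℝ} (hab : a ≤ b) (hbc : b ≤ c) :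
    eVariationOn f (Icc a b) + eVariationOn f (Icc b c) = eVariationOn f (Icc a c) := by
  simpa using eVariationOn.Icc_add_Icc f (s := univ) hab hbc (mem_univ b)

/-! ### Limits of subadditive sequences -/

theorem exists_tendsto_div_of_subadditive {v : ℕ → ℝ≥0∞} (h0 : v 0 ≠ ∞) (h1 : v 1 ≠ ∞)
    (hv : ∀ m n, v (m + n) ≤ v m + v n) :
    ∃ L : ℝ≥0∞, L ≠ ∞ ∧ Tendsto (fun n : ℕ => v n / n) atTop (𝓝 L) := by
  have hfin : ∀ n, v n ≠ ∞ := by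
    intro n
    induction n with
    | zero => exact h0
    | succ n ih => exact ne_top_of_le_ne_top (ENNReal.add_ne_top.2 ⟨ih, h1⟩) (hv n 1)
  have hs : Subadditive fun n => (v n).toReal := fun m n => by
    rw [← ENNReal.toReal_add (hfin m) (hfin n)]
    exact ENNReal.toReal_mono (ENNReal.add_ne_top.2 ⟨hfin m, hfin n⟩) (hv m n)
  have hb : BddBelow (range fun n : ℕ => (v n).toReal / n) :=
    ⟨0, by rintro _ ⟨n, rfl⟩; positivity⟩
  refine ⟨ENNReal.ofReal hs.lim, ENNReal.ofReal_ne_top, ?_⟩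
  refine (ENNReal.tendsto_ofReal (hs.tendsto_lim hb)).congr' ?_
  filter_upwards [eventually_gt_atTop 0] with n hn
  rw [ENNReal.ofReal_div_of_pos (by exact_mod_cast hn), ENNReal.ofReal_toReal (hfin n),
    ENNReal.ofReal_natCast]

theorem le_of_tendsto_div_of_le_add {v v' w : ℕ → ℝ≥0∞} {L L' : ℝ≥0∞} {m : ℕ} (hm : 0 < m)
    (hv : Tendsto (fun n : ℕ => v n / n) atTop (𝓝 L))
    (hv' : Tendsto (fun n : ℕ => v' n / n) atTop (𝓝 L'))
    (hw : Tendsto (fun n : ℕ => w n / n) atTop (𝓝 0))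
    (h : ∀ j, v (m * j) ≤ v' (m * j) + w j) : L ≤ L' := by
  have hmj : Tendsto (fun j : ℕ => m * j) atTop atTop :=
    tendsto_id.const_mul_atTop' hm
  have hsum := (hv'.comp hmj).add hw
  rw [add_zero] at hsum
  refine le_of_tendsto_of_tendsto' (hv.comp hmj) hsum fun j => ?_
  calc v (m * j) / ((m * j : ℕ) : ℝ≥0∞) ≤ (v' (m * j) + w j) / ((m * j : ℕ) : ℝ≥0∞) := by
        gcongr; exact h j
    _ = v' (m * j) / ((m * j : ℕ) : ℝ≥0∞) + w j / ((m * j : ℕ) : ℝ≥0∞) := ENNReal.add_div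
    _ ≤ v' (m * j) / ((m * j : ℕ) : ℝ≥0∞) + w j / (j : ℝ≥0∞) := by
        gcongr
        exact Nat.le_mul_of_pos_left j hm

theorem tendsto_div_of_forall_le_add {w : ℕ → ℝ≥0∞}
    (h : ∀ ε : ℝ≥0∞, ε ≠ 0 → ∃ C : ℝ≥0∞, C ≠ ∞ ∧ ∀ n : ℕ, w n ≤ C + n * ε) :
    Tendsto (fun n : ℕ => w n / n) atTop (𝓝 0) := by
  rw [ENNReal.tendsto_nhds_zero]
  intro ε hε
  obtain ⟨C, hC, hw⟩ := h (ε / 2) (ENNReal.half_pos hε.ne').ne'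
  have hlim : Tendsto (fun n : ℕ => C / n) atTop (𝓝 0) := by
    simpa using ENNReal.Tendsto.const_div ENNReal.tendsto_nat_nhds_top (Or.inr hC)
  filter_upwards [ENNReal.tendsto_nhds_zero.1 hlim (ε / 2) (ENNReal.half_pos hε.ne'),
    eventually_gt_atTop 0] with n hn hpos
  calc w n / n ≤ (C + n * (ε / 2)) / n := by gcongr; exact hw n
    _ = C / n + (n * (ε / 2)) / n := ENNReal.add_div
    _ ≤ ε / 2 + ε / 2 :=
        add_le_add hn (ENNReal.div_le_of_le_mul (mul_comm _ _).le)
    _ = ε := ENNReal.add_halves ε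

/-! ### Coboundaries over an interval map with a fixed point -/

theorem eVariationOn_comp_orderIso_iterate (G : ℝ ≃o ℝ) (f : ℝ → ℝ) (n : ℕ) (x y : ℝ) :
    eVariationOn (fun z => f (G^[n] z)) (Icc x y) =
      eVariationOn f (Icc (G^[n] x) (G^[n] y)) := by
  induction n generalizing x y with
  | zero => rfl
  | succ n ih =>
    simp only [Function.iterate_succ_apply]
    rw [← ih, ← G.image_Icc, ← eVariationOn.comp_eq_of_monotoneOn _ _ (G.monotone.monotoneOn _)]
    rfl

theorem sub_iterate_eq_sum (G : ℝ → ℝ) (ψ : ℝ → ℝ) (n : ℕ) (x : ℝ) :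
    ψ (G^[n] x) - ψ x = ∑ i ∈ Finset.range n, (ψ (G (G^[i] x)) - ψ (G^[i] x)) := by
  induction n with
  | zero => simp
  | succ n ih =>
    rw [Finset.sum_range_succ, ← ih, Function.iterate_succ_apply']
    ring

theorem eVariationOn_coboundary_le_sum (G : ℝ ≃o ℝ) (ψ : ℝ → ℝ) (n : ℕ) (x y : ℝ) :
    eVariationOn (fun z => ψ (G^[n] z) - ψ z) (Icc x y) ≤
      ∑ i ∈ Finset.range n,
        eVariationOn (fun z => ψ (G z) - ψ z) (Icc (G^[i] x) (G^[i] y)) := by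
  simp only [sub_iterate_eq_sum, ← eVariationOn_comp_orderIso_iterate]
  exact eVariationOn_sum_le _ _ _

theorem strictMono_iterate_orderIso (G : ℝ ≃o ℝ) (n : ℕ) : StrictMono G^[n] :=
  G.strictMono.iterate n

theorem continuous_iterate_orderIso (G : ℝ ≃o ℝ) (n : ℕ) : Continuous G^[n] :=
  G.continuous.iterate n

theorem iterate_symm_iterate (G : ℝ ≃o ℝ) (n : ℕ) (x : ℝ) : G^[n] (G.symm^[n] x) = x :=
  Function.LeftInverse.iterate (fun y => G.apply_symm_apply y) n x

section Component

variable {G : ℝ ≃o ℝ} {α β : ℝ}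

theorem iterate_mem_Ioo (hα : G α = α) (hβ : G β = β) {x : ℝ} (hx : x ∈ Ioo α β) (n : ℕ) :
    G^[n] x ∈ Ioo α β := by
  induction n with
  | zero => exact hx
  | succ n ih =>
    rw [Function.iterate_succ_apply']
    exact ⟨hα ▸ G.strictMono ih.1, hβ ▸ G.strictMono ih.2⟩

theorem monotone_orbit (hα : G α = α) (hβ : G β = β) (hlt : ∀ x ∈ Ioo α β, x < G x)
    {x : ℝ} (hx : x ∈ Ioo α β) : Monotone fun n => G^[n] x :=
  monotone_nat_of_le_succ fun n => by
    rw [Function.iterate_succ_apply']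
    exact (hlt _ (iterate_mem_Ioo hα hβ hx n)).le

theorem tendsto_orbit (hα : G α = α) (hβ : G β = β) (hlt : ∀ x ∈ Ioo α β, x < G x)
    {x : ℝ} (hx : x ∈ Ioo α β) : Tendsto (fun n => G^[n] x) atTop (𝓝 β) := by
  have hmono := monotone_orbit hα hβ hlt hx
  have hbdd : BddAbove (range fun n => G^[n] x) :=
    ⟨β, by rintro _ ⟨n, rfl⟩; exact (iterate_mem_Ioo hα hβ hx n).2.le⟩
  have hlim := tendsto_atTop_ciSup hmono hbdd
  set l := ⨆ n, G^[n] x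
  have hfix : G l = l := by
    refine tendsto_nhds_unique ((G.continuous.tendsto l).comp hlim) ?_
    refine ((tendsto_add_atTop_iff_nat 1).2 hlim).congr fun n => ?_
    exact Function.iterate_succ_apply' G n x
  have hxl : x ≤ l := le_ciSup hbdd 0
  have hlβ : l ≤ β := ciSup_le fun n => (iterate_mem_Ioo hα hβ hx n).2.le
  rcases hlβ.eq_or_lt with h | h
  · rwa [h] at hlim
  · exact absurd hfix (hlt l ⟨hx.1.trans_le hxl, h⟩).ne'

theorem symm_iterate_mem_Ioo (hα : G α = α) (hβ : G β = β) {x : ℝ} (hx : x ∈ Ioo α β) (n : ℕ) :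
    G.symm^[n] x ∈ Ioo α β :=
  iterate_mem_Ioo (G := G.symm) (by rw [G.symm_apply_eq, hα]) (by rw [G.symm_apply_eq, hβ]) hx n

theorem tendsto_symm_orbit (hα : G α = α) (hβ : G β = β) (hlt : ∀ x ∈ Ioo α β, x < G x)
    {x : ℝ} (hx : x ∈ Ioo α β) : Tendsto (fun n => G.symm^[n] x) atTop (𝓝 α) := by
  have hstep : ∀ y ∈ Ioo α β, G.symm y < y := fun y hy => by
    rw [G.symm_apply_lt]; exact hlt y hy
  have hmem := symm_iterate_mem_Ioo hα hβ hx
  have hanti : Antitone fun n => G.symm^[n] x := antitone_nat_of_succ_le fun n => by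
    rw [Function.iterate_succ_apply']
    exact (hstep _ (hmem n)).le
  have hbdd : BddBelow (range fun n => G.symm^[n] x) :=
    ⟨α, by rintro _ ⟨n, rfl⟩; exact (hmem n).1.le⟩
  have hlim := tendsto_atTop_ciInf hanti hbdd
  set l := ⨅ n, G.symm^[n] x
  have hfix : G.symm l = l := by
    refine tendsto_nhds_unique ((G.symm.continuous.tendsto l).comp hlim) ?_
    refine ((tendsto_add_atTop_iff_nat 1).2 hlim).congr fun n => ?_
    exact Function.iterate_succ_apply' G.symm n x
  have hxl : l ≤ x := ciInf_le hbdd 0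
  have hlα : α ≤ l := le_ciInf fun n => (hmem n).1.le
  rcases hlα.eq_or_lt with h | h
  · rwa [← h] at hlim
  · exact absurd hfix (hstep l ⟨h, hxl.trans_lt hx.2⟩).ne

variable {ψ : ℝ → ℝ} {L : ℝ}

theorem eVariationOn_fundamentalDomain_le_right (hα : G α = α) (hβ : G β = β)
    (hlt : ∀ x ∈ Ioo α β, x < G x) (hψ : ContinuousOn ψ (Icc α β))
    (hθ : ∀ x y, α ≤ x → x ≤ y → y ≤ β →
      eVariationOn (fun z => ψ (G z) - ψ z) (Icc x y) ≤ ENNReal.ofReal (L * (y - x)))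
    (hL : 0 ≤ L) {r : ℝ} (hr : r ∈ Ioo α β) :
    eVariationOn ψ (Icc r (G r)) ≤ ENNReal.ofReal (L * (β - r)) := by
  have hbound : ∀ m, eVariationOn (fun z => ψ (G^[m] z) - ψ z) (Icc r (G r)) ≤
      ENNReal.ofReal (L * (β - r)) := fun m => by
    refine (eVariationOn_coboundary_le_sum G ψ m _ _).trans ?_
    simp only [← Function.iterate_succ_apply]
    rw [eVariationOn.sum' (fun z => ψ (G z) - ψ z) (monotone_orbit hα hβ hlt hr)]
    have hm := iterate_mem_Ioo hα hβ hr m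
    refine (hθ _ _ hr.1.le (monotone_orbit hα hβ hlt hr (Nat.zero_le m)) hm.2.le).trans ?_
    refine ENNReal.ofReal_le_ofReal (mul_le_mul_of_nonneg_left ?_ hL)
    have := hm.2
    linarith
  rw [← eVariationOn_const_sub ψ (ψ β)]
  by_contra! hcon
  have hGr := iterate_mem_Ioo hα hβ hr 1
  have hev := eVariationOn.lowerSemicontinuous_aux (p := atTop)
    (F := fun m z => ψ (G^[m] z) - ψ z) (f := fun z => ψ β - ψ z) (s := Icc r (G r))
    (fun z hz => ?_) hcon
  · obtain ⟨m, hm⟩ := hev.exists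
    exact absurd hm (hbound m).not_gt
  · have hz' : z ∈ Ioo α β := ⟨hr.1.trans_le hz.1, hz.2.trans_lt hGr.2⟩
    refine Tendsto.sub_const ?_ _
    refine (hψ β ⟨(hr.1.trans hr.2).le, le_rfl⟩).tendsto.comp ?_
    refine tendsto_nhdsWithin_iff.2 ⟨tendsto_orbit hα hβ hlt hz', Eventually.of_forall fun n => ?_⟩
    exact Ioo_subset_Icc_self (iterate_mem_Ioo hα hβ hz' n)

theorem eVariationOn_fundamentalDomain_le_left (hα : G α = α) (hβ : G β = β)
    (hlt : ∀ x ∈ Ioo α β, x < G x) (hψ : ContinuousOn ψ (Icc α β))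
    (hθ : ∀ x y, α ≤ x → x ≤ y → y ≤ β →
      eVariationOn (fun z => ψ (G z) - ψ z) (Icc x y) ≤ ENNReal.ofReal (L * (y - x)))
    (hL : 0 ≤ L) {r : ℝ} (hr : r ∈ Ioo α β) :
    eVariationOn ψ (Icc r (G r)) ≤ ENNReal.ofReal (L * (r - α)) := by
  have hGr : G r ∈ Ioo α β := iterate_mem_Ioo hα hβ hr 1
  have hbound : ∀ m, eVariationOn (fun z => ψ z - ψ (G.symm^[m] z)) (Icc r (G r)) ≤
      ENNReal.ofReal (L * (r - α)) := fun m => by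
    have hm := symm_iterate_mem_Ioo hα hβ hr m
    set s := G.symm^[m] r with hs
    have hsr : G^[m] s = r := iterate_symm_iterate G m r
    have hsG : G^[m] (G s) = G r := by
      rw [← Function.iterate_succ_apply, Function.iterate_succ_apply', hsr]
    rw [← hsG]
    nth_rw 1 [← hsr]
    rw [← eVariationOn_comp_orderIso_iterate G (fun z => ψ z - ψ (G.symm^[m] z))]
    simp only [show ∀ z, G.symm^[m] (G^[m] z) = z from
      Function.LeftInverse.iterate (fun y => G.symm_apply_apply y) m]
    refine (eVariationOn_coboundary_le_sum G ψ m _ _).trans ?_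
    simp only [← Function.iterate_succ_apply]
    rw [eVariationOn.sum' (fun z => ψ (G z) - ψ z) (monotone_orbit hα hβ hlt hm)]
    have hle : s ≤ r := by
      simpa [hsr] using monotone_orbit hα hβ hlt hm (Nat.zero_le m)
    rw [hsr]
    refine (hθ _ _ hm.1.le hle hr.2.le).trans ?_
    refine ENNReal.ofReal_le_ofReal (mul_le_mul_of_nonneg_left ?_ hL)
    have := hm.1
    linarith
  have hneg : eVariationOn ψ (Icc r (G r)) = eVariationOn (fun z => ψ z - ψ α) (Icc r (G r)) := by
    simp only [eVariationOn, edist_sub_right]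
  rw [hneg]
  by_contra! hcon
  have hev := eVariationOn.lowerSemicontinuous_aux (p := atTop)
    (F := fun m z => ψ z - ψ (G.symm^[m] z)) (f := fun z => ψ z - ψ α) (s := Icc r (G r))
    (fun z hz => ?_) hcon
  · obtain ⟨m, hm⟩ := hev.exists
    exact absurd hm (hbound m).not_gt
  · have hz' : z ∈ Ioo α β := ⟨hr.1.trans_le hz.1, hz.2.trans_lt hGr.2⟩
    refine Tendsto.const_sub _ ?_
    refine (hψ α ⟨le_rfl, (hr.1.trans hr.2).le⟩).tendsto.comp ?_
    refine tendsto_nhdsWithin_iff.2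
      ⟨tendsto_symm_orbit hα hβ hlt hz', Eventually.of_forall fun n => ?_⟩
    exact Ioo_subset_Icc_self (symm_iterate_mem_Ioo hα hβ hz' n)

theorem eVariationOn_orbit_le (hα : G α = α) (hβ : G β = β) (hlt : ∀ x ∈ Ioo α β, x < G x)
    {e : ℝ≥0∞} {x : ℝ} (hx : x ∈ Ioo α β) (n : ℕ)
    (he : ∀ i < n, eVariationOn ψ (Icc (G^[i] x) (G (G^[i] x))) ≤ e) :
    eVariationOn ψ (Icc x (G^[n] x)) ≤ n * e := by
  have h := eVariationOn.sum' ψ (monotone_orbit hα hβ hlt hx) (n := n)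
  simp only [Function.iterate_zero, id] at h
  rw [← h]
  calc _ ≤ ∑ i ∈ Finset.range n, e := Finset.sum_le_sum fun i hi => by
        rw [Function.iterate_succ_apply']
        exact he i (Finset.mem_range.1 hi)
    _ = n * e := by simp

theorem eVariationOn_coboundary_component_of_lt (hαβ : α < β) (hα : G α = α) (hβ : G β = β)
    (hlt : ∀ x ∈ Ioo α β, x < G x) (hψ : ContinuousOn ψ (Icc α β))
    (hθ : ∀ x y, α ≤ x → x ≤ y → y ≤ β →
      eVariationOn (fun z => ψ (G z) - ψ z) (Icc x y) ≤ ENNReal.ofReal (L * (y - x)))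
    (hL : 0 ≤ L) {ε : ℝ} (hε : 0 < ε) :
    ∃ C : ℝ≥0∞, C ≠ ∞ ∧ ∀ n : ℕ,
      eVariationOn (fun z => ψ (G^[n] z) - ψ z) (Icc α β) ≤ C + n * ENNReal.ofReal ε := by
  set η := ε / 4 / (L + 1)
  have hη : 0 < η := by positivity
  have hLη : ∀ t, t ≤ η → L * t ≤ ε / 4 := fun t ht => by
    rcases le_or_gt t 0 with h0 | h0
    · exact (mul_nonpos_of_nonneg_of_nonpos hL h0).trans (by positivity)
    · calc L * t ≤ (L + 1) * η := by gcongr; linarith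
        _ = ε / 4 := by simp only [η]; field_simp
  obtain ⟨r, hr⟩ : (Ioo α β).Nonempty := nonempty_Ioo.2 hαβ
  obtain ⟨k, hk⟩ := ((tendsto_symm_orbit hα hβ hlt hr).eventually
    (gt_mem_nhds (show α < α + η by linarith))).exists
  set x₀ := G.symm^[k] r
  have hx₀ : x₀ ∈ Ioo α β := symm_iterate_mem_Ioo hα hβ hr k
  obtain ⟨l, hl⟩ := ((tendsto_orbit hα hβ hlt hx₀).eventually
    (lt_mem_nhds (show β - η < β by linarith))).exists
  set y₀ := G^[l] x₀
  have hy₀ : y₀ ∈ Ioo α β := iterate_mem_Ioo hα hβ hx₀ l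
  have hxy : x₀ ≤ y₀ := monotone_orbit hα hβ hlt hx₀ (Nat.zero_le l)
  set e := ENNReal.ofReal (ε / 4)
  have hright : ∀ n, eVariationOn ψ (Icc y₀ (G^[n] y₀)) ≤ n * e := fun n =>
    eVariationOn_orbit_le hα hβ hlt hy₀ n fun i _ => by
      refine (eVariationOn_fundamentalDomain_le_right hα hβ hlt hψ hθ hL
        (iterate_mem_Ioo hα hβ hy₀ i)).trans (ENNReal.ofReal_le_ofReal (hLη _ ?_))
      have : y₀ ≤ G^[i] y₀ := monotone_orbit hα hβ hlt hy₀ (Nat.zero_le i)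
      linarith
  set C := eVariationOn ψ (Icc x₀ y₀)
  have hC : C ≠ ∞ := by
    refine ne_top_of_le_ne_top ?_ (eVariationOn_orbit_le hα hβ hlt hx₀ l
      (e := ENNReal.ofReal (L * (β - α))) fun i _ => ?_)
    · exact ENNReal.mul_ne_top (by simp) ENNReal.ofReal_ne_top
    · have hi := iterate_mem_Ioo hα hβ hx₀ i
      refine (eVariationOn_fundamentalDomain_le_right hα hβ hlt hψ hθ hL hi).trans
        (ENNReal.ofReal_le_ofReal (mul_le_mul_of_nonneg_left ?_ hL))
      linarith [hi.1]
  refine ⟨C + C, ENNReal.add_ne_top.2 ⟨hC, hC⟩, fun n => ?_⟩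
  set w := G.symm^[n] x₀
  have hw : w ∈ Ioo α β := symm_iterate_mem_Ioo hα hβ hx₀ n
  have hwx : G^[n] w = x₀ := iterate_symm_iterate G n x₀
  have hwi : ∀ i ≤ n, G^[i] w ≤ x₀ := fun i hi => by
    rw [← hwx]; exact monotone_orbit hα hβ hlt hw hi
  have hwx₀ : w ≤ x₀ := hwi 0 (Nat.zero_le n)
  have hleft : eVariationOn ψ (Icc w x₀) ≤ n * e := by
    rw [← hwx]
    refine eVariationOn_orbit_le hα hβ hlt hw n fun i hi => ?_
    refine (eVariationOn_fundamentalDomain_le_left hα hβ hlt hψ hθ hL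
        (iterate_mem_Ioo hα hβ hw i)).trans (ENNReal.ofReal_le_ofReal (hLη _ ?_))
    linarith [hwi i hi.le]
  have hi_fix : ∀ i, G^[i] α = α := fun i => Function.iterate_fixed hα i
  have hi_fix' : ∀ i, G^[i] β = β := fun i => Function.iterate_fixed hβ i
  have h1 : eVariationOn (fun z => ψ (G^[n] z) - ψ z) (Icc α w) ≤ n * e := by
    refine (eVariationOn_coboundary_le_sum G ψ n _ _).trans ?_
    calc _ ≤ ∑ i ∈ Finset.range n, e := Finset.sum_le_sum fun i hi => by
          have hiw := iterate_mem_Ioo hα hβ hw i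
          rw [hi_fix]
          refine (hθ _ _ le_rfl hiw.1.le hiw.2.le).trans (ENNReal.ofReal_le_ofReal (hLη _ ?_))
          linarith [hwi i (Finset.mem_range.1 hi).le]
      _ = n * e := by simp
  have h3 : eVariationOn (fun z => ψ (G^[n] z) - ψ z) (Icc y₀ β) ≤ n * e := by
    refine (eVariationOn_coboundary_le_sum G ψ n _ _).trans ?_
    calc _ ≤ ∑ i ∈ Finset.range n, e := Finset.sum_le_sum fun i hi => by
          have hiy := iterate_mem_Ioo hα hβ hy₀ i
          rw [hi_fix']
          refine (hθ _ _ hiy.1.le hiy.2.le le_rfl).trans (ENNReal.ofReal_le_ofReal (hLη _ ?_))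
          have : y₀ ≤ G^[i] y₀ := monotone_orbit hα hβ hlt hy₀ (Nat.zero_le i)
          linarith
      _ = n * e := by simp
  have h2 : eVariationOn (fun z => ψ (G^[n] z) - ψ z) (Icc w y₀) ≤ (C + n * e) + (n * e + C) := by
    refine (eVariationOn_sub_le (f := fun z => ψ (G^[n] z)) _).trans (add_le_add ?_ ?_)
    · rw [eVariationOn_comp_orderIso_iterate, hwx, ← eVariationOn_Icc_add ψ hxy
        (monotone_orbit hα hβ hlt hy₀ (Nat.zero_le n))]
      exact add_le_add le_rfl (hright n)
    · rw [← eVariationOn_Icc_add ψ hwx₀ hxy]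
      exact add_le_add hleft le_rfl
  rw [← eVariationOn_Icc_add _ hw.1.le (hwx₀.trans (hxy.trans hy₀.2.le)),
    ← eVariationOn_Icc_add _ (hwx₀.trans hxy) hy₀.2.le]
  calc _ ≤ n * e + ((C + n * e) + (n * e + C) + n * e) := by gcongr
    _ = C + C + n * (4 * e) := by ring
    _ = _ := by
      congr 2
      rw [show (4 : ℝ≥0∞) = ENNReal.ofReal 4 by simp, ← ENNReal.ofReal_mul (by norm_num)]
      congr 1; ring

end Component

theorem eVariationOn_comp_neg (f : ℝ → ℝ) (x y : ℝ) :
    eVariationOn (fun z => f (-z)) (Icc x y) = eVariationOn f (Icc (-y) (-x)) := by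
  have h := eVariationOn.comp_eq_of_antitoneOn f (t := Icc x y) (fun z : ℝ => -z)
    (fun _ _ _ _ h => neg_le_neg h)
  rw [show (fun z : ℝ => -z) '' Icc x y = Icc (-y) (-x) by simp] at h
  exact h

/-- Conjugation of an increasing homeomorphism of the line by `x ↦ -x`. -/
def negConj (G : ℝ ≃o ℝ) : ℝ ≃o ℝ where
  toFun x := -G (-x)
  invFun x := -G.symm (-x)
  left_inv x := by simp
  right_inv x := by simp
  map_rel_iff' := by simp

theorem negConj_apply (G : ℝ ≃o ℝ) (x : ℝ) : negConj G x = -G (-x) := rfl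

theorem negConj_iterate (G : ℝ ≃o ℝ) (n : ℕ) (x : ℝ) :
    (negConj G)^[n] x = -G^[n] (-x) := by
  induction n with
  | zero => simp
  | succ n ih => rw [Function.iterate_succ_apply', ih, negConj_apply, neg_neg,
      Function.iterate_succ_apply']

theorem eVariationOn_coboundary_component {G : ℝ ≃o ℝ} {α β L : ℝ} {ψ : ℝ → ℝ}
    (hαβ : α < β) (hα : G α = α) (hβ : G β = β)
    (hne : ∀ x ∈ Ioo α β, G x ≠ x) (hψ : ContinuousOn ψ (Icc α β))
    (hθ : ∀ x y, α ≤ x → x ≤ y → y ≤ β →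
      eVariationOn (fun z => ψ (G z) - ψ z) (Icc x y) ≤ ENNReal.ofReal (L * (y - x)))
    (hL : 0 ≤ L) {ε : ℝ} (hε : 0 < ε) :
    ∃ C : ℝ≥0∞, C ≠ ∞ ∧ ∀ n : ℕ,
      eVariationOn (fun z => ψ (G^[n] z) - ψ z) (Icc α β) ≤ C + n * ENNReal.ofReal ε := by
  by_cases hlt : ∀ x ∈ Ioo α β, x < G x
  · exact eVariationOn_coboundary_component_of_lt hαβ hα hβ hlt hψ hθ hL hε
  have hgt : ∀ x ∈ Ioo α β, G x < x := by
    push Not at hlt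
    obtain ⟨r, hr, hGr⟩ := hlt
    by_contra! hcon
    obtain ⟨s, hs, hGs⟩ := hcon
    have := isPreconnected_Ioo.intermediate_value hr hs
      (f := fun x => G x - x) (G.continuous.sub continuous_id).continuousOn
    obtain ⟨t, ht, h0⟩ := this ⟨sub_nonpos.2 hGr, sub_nonneg.2 hGs⟩
    exact hne t ht (by simpa [sub_eq_zero] using h0)
  obtain ⟨C, hC, h⟩ := eVariationOn_coboundary_component_of_lt (G := negConj G) (α := -β)
    (β := -α) (ψ := fun z => ψ (-z)) (L := L) (neg_lt_neg hαβ)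
    (by rw [negConj_apply, neg_neg, hβ]) (by rw [negConj_apply, neg_neg, hα])
    (fun x hx => by
      rw [negConj_apply, lt_neg]
      exact hgt _ ⟨by linarith [hx.2], by linarith [hx.1]⟩)
    (hψ.comp continuous_neg.continuousOn fun x hx => ⟨by linarith [hx.2], by linarith [hx.1]⟩)
    (fun x y hx hxy hy => by
      simp only [negConj_apply, neg_neg]
      rw [eVariationOn_comp_neg (fun z => ψ (G z) - ψ z)]
      refine (hθ _ _ (by linarith) (by linarith) (by linarith)).trans_eq ?_
      congr 2; ring)
    hL hε
  refine ⟨C, hC, fun n => ?_⟩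
  have := h n
  simp only [negConj_iterate, neg_neg] at this
  rw [eVariationOn_comp_neg (fun z => ψ (G^[n] z) - ψ z), neg_neg, neg_neg] at this
  exact this

section Glue

variable {G : ℝ ≃o ℝ} {ψ : ℝ → ℝ} {a b : ℝ} {L : NNReal}

theorem isClosed_fixed (G : ℝ ≃o ℝ) : IsClosed {x | G x = x} :=
  isClosed_eq G.continuous continuous_id

theorem edist_coboundary_le_volume
    (hθ : LipschitzOnWith L (fun z => ψ (G z) - ψ z) (Icc a b)) {x y : ℝ}
    (hx : a ≤ x) (hxy : x ≤ y) (hy : y ≤ b) :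
    edist (ψ (G x) - ψ x) (ψ (G y) - ψ y) ≤
      L * volume.restrict {x | G x ≠ x} (Ioc x y) := by
  have hlip : ∀ u v, x ≤ u → u ≤ v → v ≤ y →
      edist (ψ (G u) - ψ u) (ψ (G v) - ψ v) ≤ L * volume (Ioo u v) := fun u v hu huv hv => by
    refine (hθ ⟨hx.trans hu, huv.trans (hv.trans hy)⟩
      ⟨hx.trans (hu.trans huv), hv.trans hy⟩).trans_eq ?_
    rw [Real.volume_Ioo, edist_dist, dist_comm, Real.dist_eq, abs_of_nonneg (by linarith)]
  have hcl := isClosed_fixed G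
  rw [Measure.restrict_apply measurableSet_Ioc]
  by_cases hne : (Icc x y ∩ {x | G x = x}).Nonempty
  · have hcomp : IsCompact (Icc x y ∩ {x | G x = x}) := isCompact_Icc.inter_right hcl
    obtain ⟨u, hu, hu'⟩ := hcomp.exists_isLeast hne
    obtain ⟨v, hv, hv'⟩ := hcomp.exists_isGreatest hne
    have hu0 : ψ (G u) - ψ u = 0 := by rw [hu.2, sub_self]
    have hv0 : ψ (G v) - ψ v = 0 := by rw [hv.2, sub_self]
    have huv : u ≤ v := hu' hv
    calc edist (ψ (G x) - ψ x) (ψ (G y) - ψ y)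
        ≤ edist (ψ (G x) - ψ x) (ψ (G u) - ψ u) + edist (ψ (G v) - ψ v) (ψ (G y) - ψ y) := by
          rw [hu0, hv0]; exact edist_triangle _ _ _
      _ ≤ L * volume (Ioo x u) + L * volume (Ioo v y) := by
          gcongr
          · exact hlip _ _ le_rfl hu.1.1 (huv.trans hv.1.2)
          · exact hlip _ _ (hu.1.1.trans huv) hv.1.2 le_rfl
      _ = L * volume (Ioo x u ∪ Ioo v y) := by
          rw [measure_union ?_ measurableSet_Ioo, mul_add]
          exact disjoint_left.2 fun z hz hz' => absurd (hz.2.trans_le huv) hz'.1.not_gt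
      _ ≤ _ := by
          gcongr
          rintro z (hz | hz)
          · have : z ≤ y := hz.2.le.trans hu.1.2
            exact ⟨⟨hz.1, this⟩, fun h => absurd (hu' ⟨⟨hz.1.le, this⟩, h⟩) hz.2.not_ge⟩
          · have : x < z := (hu.1.1.trans huv).trans_lt hz.1
            exact ⟨⟨this, hz.2.le⟩, fun h => absurd (hv' ⟨⟨this.le, hz.2.le⟩, h⟩) hz.1.not_ge⟩
  · refine (hlip x y le_rfl hxy le_rfl).trans ?_
    gcongr
    exact fun z hz => ⟨⟨hz.1, hz.2.le⟩, fun h => hne ⟨z, Ioo_subset_Icc_self hz, h⟩⟩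

theorem eVariationOn_coboundary_le_volume
    (hθ : LipschitzOnWith L (fun z => ψ (G z) - ψ z) (Icc a b)) {x y : ℝ}
    (hx : a ≤ x) (hy : y ≤ b) :
    eVariationOn (fun z => ψ (G z) - ψ z) (Icc x y) ≤
      L * volume.restrict {x | G x ≠ x} (Icc x y) := by
  refine iSup_le fun ⟨n, u, hu, us⟩ => ?_
  set μ := volume.restrict {x | G x ≠ x}
  have hsum : ∀ n, ∑ i ∈ Finset.range n, μ (Ioc (u i) (u (i + 1))) = μ (Ioc (u 0) (u n)) := by
    intro n
    induction n with
    | zero => simp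
    | succ n ih =>
      rw [Finset.sum_range_succ, ih, ← measure_union ?_ measurableSet_Ioc,
        Ioc_union_Ioc_eq_Ioc (hu (Nat.zero_le n)) (hu (Nat.le_succ n))]
      exact disjoint_left.2 fun z hz hz' => absurd hz.2 hz'.1.not_ge
  calc _ ≤ ∑ i ∈ Finset.range n, L * μ (Ioc (u i) (u (i + 1))) :=
        Finset.sum_le_sum fun i _ => by
          rw [edist_comm]
          exact edist_coboundary_le_volume hθ (hx.trans (us i).1) (hu (Nat.le_succ i))
            ((us (i + 1)).2.trans hy)
    _ = L * μ (Ioc (u 0) (u n)) := by rw [← Finset.mul_sum, hsum]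
    _ ≤ _ := by
        gcongr
        exact fun z hz => ⟨(us 0).1.trans hz.1.le, hz.2.trans (us n).2⟩

theorem eVariationOn_coboundary_iterate_le_volume
    (hθ : LipschitzOnWith L (fun z => ψ (G z) - ψ z) (Icc a b)) {p q : ℝ}
    (hp : a ≤ p) (hq : q ≤ b) (hGp : G p = p) (hGq : G q = q) (n : ℕ) :
    eVariationOn (fun z => ψ (G^[n] z) - ψ z) (Icc p q) ≤
      n * (L * volume.restrict {x | G x ≠ x} (Icc p q)) := by
  refine (eVariationOn_coboundary_le_sum G ψ n _ _).trans ?_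
  calc _ ≤ ∑ i ∈ Finset.range n, L * volume.restrict {x | G x ≠ x} (Icc p q) :=
        Finset.sum_le_sum fun i _ => by
          rw [Function.iterate_fixed hGp, Function.iterate_fixed hGq]
          exact eVariationOn_coboundary_le_volume hθ hp hq
    _ = _ := by simp

/-- The bounded open components of the complement of the fixed point set. -/
def FixedGap (G : ℝ ≃o ℝ) (c : ℝ × ℝ) : Prop :=
  c.1 < c.2 ∧ G c.1 = c.1 ∧ G c.2 = c.2 ∧ ∀ x ∈ Ioo c.1 c.2, G x ≠ x

theorem exists_fixedGap {x : ℝ} (ha : G a = a) (hb : G b = b) (hx : x ∈ Icc a b)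
    (hGx : G x ≠ x) : ∃ c, FixedGap G c ∧ x ∈ Ioo c.1 c.2 := by
  have hcl := isClosed_fixed G
  obtain ⟨u, hu, hu'⟩ := (isCompact_Icc.inter_right hcl).exists_isGreatest
    ⟨a, left_mem_Icc.2 hx.1, ha⟩
  obtain ⟨v, hv, hv'⟩ := (isCompact_Icc.inter_right hcl).exists_isLeast
    ⟨b, right_mem_Icc.2 hx.2, hb⟩
  have hux : u < x := lt_of_le_of_ne hu.1.2 fun h => hGx (h ▸ hu.2)
  have hxv : x < v := lt_of_le_of_ne hv.1.1 fun h => hGx (h ▸ hv.2)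
  refine ⟨(u, v), ⟨hux.trans hxv, hu.2, hv.2, fun z hz h => ?_⟩, hux, hxv⟩
  rcases le_total z x with hzx | hzx
  · exact absurd (hu' ⟨⟨hu.1.1.trans hz.1.le, hzx⟩, h⟩) hz.1.not_ge
  · exact absurd (hv' ⟨⟨hzx, hz.2.le.trans hv.1.2⟩, h⟩) hz.2.not_ge

theorem eVariationOn_coboundary_le_of_gaps (hψ : ContinuousOn ψ (Icc a b))
    (hθ : LipschitzOnWith L (fun z => ψ (G z) - ψ z) (Icc a b))
    (s : Finset (ℝ × ℝ)) (hs : ∀ c ∈ s, FixedGap G c) :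
    ∀ p q, a ≤ p → p ≤ q → q ≤ b → G p = p → G q = q → ∀ ε : ℝ, 0 < ε →
      ∃ C : ℝ≥0∞, C ≠ ∞ ∧ ∀ n : ℕ,
        eVariationOn (fun z => ψ (G^[n] z) - ψ z) (Icc p q) ≤
          C + n * (L * volume.restrict {x | G x ≠ x} (Icc p q \ ⋃ c ∈ s, Ioo c.1 c.2) +
            ENNReal.ofReal ε) := by
  classical
  set μ := volume.restrict {x | G x ≠ x} with hμ
  induction s using Finset.induction_on with
  | empty =>
    intro p q hp hpq hq hGp hGq ε hε
    refine ⟨0, by simp, fun n => ?_⟩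
    refine (eVariationOn_coboundary_iterate_le_volume hθ hp hq hGp hGq n).trans ?_
    simp only [Finset.notMem_empty, iUnion_of_empty, iUnion_empty, sdiff_empty, zero_add]
    gcongr
    exact le_self_add
  | insert c s _ ih =>
    intro p q hp hpq hq hGp hGq ε hε
    obtain ⟨hlt, h1, h2, hgap⟩ := hs c (Finset.mem_insert_self _ _)
    have ih := ih fun d hd => hs d (Finset.mem_insert_of_mem hd)
    by_cases hin : p ≤ c.1 ∧ c.2 ≤ q
    · obtain ⟨hpc, hcq⟩ := hin
      obtain ⟨C₁, hC₁, H₁⟩ := ih p c.1 hp hpc (hlt.le.trans (hcq.trans hq)) hGp h1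
        (ε / 3) (by positivity)
      obtain ⟨C₃, hC₃, H₃⟩ := ih c.2 q (hp.trans (hpc.trans hlt.le)) hcq hq h2 hGq
        (ε / 3) (by positivity)
      have hsub : Icc c.1 c.2 ⊆ Icc a b := Icc_subset_Icc (hp.trans hpc) (hcq.trans hq)
      obtain ⟨C₂, hC₂, H₂⟩ := eVariationOn_coboundary_component (L := L) hlt h1 h2 hgap
        (hψ.mono hsub)
        (fun x y hx hxy hy => by
          refine (eVariationOn_coboundary_le_volume hθ (hsub ⟨hx, hxy.trans hy⟩).1
            (hsub ⟨hx.trans hxy, hy⟩).2).trans ?_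
          rw [ENNReal.ofReal_mul L.coe_nonneg, ENNReal.ofReal_coe_nnreal, ← Real.volume_Icc]
          gcongr
          exact Measure.restrict_le_self)
        L.coe_nonneg (show 0 < ε / 3 by positivity)
      refine ⟨C₁ + C₂ + C₃, by simp [hC₁, hC₂, hC₃], fun n => ?_⟩
      rw [← eVariationOn_Icc_add _ (hpc.trans hlt.le) hcq, ← eVariationOn_Icc_add _ hpc hlt.le]
      set A₁ := Icc p c.1 \ ⋃ c ∈ s, Ioo c.1 c.2
      set A₃ := Icc c.2 q \ ⋃ c ∈ s, Ioo c.1 c.2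
      have hmeas : MeasurableSet A₃ := measurableSet_Icc.diff
        (Finset.measurableSet_biUnion _ fun _ _ => measurableSet_Ioo)
      have hA : μ A₁ + μ A₃ ≤ μ (Icc p q \ ⋃ d ∈ insert c s, Ioo d.1 d.2) := by
        rw [← measure_union (disjoint_left.2 fun z hz hz' =>
          absurd (hz'.1.1.trans hz.1.2) hlt.not_ge) hmeas]
        refine measure_mono ?_
        simp only [Finset.set_biUnion_insert]
        rintro z (hz | hz)
        · exact ⟨⟨hz.1.1, hz.1.2.trans (hlt.le.trans hcq)⟩, fun h => h.elim
            (fun h => absurd hz.1.2 h.1.not_ge) hz.2⟩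
        · exact ⟨⟨(hpc.trans hlt.le).trans hz.1.1, hz.1.2⟩, fun h => h.elim
            (fun h => absurd hz.1.1 h.2.not_ge) hz.2⟩
      set e := ENNReal.ofReal (ε / 3)
      have he : ENNReal.ofReal ε = 3 * e := by
        rw [show (3 : ℝ≥0∞) = ENNReal.ofReal 3 by simp, ← ENNReal.ofReal_mul (by norm_num)]
        congr 1; ring
      rw [he]
      calc _ ≤ (C₁ + n * (L * μ A₁ + e)) + (C₂ + n * e) + (C₃ + n * (L * μ A₃ + e)) := by
            gcongr
            · exact H₁ n
            · exact H₂ n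
            · exact H₃ n
        _ = C₁ + C₂ + C₃ + n * (L * (μ A₁ + μ A₃) + 3 * e) := by ring
        _ ≤ _ := by gcongr
    · obtain ⟨C, hC, H⟩ := ih p q hp hpq hq hGp hGq ε hε
      refine ⟨C, hC, fun n => (H n).trans ?_⟩
      gcongr 2
      refine add_le_add_left (mul_le_mul_right (measure_mono ?_) _) _
      simp only [Finset.set_biUnion_insert]
      refine fun z hz => ⟨hz.1, fun h => h.elim (fun h => hin ⟨?_, ?_⟩) hz.2⟩
      · by_contra! hcon
        exact hgap p ⟨hcon, hz.1.1.trans_lt h.2⟩ hGp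
      · by_contra! hcon
        exact hgap q ⟨h.1.trans_le hz.1.2, hcon⟩ hGq

/-- A Lipschitz coboundary of a continuous function over an increasing homeomorphism of a compact
interval has Birkhoff sums of sublinear variation. -/
theorem tendsto_eVariationOn_coboundary_div (hab : a ≤ b) (ha : G a = a) (hb : G b = b)
    (hψ : ContinuousOn ψ (Icc a b))
    (hθ : LipschitzOnWith L (fun z => ψ (G z) - ψ z) (Icc a b)) :
    Tendsto (fun n : ℕ => eVariationOn (fun z => ψ (G^[n] z) - ψ z) (Icc a b) / n)
      atTop (𝓝 0) := by
  refine tendsto_div_of_forall_le_add fun ε hε => ?_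
  obtain ⟨δ, hδ, hδε⟩ : ∃ δ : ℝ, 0 < δ ∧ (L + 1) * ENNReal.ofReal δ ≤ ε := by
    have hlim : Tendsto (fun t : ℝ => ((L : ℝ≥0∞) + 1) * ENNReal.ofReal t) (𝓝[>] 0) (𝓝 0) := by
      have := ENNReal.Tendsto.const_mul (a := (L : ℝ≥0∞) + 1)
        (ENNReal.tendsto_ofReal (tendsto_id.mono_left nhdsWithin_le_nhds :
          Tendsto (fun t : ℝ => t) (𝓝[>] 0) (𝓝 0))) (Or.inr (by simp))
      simpa using this
    obtain ⟨δ, h1, h2⟩ := ((ENNReal.tendsto_nhds_zero.1 hlim ε (pos_iff_ne_zero.2 hε)).and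
      self_mem_nhdsWithin).exists
    exact ⟨δ, h2, h1⟩
  have hopen : IsOpen {x | G x ≠ x} := (isClosed_fixed G).isOpen_compl
  have hmeas : MeasurableSet (Icc a b ∩ {x | G x ≠ x}) := measurableSet_Icc.inter hopen.measurableSet
  have hfin : volume (Icc a b ∩ {x | G x ≠ x}) ≠ ∞ :=
    measure_ne_top_of_subset inter_subset_left (by simp)
  obtain ⟨K, hKs, hK, hKδ⟩ := hmeas.exists_isCompact_sdiff_lt hfin
    (ENNReal.ofReal_pos.2 hδ).ne'
  choose! c hc hxc using fun x (hx : x ∈ K) =>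
    exists_fixedGap ha hb (hKs hx).1 (hKs hx).2
  classical
  obtain ⟨t, ht, hcover⟩ := hK.elim_nhds_subcover (fun x => Ioo (c x).1 (c x).2)
    fun x hx => isOpen_Ioo.mem_nhds (hxc x hx)
  obtain ⟨C, hC, H⟩ := eVariationOn_coboundary_le_of_gaps hψ hθ (t.image c)
    (fun d hd => by
      obtain ⟨x, hx, rfl⟩ := Finset.mem_image.1 hd
      exact hc x (ht x hx)) a b le_rfl hab le_rfl ha hb δ hδ
  refine ⟨C, hC, fun n => (H n).trans ?_⟩
  gcongr
  refine le_trans ?_ hδε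
  rw [add_mul, one_mul]
  gcongr
  rw [Measure.restrict_apply' hopen.measurableSet]
  refine (measure_mono ?_).trans hKδ.le
  intro z hz
  refine ⟨⟨hz.1.1, hz.2⟩, fun hzK => hz.1.2 ?_⟩
  obtain ⟨x, hx, hzx⟩ := mem_iUnion₂.1 (hcover hzK)
  exact mem_iUnion₂.2 ⟨c x, Finset.mem_image_of_mem _ hx, hzx⟩

end Glue

/-! ### Combinatorics of irrational rotations -/

/-- `q` and `q'` are consecutive closest return times of the rotation by `α`, and `p`, `p'` are the
corresponding nearest integers. -/
structure ClosestReturn (α : ℝ) (q q' : ℕ) (p p' : ℤ) : Prop where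
  pos : 0 < q
  lt : q < q'
  ne : q * α - p ≠ 0
  lt_one : |q * α - p| < 1
  le_abs : ∀ j : ℕ, 0 < j → j < q' → ∀ k : ℤ, |q * α - p| ≤ |j * α - k|
  abs_succ_lt : |q' * α - p'| < |q * α - p|

theorem exists_closestReturn {α : ℝ} (hα : ∀ j : ℕ, 0 < j → ∀ k : ℤ, j * α ≠ k) {η : ℝ}
    (hη : 0 < η) : ∃ q q' p p', ClosestReturn α q q' p p' ∧ |q * α - p| < η := by
  let d : ℕ → ℝ := fun j => |j * α - round (j * α)|
  have hdk : ∀ (j : ℕ) (k : ℤ), d j ≤ |j * α - k| := fun j k => round_le _ _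
  have hd : ∀ j, 0 < j → 0 < d j := fun j hj => abs_pos.2 (sub_ne_zero.2 (hα j hj _))
  have hdir : ∀ t : ℝ, 0 < t → ∃ j, 0 < j ∧ d j < t := fun t ht => by
    obtain ⟨n, hn⟩ := exists_nat_gt (1 / t)
    have hn0 : 0 < n := by
      have : (0 : ℝ) < n := (by positivity : 0 < 1 / t).trans hn
      exact_mod_cast this
    obtain ⟨k, hk, -, hkd⟩ := Real.exists_nat_abs_mul_sub_round_le α hn0
    refine ⟨k, hk, hkd.trans_lt ?_⟩
    rw [div_lt_comm₀ (by positivity) ht]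
    linarith
  obtain ⟨j₀, hj₀, hdj₀⟩ := hdir (min η 1) (by positivity)
  obtain ⟨q, hq, hqmin⟩ := Finset.exists_min_image (Finset.Icc 1 j₀) d ⟨1, by simp; omega⟩
  have hq' := Finset.mem_Icc.1 hq
  have hdq : d q < min η 1 := (hqmin j₀ (by simp; omega)).trans_lt hdj₀
  have hex : ∃ j, 0 < j ∧ d j < d q := hdir _ (hd q (by omega))
  classical
  have hspec := Nat.find_spec hex
  have hmin : ∀ j, 0 < j → j < Nat.find hex → d q ≤ d j := fun j hj hlt => by
    have := Nat.find_min hex hlt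
    push Not at this
    exact this hj
  refine ⟨q, Nat.find hex, round (q * α), round (Nat.find hex * α),
    ⟨by omega, ?_, sub_ne_zero.2 (hα q (by omega) _), hdq.trans_le (min_le_right _ _),
      fun j hj hlt k => (hmin j hj hlt).trans (hdk j k), hspec.2⟩, hdq.trans_le (min_le_left _ _)⟩
  by_contra! hcon
  exact absurd (hqmin _ (Finset.mem_Icc.2 ⟨hspec.1, hcon.trans hq'.2⟩)) hspec.2.not_ge

theorem exists_forall_le_abs {α : ℝ} (hα : ∀ j : ℕ, 0 < j → ∀ k : ℤ, j * α ≠ k) (n : ℕ) :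
    ∃ η > 0, ∀ j : ℕ, 0 < j → j ≤ n → ∀ k : ℤ, η ≤ |j * α - k| := by
  induction n with
  | zero => exact ⟨1, one_pos, fun j hj hj' => by omega⟩
  | succ n ih =>
    obtain ⟨η, hη, h⟩ := ih
    refine ⟨min η |(n + 1 : ℕ) * α - round ((n + 1 : ℕ) * α)|, lt_min hη
      (abs_pos.2 (sub_ne_zero.2 (hα _ n.succ_pos _))), fun j hj hj' k => ?_⟩
    rcases Nat.lt_or_ge n j with hlt | hle
    · obtain rfl : j = n + 1 := by omega
      exact (min_le_right _ _).trans (round_le _ _)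
    · exact (min_le_left _ _).trans (h j hj hle k)

/-- The family `P i k` is ordered as the numbers `i * α + k`. -/
def RotationOrdered (α : ℝ) (P : ℕ → ℤ → ℝ) : Prop :=
  ∀ i k j l, P i k < P j l ↔ i * α + k < j * α + l

theorem RotationOrdered.neg {α : ℝ} {P : ℕ → ℤ → ℝ} (h : RotationOrdered α P) :
    RotationOrdered (-α) fun i k => -P i (-k) := fun i k j l => by
  rw [neg_lt_neg_iff, h]
  push_cast
  constructor <;> intro h' <;> linarith

theorem ClosestReturn.neg {α : ℝ} {q q' : ℕ} {p p' : ℤ} (h : ClosestReturn α q q' p p') :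
    ClosestReturn (-α) q q' (-p) (-p') := by
  have key : ∀ (j : ℕ) (k : ℤ), |j * -α - k| = |j * α - (-k : ℤ)| := fun j k => by
    rw [← abs_neg]; congr 1; push_cast; ring
  refine ⟨h.pos, h.lt, ?_, ?_, fun j hj hj' k => ?_, ?_⟩
  · have := h.ne
    contrapose! this
    push_cast at this
    linarith
  · rw [key, neg_neg]; exact h.lt_one
  · rw [key, key, neg_neg]; exact h.le_abs j hj hj' _
  · rw [key, key, neg_neg, neg_neg]; exact h.abs_succ_lt

theorem ClosestReturn.eq_of_overlap {α : ℝ} {q q' : ℕ} {p p' : ℤ} (h : ClosestReturn α q q' p p')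
    {P : ℕ → ℤ → ℝ} (hP : RotationOrdered α P) {i j : ℕ} {k l : ℤ} (hij : i < j + q')
    (hji : j < i + q') {t : ℝ}
    (hi : t ∈ Ioo (min (P i k) (P (i + q) (k - p))) (max (P i k) (P (i + q) (k - p))))
    (hj : t ∈ Ioo (min (P j l) (P (j + q) (l - p))) (max (P j l) (P (j + q) (l - p)))) :
    i = j ∧ k = l := by
  have hlt : |(i * α + k) - (j * α + l)| < |q * α - p| := by
    rw [abs_lt]
    rcases lt_or_gt_of_ne h.ne with hβ | hβ
    · have hP1 : ∀ (i : ℕ) (k : ℤ), P (i + q) (k - p) < P i k := fun i k => by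
        rw [hP]; push_cast; linarith
      rw [min_eq_right (hP1 i k).le, max_eq_left (hP1 i k).le] at hi
      rw [min_eq_right (hP1 j l).le, max_eq_left (hP1 j l).le] at hj
      have h1 := (hP _ _ _ _).1 (hi.1.trans hj.2)
      have h2 := (hP _ _ _ _).1 (hj.1.trans hi.2)
      push_cast at h1 h2
      rw [abs_of_neg hβ]
      constructor <;> linarith
    · have hP1 : ∀ (i : ℕ) (k : ℤ), P i k < P (i + q) (k - p) := fun i k => by
        rw [hP]; push_cast; linarith
      rw [max_eq_right (hP1 i k).le, min_eq_left (hP1 i k).le] at hi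
      rw [max_eq_right (hP1 j l).le, min_eq_left (hP1 j l).le] at hj
      have h1 := (hP _ _ _ _).1 (hi.1.trans hj.2)
      have h2 := (hP _ _ _ _).1 (hj.1.trans hi.2)
      push_cast at h1 h2
      rw [abs_of_pos hβ]
      constructor <;> linarith
  rcases lt_trichotomy i j with hlt' | rfl | hlt'
  · obtain ⟨m, rfl⟩ := Nat.exists_eq_add_of_lt hlt'
    have := h.le_abs (m + 1) (by omega) (by omega) (k - l)
    rw [← abs_neg] at hlt
    refine absurd hlt (not_lt.2 (this.trans_eq ?_))
    congr 1; push_cast; ring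
  · refine ⟨rfl, ?_⟩
    have h1 : |((k - l : ℤ) : ℝ)| < 1 := by
      refine lt_of_eq_of_lt ?_ (hlt.trans h.lt_one)
      congr 1; push_cast; ring
    rw [← Int.cast_abs] at h1
    have h2 : |k - l| < 1 := by exact_mod_cast h1
    exact sub_eq_zero.1 (Int.abs_lt_one_iff.1 h2)
  · obtain ⟨m, rfl⟩ := Nat.exists_eq_add_of_lt hlt'
    have := h.le_abs (m + 1) (by omega) (by omega) (l - k)
    refine absurd hlt (not_lt.2 (this.trans_eq ?_))
    congr 1; push_cast; ring

theorem ClosestReturn.exists_mem_Icc_of_pos {α : ℝ} {q q' : ℕ} {p p' : ℤ}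
    (h : ClosestReturn α q q' p p') {P : ℕ → ℤ → ℝ} (hP : RotationOrdered α P)
    (hadd : ∀ i k, P i k = P i 0 + k) (hβ : 0 < q * α - p) (t : ℝ) :
    ∃ i < q + q', ∃ k, t ∈ Icc (P i k) (P (i + q) (k - p)) := by
  obtain ⟨i, hi, hmax⟩ := Finset.exists_max_image (Finset.range q')
    (fun i => P i ⌊t - P i 0⌋) ⟨0, Finset.mem_range.2 (h.pos.trans h.lt)⟩
  rw [Finset.mem_range] at hi
  set k := ⌊t - P i 0⌋
  have hit : P i k ≤ t := by
    rw [hadd]; linarith [Int.floor_le (t - P i 0)]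
  have hnext : ∀ j < q', ∀ l, P i k < P j l → t < P j l := fun j hj l hlt => by
    by_contra! hcon
    rw [hadd] at hcon
    have : l ≤ ⌊t - P j 0⌋ := Int.le_floor.2 (by linarith)
    have h1 : P j l ≤ P j ⌊t - P j 0⌋ := by
      rw [hadd, hadd j ⌊_⌋]
      have : (l : ℝ) ≤ (⌊t - P j 0⌋ : ℤ) := by exact_mod_cast this
      linarith
    exact absurd (h1.trans (hmax j (Finset.mem_range.2 hj))) hlt.not_ge
  have hq := h.lt
  by_cases hiq : i + q < q'
  · exact ⟨i, by omega, k, hit, (hnext _ hiq _ (by rw [hP]; push_cast; linarith)).le⟩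
  · have habs := h.abs_succ_lt
    rw [abs_of_pos hβ, abs_lt] at habs
    obtain ⟨j, hj⟩ : ∃ j, i + q = j + q' := ⟨i + q - q', by omega⟩
    have hjr : (i : ℝ) + q = j + q' := by exact_mod_cast hj
    have hjr' : (j : ℝ) * α = i * α + q * α - q' * α := by
      rw [← add_mul, hjr]; ring
    have hjt : t < P j (k - p + p') := hnext j (by omega) _ (by
      rw [hP]; push_cast; linarith)
    rcases le_or_gt t (P (i + q) (k - p)) with hle | hgt
    · exact ⟨i, by omega, k, hit, hle⟩
    · refine ⟨i + q, by omega, k - p, hgt.le, hjt.le.trans (le_of_lt ?_)⟩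
      rw [hP]; push_cast; linarith

theorem ClosestReturn.exists_mem_Icc {α : ℝ} {q q' : ℕ} {p p' : ℤ}
    (h : ClosestReturn α q q' p p') {P : ℕ → ℤ → ℝ} (hP : RotationOrdered α P)
    (hadd : ∀ i k, P i k = P i 0 + k) (t : ℝ) :
    ∃ i < q + q', ∃ k,
      t ∈ Icc (min (P i k) (P (i + q) (k - p))) (max (P i k) (P (i + q) (k - p))) := by
  rcases lt_or_gt_of_ne h.ne with hβ | hβ
  · obtain ⟨i, hi, k, h1, h2⟩ := h.neg.exists_mem_Icc_of_pos hP.neg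
      (fun i k => by rw [hadd]; push_cast; simp; ring) (by push_cast; linarith) (-t)
    refine ⟨i, hi, -k, min_le_of_right_le ?_, le_max_of_le_left (by linarith)⟩
    rw [show -k - p = -(k - -p) by ring]
    linarith
  · obtain ⟨i, hi, k, h1, h2⟩ := h.exists_mem_Icc_of_pos hP hadd hβ t
    exact ⟨i, hi, k, min_le_of_left_le h1, le_max_of_le_right h2⟩

/-! ### Lifts of circle homeomorphisms without periodic points -/

/-- The degree one lift given by an increasing homeomorphism commuting with the unit translation. -/
def degOneLift (G : ℝ ≃o ℝ) (h1 : ∀ x, G (x + 1) = G x + 1) : CircleDeg1Lift :=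
  CircleDeg1Lift.mk G.toOrderEmbedding.toOrderHom h1

theorem iterate_add_int {G : ℝ ≃o ℝ} (h1 : ∀ x, G (x + 1) = G x + 1) (n : ℕ) (x : ℝ) (k : ℤ) :
    G^[n] (x + k) = G^[n] x + k := by
  have := (degOneLift G h1 ^ n).map_add_int x k
  rwa [CircleDeg1Lift.coe_pow] at this

theorem exists_rotationOrdered {G : ℝ ≃o ℝ} (h1 : ∀ x, G (x + 1) = G x + 1)
    (hper : ∀ n : ℕ, 0 < n → ∀ (x : ℝ) (k : ℤ), G^[n] x ≠ x + k) :
    ∃ α : ℝ, (∀ j : ℕ, 0 < j → ∀ k : ℤ, j * α ≠ k) ∧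
      ∀ x, RotationOrdered α fun i k => G^[i] x + k := by
  set f := degOneLift G h1
  have hf : Continuous f := G.continuous
  have hfn : ∀ n x, (f ^ n) x = G^[n] x := fun n x => by rw [CircleDeg1Lift.coe_pow]; rfl
  set α := f.translationNumber
  have hne : ∀ j : ℕ, 0 < j → ∀ k : ℤ, j * α ≠ k := fun j hj k h => by
    rw [← CircleDeg1Lift.translationNumber_pow,
      CircleDeg1Lift.translationNumber_eq_int_iff _ (f.continuous_pow hf j)] at h
    obtain ⟨x, hx⟩ := h
    exact hper j hj x k (by rw [← hfn, hx])
  have hlt : ∀ (m : ℕ) (y : ℝ) (k : ℤ), m * α < k → G^[m] y < y + k := fun m y k h => by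
    rw [← hfn]
    exact (f ^ m).map_lt_of_translationNumber_lt_int
      (by rwa [CircleDeg1Lift.translationNumber_pow]) y
  have hgt : ∀ (m : ℕ) (y : ℝ) (k : ℤ), k < m * α → y + k < G^[m] y := fun m y k h => by
    rw [← hfn]
    exact (f ^ m).lt_map_of_int_lt_translationNumber
      (by rwa [CircleDeg1Lift.translationNumber_pow]) y
  have hcomp : ∀ (x : ℝ) (i m : ℕ), G^[i + m] x = G^[m] (G^[i] x) := fun x i m => by
    rw [add_comm, Function.iterate_add_apply]
  have hforward : ∀ (x : ℝ) (i : ℕ) (k : ℤ) (j : ℕ) (l : ℤ), (i : ℝ) * α + k < j * α + l →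
      G^[i] x + k < G^[j] x + l := fun x i k j l h => by
    rcases le_total i j with hij | hij
    · obtain ⟨m, rfl⟩ := Nat.exists_eq_add_of_le hij
      rw [hcomp]
      have := hgt m (G^[i] x) (k - l) (by push_cast at h ⊢; linarith)
      push_cast at this
      linarith
    · obtain ⟨m, rfl⟩ := Nat.exists_eq_add_of_le hij
      rw [hcomp]
      have := hlt m (G^[j] x) (l - k) (by push_cast at h ⊢; linarith)
      push_cast at this
      linarith
  refine ⟨α, hne, fun x i k j l => ⟨fun h => ?_, hforward x i k j l⟩⟩
  rcases lt_trichotomy ((i : ℝ) * α + k) (j * α + l) with h' | h' | h'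
  · exact h'
  · exfalso
    rcases lt_trichotomy i j with hij | rfl | hij
    · obtain ⟨m, rfl⟩ := Nat.exists_eq_add_of_lt hij
      exact hne (m + 1) m.succ_pos (k - l) (by push_cast at h' ⊢; linarith)
    · have : (k : ℝ) = l := by linarith
      simp only [this] at h
      exact lt_irrefl _ h
    · obtain ⟨m, rfl⟩ := Nat.exists_eq_add_of_lt hij
      exact hne (m + 1) m.succ_pos (l - k) (by push_cast at h' ⊢; linarith)
  · exact absurd h (hforward x j l i k h').not_gt

/-! ### Packings and coverings of the circle by arcs -/

theorem setLIntegral_eq_tsum_translates {F : ℝ → ℝ≥0∞} (hF : Function.Periodic F 1) {s : Set ℝ}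
    (hs : MeasurableSet s) :
    ∫⁻ x in s, F x = ∑' k : ℤ, ∫⁻ x in Ico 0 1 ∩ (fun x : ℝ => x + k) ⁻¹' s, F x := by
  have hdecomp : s = ⋃ k : ℤ, Ico (k : ℝ) (k + 1) ∩ s := by
    rw [← iUnion_inter, iUnion_Ico_intCast, univ_inter]
  conv_lhs => rw [hdecomp]
  rw [lintegral_iUnion (fun k => measurableSet_Ico.inter hs)
    (fun i j hij => (pairwise_disjoint_Ico_intCast ℝ hij).mono inter_subset_left inter_subset_left)]
  refine tsum_congr fun k => ?_
  have h := (measurePreserving_add_right volume (k : ℝ)).setLIntegral_comp_preimage_emb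
    (MeasurableEquiv.addRight (k : ℝ)).measurableEmbedding F (Ico (k : ℝ) (k + 1) ∩ s)
  rw [← h]
  have hset : (fun x : ℝ => x + k) ⁻¹' (Ico (k : ℝ) (k + 1) ∩ s) =
      Ico 0 1 ∩ (fun x : ℝ => x + k) ⁻¹' s := by
    ext x
    simp only [mem_preimage, mem_inter_iff, mem_Ico]
    constructor <;> rintro ⟨⟨h1, h2⟩, h3⟩ <;> exact ⟨⟨by linarith, by linarith⟩, h3⟩
  rw [hset]
  refine lintegral_congr fun x => ?_
  have := hF.int_mul k x
  simpa using this

theorem measurableSet_translate_inter {s : Set ℝ} (hs : MeasurableSet s) (k : ℤ) :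
    MeasurableSet (Ico (0 : ℝ) 1 ∩ (fun x : ℝ => x + k) ⁻¹' s) :=
  measurableSet_Ico.inter ((measurable_add_const (k : ℝ)) hs)

theorem sum_setLIntegral_le_of_packing {ι : Type*} {F : ℝ → ℝ≥0∞} (hF : Function.Periodic F 1)
    {t : Finset ι} {s : ι → Set ℝ} (hs : ∀ i, MeasurableSet (s i))
    (hdisj : ∀ i ∈ t, ∀ j ∈ t, ∀ (k l : ℤ) (x : ℝ), x + k ∈ s i → x + l ∈ s j → i = j ∧ k = l) :
    ∑ i ∈ t, ∫⁻ x in s i, F x ≤ ∫⁻ x in Ico 0 1, F x := by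
  have hB : ∀ i ∈ t, ∫⁻ x in s i, F x =
      ∫⁻ x in ⋃ k : ℤ, Ico 0 1 ∩ (fun x : ℝ => x + k) ⁻¹' s i, F x := fun i hi => by
    rw [setLIntegral_eq_tsum_translates hF (hs i),
      lintegral_iUnion fun k => measurableSet_translate_inter (hs i) k]
    exact fun k l hkl => disjoint_left.2 fun x hx hx' =>
      hkl (hdisj i hi i hi k l x hx.2 hx'.2).2
  rw [Finset.sum_congr rfl hB, ← lintegral_biUnion_finset]
  · exact lintegral_mono_set (iUnion₂_subset fun i _ => iUnion_subset fun k => inter_subset_left)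
  · intro i hi j hj hij
    refine disjoint_left.2 fun x hx hx' => ?_
    obtain ⟨k, hk⟩ := mem_iUnion.1 hx
    obtain ⟨l, hl⟩ := mem_iUnion.1 hx'
    exact hij (hdisj i hi j hj k l x hk.2 hl.2).1
  · exact fun i _ => MeasurableSet.iUnion fun k => measurableSet_translate_inter (hs i) k

theorem setLIntegral_le_sum_of_covering {ι : Type*} {F : ℝ → ℝ≥0∞} (hF : Function.Periodic F 1)
    {t : Finset ι} {s : ι → Set ℝ} (hs : ∀ i, MeasurableSet (s i))
    (hcover : ∀ x : ℝ, ∃ i ∈ t, ∃ k : ℤ, x + k ∈ s i) :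
    ∫⁻ x in Ico 0 1, F x ≤ ∑ i ∈ t, ∫⁻ x in s i, F x := by
  calc ∫⁻ x in Ico 0 1, F x
      ≤ ∫⁻ x in ⋃ r : t × ℤ, Ico 0 1 ∩ (fun x : ℝ => x + r.2) ⁻¹' s r.1, F x := by
        refine lintegral_mono_set fun x hx => ?_
        obtain ⟨i, hi, k, hk⟩ := hcover x
        exact mem_iUnion.2 ⟨(⟨i, hi⟩, k), hx, hk⟩
    _ ≤ ∑' r : t × ℤ, ∫⁻ x in Ico 0 1 ∩ (fun x : ℝ => x + r.2) ⁻¹' s r.1, F x :=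
        lintegral_iUnion_le _ _
    _ = ∑ i ∈ t, ∫⁻ x in s i, F x := by
        rw [ENNReal.tsum_prod (f := fun (i : t) (k : ℤ) =>
          ∫⁻ x in Ico 0 1 ∩ (fun x : ℝ => x + k) ⁻¹' s i, F x), tsum_fintype, ← Finset.sum_coe_sort t]
        exact Finset.sum_congr rfl fun i _ => (setLIntegral_eq_tsum_translates hF (hs i)).symm

theorem ofReal_intervalIntegral {F : ℝ → ℝ} (hF : Continuous F) (h0 : ∀ x, 0 ≤ F x) {a b : ℝ}
    (hab : a ≤ b) : ENNReal.ofReal (∫ x in a..b, F x) = ∫⁻ x in Icc a b, ENNReal.ofReal (F x) := by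
  rw [intervalIntegral.integral_of_le hab, ← integral_Icc_eq_integral_Ioc,
    ofReal_integral_eq_lintegral_ofReal hF.continuousOn.integrableOn_Icc
      (Eventually.of_forall h0)]

theorem sum_integral_le_of_packing {ι : Type*} {F : ℝ → ℝ} (hF : Continuous F)
    (h0 : ∀ x, 0 ≤ F x) (hper : Function.Periodic F 1) {t : Finset ι} {y z : ι → ℝ}
    (hyz : ∀ i, y i ≤ z i)
    (hdisj : ∀ i ∈ t, ∀ j ∈ t, ∀ (k l : ℤ) (x : ℝ),
      x + k ∈ Ioo (y i) (z i) → x + l ∈ Ioo (y j) (z j) → i = j ∧ k = l) :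
    ∑ i ∈ t, ∫ x in y i..z i, F x ≤ ∫ x in (0 : ℝ)..1, F x := by
  have hnn : ∀ a b : ℝ, a ≤ b → 0 ≤ ∫ x in a..b, F x := fun a b hab =>
    intervalIntegral.integral_nonneg hab fun x _ => h0 x
  rw [← ENNReal.ofReal_le_ofReal_iff (hnn _ _ zero_le_one),
    ENNReal.ofReal_sum_of_nonneg fun i _ => hnn _ _ (hyz i),
    ofReal_intervalIntegral hF h0 zero_le_one, ← restrict_Ico_eq_restrict_Icc]
  refine le_trans (Finset.sum_le_sum fun i _ => ?_) (sum_setLIntegral_le_of_packing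
    (F := fun x => ENNReal.ofReal (F x)) (fun x => by simp only [hper x])
    (fun i => measurableSet_Ioo) hdisj)
  rw [ofReal_intervalIntegral hF h0 (hyz i), restrict_Ioo_eq_restrict_Icc]

theorem integral_le_sum_of_covering {ι : Type*} {F : ℝ → ℝ} (hF : Continuous F)
    (h0 : ∀ x, 0 ≤ F x) (hper : Function.Periodic F 1) {t : Finset ι} {y z : ι → ℝ}
    (hyz : ∀ i, y i ≤ z i)
    (hcover : ∀ x : ℝ, ∃ i ∈ t, ∃ k : ℤ, x + k ∈ Icc (y i) (z i)) :
    ∫ x in (0 : ℝ)..1, F x ≤ ∑ i ∈ t, ∫ x in y i..z i, F x := by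
  have hnn : ∀ a b : ℝ, a ≤ b → 0 ≤ ∫ x in a..b, F x := fun a b hab =>
    intervalIntegral.integral_nonneg hab fun x _ => h0 x
  rw [← ENNReal.ofReal_le_ofReal_iff (Finset.sum_nonneg fun i _ => hnn _ _ (hyz i)),
    ENNReal.ofReal_sum_of_nonneg fun i _ => hnn _ _ (hyz i),
    ofReal_intervalIntegral hF h0 zero_le_one, ← restrict_Ico_eq_restrict_Icc]
  refine (setLIntegral_le_sum_of_covering
    (F := fun x => ENNReal.ofReal (F x)) (fun x => by simp only [hper x])
    (fun i => measurableSet_Icc) hcover).trans (Finset.sum_le_sum fun i _ => ?_)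
  rw [ofReal_intervalIntegral hF h0 (hyz i)]

theorem abs_sub_le_integral_abs_deriv {f : ℝ → ℝ} (hf : ContDiff ℝ 1 f) {a b s t : ℝ}
    (hs : s ∈ Icc a b) (ht : t ∈ Icc a b) : |f s - f t| ≤ ∫ x in a..b, |deriv f x| := by
  wlog hst : t ≤ s generalizing s t
  · rw [abs_sub_comm]
    exact this ht hs (le_of_not_ge hst)
  have hc : Continuous (deriv f) := hf.continuous_deriv le_rfl
  rw [← intervalIntegral.integral_deriv_eq_sub
    (fun x _ => (hf.differentiable one_ne_zero).differentiableAt) (hc.intervalIntegrable _ _)]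
  refine (intervalIntegral.abs_integral_le_integral_abs hst).trans ?_
  exact intervalIntegral.integral_mono_interval ht.1 hst hs.2
    (Eventually.of_forall fun x => abs_nonneg _) (hc.abs.intervalIntegrable _ _)

theorem eVariationOn_le_integral_abs_deriv {f : ℝ → ℝ} (hf : ContDiff ℝ 1 f) (a b : ℝ) :
    eVariationOn f (Icc a b) ≤ ENNReal.ofReal (∫ x in a..b, |deriv f x|) := by
  have hc : Continuous fun x => |deriv f x| := (hf.continuous_deriv le_rfl).abs
  refine iSup_le fun ⟨n, u, hu, us⟩ => ?_
  calc _ ≤ ∑ i ∈ Finset.range n, ENNReal.ofReal (∫ x in u i..u (i + 1), |deriv f x|) :=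
        Finset.sum_le_sum fun i _ => by
          rw [edist_dist]
          exact ENNReal.ofReal_le_ofReal (abs_sub_le_integral_abs_deriv hf
            (right_mem_Icc.2 (hu i.le_succ)) (left_mem_Icc.2 (hu i.le_succ)))
    _ = ENNReal.ofReal (∫ x in u 0..u n, |deriv f x|) := by
        rw [← ENNReal.ofReal_sum_of_nonneg fun i _ =>
          intervalIntegral.integral_nonneg (hu i.le_succ) fun _ _ => abs_nonneg _,
          intervalIntegral.sum_integral_adjacent_intervals fun i _ => hc.intervalIntegrable _ _]
    _ ≤ _ := ENNReal.ofReal_le_ofReal (intervalIntegral.integral_mono_interval (us 0).1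
        (hu n.zero_le) (us n).2 (Eventually.of_forall fun x => abs_nonneg _)
        (hc.intervalIntegrable _ _))

/-! ### Bounded distortion and Denjoy's theorem -/

/-- The first `n` images of the arc `(y, z)` are pairwise disjoint modulo `1`. -/
def Packed (G : ℝ → ℝ) (y z : ℝ) (n : ℕ) : Prop :=
  ∀ i < n, ∀ j < n, ∀ (k l : ℤ) (t : ℝ),
    t + k ∈ Ioo (G^[i] y) (G^[i] z) → t + l ∈ Ioo (G^[j] y) (G^[j] z) → i = j ∧ k = l

theorem Packed.sum_le {G : ℝ ≃o ℝ} {y z : ℝ} {n : ℕ} (h : Packed G y z n) (hyz : y ≤ z)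
    {F : ℝ → ℝ} (hF : Continuous F) (h0 : ∀ x, 0 ≤ F x) (hper : Function.Periodic F 1) :
    ∑ i ∈ Finset.range n, ∫ x in G^[i] y..G^[i] z, F x ≤ ∫ x in (0 : ℝ)..1, F x :=
  sum_integral_le_of_packing hF h0 hper
    (fun i => (strictMono_iterate_orderIso G i).monotone hyz)
    fun i hi j hj => h i (Finset.mem_range.1 hi) j (Finset.mem_range.1 hj)

theorem Packed.sum_length_le {G : ℝ ≃o ℝ} {y z : ℝ} {n : ℕ} (h : Packed G y z n) (hyz : y ≤ z) :
    ∑ i ∈ Finset.range n, (G^[i] z - G^[i] y) ≤ 1 := by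
  simpa using h.sum_le hyz (F := fun _ => 1) continuous_const (fun _ => zero_le_one)
    (fun _ => rfl)

/-- The total variation of `φ` over a period. -/
noncomputable def periodVar (φ : ℝ → ℝ) : ℝ := ∫ x in (0 : ℝ)..1, |deriv φ x|

theorem Packed.abs_birkhoffSum_sub_le {G : ℝ ≃o ℝ} {y z : ℝ} {n : ℕ} (h : Packed G y z n)
    {φ : ℝ → ℝ} (hφ : ContDiff ℝ 1 φ) (hper : Function.Periodic φ 1) {s t : ℝ}
    (hs : s ∈ Icc y z) (ht : t ∈ Icc y z) :
    |birkhoffSum G φ n s - birkhoffSum G φ n t| ≤ periodVar φ := by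
  have hmono : ∀ i, Monotone G^[i] := fun i => (strictMono_iterate_orderIso G i).monotone
  have hper' : Function.Periodic (fun x => |deriv φ x|) 1 := fun x => by
    have : deriv φ (x + 1) = deriv φ x := by
      rw [← deriv_comp_add_const, funext hper]
    simp only [this]
  rw [birkhoffSum, birkhoffSum, ← Finset.sum_sub_distrib]
  refine (Finset.abs_sum_le_sum_abs _ _).trans (le_trans (Finset.sum_le_sum fun i _ => ?_)
    (h.sum_le (hs.1.trans hs.2) (hφ.continuous_deriv le_rfl).abs (fun _ => abs_nonneg _) hper'))
  exact abs_sub_le_integral_abs_deriv hφ ⟨hmono i hs.1, hmono i hs.2⟩ ⟨hmono i ht.1, hmono i ht.2⟩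

/-- An increasing diffeomorphism of the line commuting with the unit translation, with logarithmic
derivative `φ` of class `C¹`. -/
structure SmoothLift (G : ℝ ≃o ℝ) (φ : ℝ → ℝ) : Prop where
  add_one : ∀ x, G (x + 1) = G x + 1
  hasDerivAt : ∀ x, HasDerivAt G (Real.exp (φ x)) x
  contDiff : ContDiff ℝ 1 φ
  periodic : Function.Periodic φ 1

namespace SmoothLift

variable {G : ℝ ≃o ℝ} {φ : ℝ → ℝ}

theorem hasDerivAt_iterate (h : SmoothLift G φ) (n : ℕ) (x : ℝ) :
    HasDerivAt G^[n] (Real.exp (birkhoffSum G φ n x)) x := by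
  induction n with
  | zero => simpa using hasDerivAt_id x
  | succ n ih =>
    rw [birkhoffSum_succ, Real.exp_add, mul_comm, Function.iterate_succ']
    exact (h.hasDerivAt _).comp x ih

theorem exists_length_eq (h : SmoothLift G φ) (n : ℕ) {y z : ℝ} (hyz : y < z) :
    ∃ c ∈ Ioo y z, G^[n] z - G^[n] y = Real.exp (birkhoffSum G φ n c) * (z - y) := by
  obtain ⟨c, hc, hcd⟩ := exists_hasDerivAt_eq_slope G^[n] _ hyz
    (continuous_iterate_orderIso G n).continuousOn fun x _ => h.hasDerivAt_iterate n x
  refine ⟨c, hc, ?_⟩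
  rw [hcd, div_mul_cancel₀ _ (sub_pos.2 hyz).ne']

theorem birkhoffSum_add_int (h : SmoothLift G φ) {f : ℝ → ℝ} (hf : Function.Periodic f 1) (n : ℕ)
    (x : ℝ) (k : ℤ) : birkhoffSum G f n (x + k) = birkhoffSum G f n x := by
  refine Finset.sum_congr rfl fun i _ => ?_
  rw [iterate_add_int h.add_one]
  simpa using hf.int_mul k (G^[i] x)

end SmoothLift

/-- Left endpoint of the arc between `x` and its return `G^q x - p`. -/
noncomputable def returnLeft (G : ℝ → ℝ) (q : ℕ) (p : ℤ) (x : ℝ) : ℝ := min x (G^[q] x - p)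

/-- Right endpoint of the arc between `x` and its return `G^q x - p`. -/
noncomputable def returnRight (G : ℝ → ℝ) (q : ℕ) (p : ℤ) (x : ℝ) : ℝ := max x (G^[q] x - p)

theorem iterate_return {G : ℝ ≃o ℝ} (h1 : ∀ x, G (x + 1) = G x + 1) (i q : ℕ) (p : ℤ) (x : ℝ) :
    G^[i] (G^[q] x - p) = G^[i + q] x - p := by
  have := iterate_add_int h1 i (G^[q] x) (-p)
  push_cast at this
  rw [sub_eq_add_neg, this, Function.iterate_add_apply, sub_eq_add_neg]

theorem iterate_returnLeft {G : ℝ ≃o ℝ} (h1 : ∀ x, G (x + 1) = G x + 1) (i q : ℕ) (p : ℤ)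
    (x : ℝ) : G^[i] (returnLeft G q p x) = min (G^[i] x) (G^[i + q] x - p) := by
  rw [returnLeft, (strictMono_iterate_orderIso G i).monotone.map_min, iterate_return h1]

theorem iterate_returnRight {G : ℝ ≃o ℝ} (h1 : ∀ x, G (x + 1) = G x + 1) (i q : ℕ) (p : ℤ)
    (x : ℝ) : G^[i] (returnRight G q p x) = max (G^[i] x) (G^[i + q] x - p) := by
  rw [returnRight, (strictMono_iterate_orderIso G i).monotone.map_max, iterate_return h1]

theorem iterate_returnLeft' {G : ℝ ≃o ℝ} (h1 : ∀ x, G (x + 1) = G x + 1) (i q : ℕ) (p : ℤ)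
    (x : ℝ) : G^[i] (returnLeft G q p x) = returnLeft G q p (G^[i] x) := by
  rw [iterate_returnLeft h1, returnLeft, add_comm i q, Function.iterate_add_apply]

theorem iterate_returnRight' {G : ℝ ≃o ℝ} (h1 : ∀ x, G (x + 1) = G x + 1) (i q : ℕ) (p : ℤ)
    (x : ℝ) : G^[i] (returnRight G q p x) = returnRight G q p (G^[i] x) := by
  rw [iterate_returnRight h1, returnRight, add_comm i q, Function.iterate_add_apply]

section Return

variable {G : ℝ ≃o ℝ} {α : ℝ} {q q' : ℕ} {p p' : ℤ}

theorem ClosestReturn.returnLeft_lt (hr : ClosestReturn α q q' p p')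
    (hord : ∀ x, RotationOrdered α fun i k => G^[i] x + k) (x : ℝ) :
    returnLeft G q p x < returnRight G q p x := by
  have h := hord x 0 0 q (-p)
  have h' := hord x q (-p) 0 0
  simp only [Function.iterate_zero, id, Int.cast_zero, add_zero, Nat.cast_zero, zero_mul,
    Int.cast_neg, ← sub_eq_add_neg] at h h'
  rw [returnLeft, returnRight]
  rcases lt_or_gt_of_ne hr.ne with hβ | hβ
  · have := h'.2 hβ
    rwa [min_eq_right this.le, max_eq_left this.le]
  · have := h.2 hβ
    rwa [min_eq_left this.le, max_eq_right this.le]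

theorem ClosestReturn.packed (hr : ClosestReturn α q q' p p') (h1 : ∀ x, G (x + 1) = G x + 1)
    (hord : ∀ x, RotationOrdered α fun i k => G^[i] x + k) (x : ℝ) :
    Packed G (returnLeft G q p x) (returnRight G q p x) q' := by
  intro i hi j hj k l t htk htl
  have key : ∀ (i : ℕ) (k : ℤ), t + k ∈ Ioo (G^[i] (returnLeft G q p x))
      (G^[i] (returnRight G q p x)) → t ∈ Ioo
        (min (G^[i] x + (-k : ℤ)) (G^[i + q] x + (-k - p : ℤ)))
        (max (G^[i] x + (-k : ℤ)) (G^[i + q] x + (-k - p : ℤ))) := fun i k ht => by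
    rw [iterate_returnLeft h1, iterate_returnRight h1] at ht
    have e : G^[i + q] x + (-k - p : ℤ) = G^[i + q] x - p + (-k : ℤ) := by push_cast; ring
    rw [e, min_add_add_right, max_add_add_right]
    push_cast
    exact ⟨by linarith [ht.1], by linarith [ht.2]⟩
  have := hr.eq_of_overlap (hord x) (by omega) (by omega) (key i k htk) (key j l htl)
  exact ⟨this.1, neg_inj.1 this.2⟩

theorem ClosestReturn.covering (hr : ClosestReturn α q q' p p') (h1 : ∀ x, G (x + 1) = G x + 1)
    (hord : ∀ x, RotationOrdered α fun i k => G^[i] x + k) (x t : ℝ) :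
    ∃ i < q + q', ∃ k : ℤ,
      t + k ∈ Icc (G^[i] (returnLeft G q p x)) (G^[i] (returnRight G q p x)) := by
  obtain ⟨i, hi, k, hk⟩ := hr.exists_mem_Icc (hord x) (fun i k => by simp) t
  refine ⟨i, hi, -k, ?_⟩
  rw [iterate_returnLeft h1, iterate_returnRight h1]
  have e : G^[i + q] x + (k - p : ℤ) = G^[i + q] x - p + k := by push_cast; ring
  simp only [e] at hk
  rw [min_add_add_right, max_add_add_right] at hk
  push_cast
  exact ⟨by linarith [hk.1], by linarith [hk.2]⟩

end Return

theorem packed_of_wandering {G : ℝ ≃o ℝ} (h1 : ∀ x, G (x + 1) = G x + 1) {y z : ℝ}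
    (hyz1 : z - y ≤ 1)
    (hw : ∀ n : ℕ, 0 < n → ∀ (k : ℤ) (t : ℝ), t ∈ Ioo y z → G^[n] t + k ∉ Ioo y z) (m n : ℕ) :
    Packed G (G.symm^[m] y) (G.symm^[m] z) n := by
  have pre : ∀ (i : ℕ) (x : ℝ), x ∈ Ioo (G^[i] (G.symm^[m] y)) (G^[i] (G.symm^[m] z)) →
      ∃ s, x = G^[i] s ∧ G^[m] s ∈ Ioo y z := fun i x hx => by
    have hx' := iterate_symm_iterate G i x
    refine ⟨G.symm^[i] x, hx'.symm, ?_⟩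
    rw [← hx'] at hx
    have ha := strictMono_iterate_orderIso G m ((strictMono_iterate_orderIso G i).lt_iff_lt.1 hx.1)
    have hb := strictMono_iterate_orderIso G m ((strictMono_iterate_orderIso G i).lt_iff_lt.1 hx.2)
    rw [iterate_symm_iterate] at ha hb
    exact ⟨ha, hb⟩
  have main : ∀ (i d : ℕ) (k l : ℤ) (t : ℝ),
      t + k ∈ Ioo (G^[i] (G.symm^[m] y)) (G^[i] (G.symm^[m] z)) →
      t + l ∈ Ioo (G^[i + d] (G.symm^[m] y)) (G^[i + d] (G.symm^[m] z)) → d = 0 ∧ k = l := by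
    intro i d k l t hk hl
    obtain ⟨s, hs, hsm⟩ := pre i _ hk
    obtain ⟨s', hs', hsm'⟩ := pre (i + d) _ hl
    have hss : s = G^[d] s' + (k - l : ℤ) := by
      apply (strictMono_iterate_orderIso G i).injective
      rw [iterate_add_int h1, ← Function.iterate_add_apply, ← hs, ← hs']
      push_cast; ring
    have hms : G^[m] s = G^[d] (G^[m] s') + (k - l : ℤ) := by
      rw [hss, iterate_add_int h1, ← Function.iterate_add_apply, ← Function.iterate_add_apply,
        add_comm m d]
    rcases Nat.eq_zero_or_pos d with rfl | hd
    · refine ⟨rfl, ?_⟩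
      simp only [Function.iterate_zero, id] at hms
      have hlt : |((k - l : ℤ) : ℝ)| < 1 := by
        rw [abs_lt]
        constructor <;> linarith [hsm.1, hsm.2, hsm'.1, hsm'.2]
      rw [← Int.cast_abs] at hlt
      have h2 : |k - l| < 1 := by exact_mod_cast hlt
      exact sub_eq_zero.1 (Int.abs_lt_one_iff.1 h2)
    · exact absurd (hms ▸ hsm) (hw d hd _ _ hsm')
  intro i _ j _ k l t hk hl
  rcases le_total i j with hij | hij
  · obtain ⟨d, rfl⟩ := Nat.exists_eq_add_of_le hij
    have := main i d k l t hk hl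
    exact ⟨by omega, this.2⟩
  · obtain ⟨d, rfl⟩ := Nat.exists_eq_add_of_le hij
    have := main j d l k t hl hk
    exact ⟨by omega, this.2.symm⟩

theorem tendsto_zero_of_sum_range_le {a : ℕ → ℝ} (h0 : ∀ n, 0 ≤ a n)
    (h : ∀ n, ∑ i ∈ Finset.range n, a i ≤ 1) : Tendsto a atTop (𝓝 0) :=
  (summable_of_sum_range_le h0 h).tendsto_atTop_zero

namespace SmoothLift

variable {G : ℝ ≃o ℝ} {φ : ℝ → ℝ} {α : ℝ}

/-- Denjoy's theorem: a smooth circle diffeomorphism without periodic points has no wandering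
arcs. -/
theorem exists_return (h : SmoothLift G φ) (hα : ∀ j : ℕ, 0 < j → ∀ k : ℤ, j * α ≠ k)
    (hord : ∀ x, RotationOrdered α fun i k => G^[i] x + k) {y z : ℝ} (hyz : y < z)
    (hyz1 : z - y ≤ 1) :
    ∃ n : ℕ, 0 < n ∧ ∃ (k : ℤ) (t : ℝ), t ∈ Ioo y z ∧ G^[n] t + k ∈ Ioo y z := by
  by_contra! hw
  have hpack := packed_of_wandering h.add_one hyz1 hw
  have hsymm : ∀ n, StrictMono G.symm^[n] := strictMono_iterate_orderIso G.symm
  have hlim₁ : Tendsto (fun n => G^[n] z - G^[n] y) atTop (𝓝 0) :=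
    tendsto_zero_of_sum_range_le
      (fun n => sub_nonneg.2 ((strictMono_iterate_orderIso G n).monotone hyz.le))
      fun n => (hpack 0 n).sum_length_le hyz.le
  have hlim₂ : Tendsto (fun n => G.symm^[n] z - G.symm^[n] y) atTop (𝓝 0) := by
    rw [← tendsto_add_atTop_iff_nat 1]
    refine tendsto_zero_of_sum_range_le
      (fun n => sub_nonneg.2 ((hsymm _).monotone hyz.le)) fun n => ?_
    have := (hpack n n).sum_length_le ((hsymm n).monotone hyz.le)
    rw [← Finset.sum_range_reflect] at this
    refine le_trans (Finset.sum_le_sum fun i hi => le_of_eq ?_) this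
    have hi' := Finset.mem_range.1 hi
    have e : ∀ x, G^[n - 1 - i] (G.symm^[n] x) = G.symm^[i + 1] x := fun x => by
      rw [show n = (n - 1 - i) + (i + 1) by omega, Function.iterate_add_apply,
        show n - 1 - i + (i + 1) - 1 - i = n - 1 - i by omega, iterate_symm_iterate]
    rw [e, e]
  set V := periodVar φ
  set c := Real.exp (-V) * (z - y)
  have hc : 0 < c := mul_pos (Real.exp_pos _) (sub_pos.2 hyz)
  obtain ⟨n₀, hn₀⟩ := eventually_atTop.1
    ((hlim₁.eventually (gt_mem_nhds hc)).and (hlim₂.eventually (gt_mem_nhds hc)))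
  obtain ⟨η, hη, hηn⟩ := exists_forall_le_abs hα n₀
  obtain ⟨q, q', p, p', hr, hqη⟩ := exists_closestReturn hα hη
  have hq : n₀ < q := by
    by_contra! hcon
    exact absurd (hηn q hr.pos hcon p) hqη.not_ge
  obtain ⟨ha, hb⟩ := hn₀ q hq.le
  obtain ⟨ξ, hξ, hξe⟩ := h.exists_length_eq q hyz
  obtain ⟨ξ', hξ', hξe'⟩ := h.exists_length_eq q (hsymm q hyz)
  rw [iterate_symm_iterate, iterate_symm_iterate] at hξe'
  have hmono := strictMono_iterate_orderIso G q
  have htmem : G^[q] ξ' ∈ Icc y z := by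
    have h1 := hmono.monotone hξ'.1.le
    have h2 := hmono.monotone hξ'.2.le
    rw [iterate_symm_iterate] at h1 h2
    exact ⟨h1, h2⟩
  have hpq : Packed G (returnLeft G q p ξ') (returnRight G q p ξ') q :=
    fun i hi j hj => hr.packed h.add_one hord ξ' i (hi.trans hr.lt) j (hj.trans hr.lt)
  have hd1 := abs_le.1 ((hpack 0 q).abs_birkhoffSum_sub_le h.contDiff h.periodic
    (Ioo_subset_Icc_self hξ) htmem)
  have hd2 := abs_le.1 (hpq.abs_birkhoffSum_sub_le h.contDiff h.periodic
    (s := G^[q] ξ' - p) (t := ξ') ⟨min_le_right _ _, le_max_right _ _⟩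
    ⟨min_le_left _ _, le_max_left _ _⟩)
  have hint := h.birkhoffSum_add_int h.periodic q (G^[q] ξ') (-p)
  push_cast at hint
  rw [← sub_eq_add_neg] at hint
  rw [hint] at hd2
  set A := birkhoffSum G φ q ξ
  set B := birkhoffSum G φ q ξ'
  have hAB : -V + (-V + B) ≤ A := by linarith [hd1.1, hd2.1]
  have hexp := Real.exp_le_exp.2 hAB
  rw [Real.exp_add, Real.exp_add] at hexp
  set b := G.symm^[q] z - G.symm^[q] y
  have hb0 : 0 < b := sub_pos.2 (hsymm q hyz)
  have h3 : c * c ≤ (G^[q] z - G^[q] y) * b := by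
    calc c * c = Real.exp (-V) * (Real.exp (-V) * (z - y)) * (z - y) := by simp only [c]; ring
      _ = (Real.exp (-V) * (Real.exp (-V) * Real.exp B)) * b * (z - y) := by
        nth_rw 2 [hξe']
        simp only [b]; ring
      _ ≤ Real.exp A * b * (z - y) := by gcongr
      _ = (G^[q] z - G^[q] y) * b := by rw [hξe]; ring
  have h4 : (G^[q] z - G^[q] y) * b < c * c :=
    mul_lt_mul'' ha hb (sub_nonneg.2 (hmono.monotone hyz.le)) hb0.le
  exact absurd h3 h4.not_ge

theorem exists_forall_abs_return_lt (h : SmoothLift G φ)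
    (hα : ∀ j : ℕ, 0 < j → ∀ k : ℤ, j * α ≠ k)
    (hord : ∀ x, RotationOrdered α fun i k => G^[i] x + k) {η : ℝ} (hη : 0 < η) :
    ∃ ε > 0, ∀ (q : ℕ) (p : ℤ), |q * α - p| < ε → ∀ x, |G^[q] x - p - x| < η := by
  obtain ⟨M, hM⟩ := exists_nat_gt (2 / η)
  have hM0 : (0 : ℝ) < M := (by positivity : 0 < 2 / η).trans hM
  have hM1 : (1 : ℝ) ≤ M := by
    have : 0 < M := by exact_mod_cast hM0
    exact_mod_cast this
  have hMη : 2 / M < η := by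
    rw [div_lt_comm₀ hM0 hη]; exact hM
  choose n hn k t ht htr using fun m : ℕ => h.exists_return hα hord
    (y := m / M) (z := (m + 1) / M) (by gcongr; linarith) (by
      rw [← sub_div, add_sub_cancel_left]
      exact (div_le_one hM0).2 hM1)
  obtain ⟨N, hN⟩ : ∃ N, ∀ m ∈ Finset.range M, n m ≤ N :=
    ⟨(Finset.range M).sup n, fun m hm => Finset.le_sup hm⟩
  obtain ⟨ε, hε, hεN⟩ := exists_forall_le_abs hα N
  refine ⟨ε, hε, fun q p hqp x => ?_⟩
  by_contra! hcon
  set lo := min x (G^[q] x - p)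
  set hi := max x (G^[q] x - p)
  have hlen : hi - lo = |G^[q] x - p - x| := by
    simp only [hi, lo]
    rw [max_sub_min_eq_abs, abs_sub_comm]
  obtain ⟨w, hw, n', hn', hn'N, k', hk'⟩ : ∃ w ∈ Icc lo hi, ∃ n' : ℕ, 0 < n' ∧ n' ≤ N ∧
      ∃ k' : ℤ, G^[n'] w + k' ∈ Icc lo hi := by
    set c := ⌈lo * M⌉
    have hMi : (0 : ℤ) < M := by exact_mod_cast hM0
    have hdiv := Int.emod_add_mul_ediv c M
    set m := (c % (M : ℤ)).toNat
    set l := c / (M : ℤ)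
    have hmc : (m : ℤ) = c % M := Int.toNat_of_nonneg (Int.emod_nonneg _ hMi.ne')
    have hmM : m < M := by
      have := Int.emod_lt_of_pos c hMi
      rw [← hmc] at this
      exact_mod_cast this
    rw [← hmc] at hdiv
    have hcr : (m : ℝ) / M + l = c / M := by
      rw [← hdiv]; push_cast; field_simp
    have hcr' : ((m : ℝ) + 1) / M + l = c / M + 1 / M := by
      rw [← hcr]; ring
    have hc1 : lo ≤ c / M := by
      rw [le_div_iff₀ hM0]; exact Int.le_ceil _
    have hc2 : (c : ℝ) / M < lo + 1 / M := by
      rw [div_lt_iff₀ hM0, add_mul, one_div, inv_mul_cancel₀ hM0.ne']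
      exact Int.ceil_lt_add_one _
    have hsub : ∀ s ∈ Ioo ((m : ℝ) / M) ((m + 1) / M), s + l ∈ Icc lo hi := fun s hs =>
      ⟨by linarith [hs.1], by
        have : (2 : ℝ) / M = 1 / M + 1 / M := by ring
        linarith [hs.2]⟩
    refine ⟨t m + l, hsub _ (ht m), n m, hn m, hN m (Finset.mem_range.2 hmM), k m, ?_⟩
    rw [iterate_add_int h.add_one]
    have := hsub _ (htr m)
    rwa [add_right_comm] at this
  have hret : ∀ v, v ∈ Icc lo hi → G^[q] lo ≤ G^[q] v ∧ G^[q] v ≤ G^[q] hi := fun v hv =>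
    ⟨(strictMono_iterate_orderIso G q).monotone hv.1,
      (strictMono_iterate_orderIso G q).monotone hv.2⟩
  have hbig := hεN n' hn' hn'N (-k')
  push_cast at hbig
  rw [sub_neg_eq_add] at hbig
  have habs : |(q * α - p : ℝ)| < |n' * α + k'| := hqp.trans_le hbig
  have hgen := fun i k j l => (hord w i k j l).2
  have hcomp : G^[n' + q] w = G^[q] (G^[n'] w + k') - k' := by
    rw [iterate_add_int h.add_one, add_comm, Function.iterate_add_apply]; ring
  have h1 := hret w hw
  have h2 := hret _ hk'
  rcases le_total x (G^[q] x - p) with hle | hle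
  · have hlo : lo = x := min_eq_left hle
    have hhi : hi = G^[q] x - p := max_eq_right hle
    rw [hlo] at h1 h2 hw hk'
    rw [hhi] at hw hk'
    rcases le_or_gt (n' * α + k') 0 with hs | hs
    · rw [abs_of_nonpos hs] at habs
      have := (abs_lt.1 habs).2
      have h3 := hgen (n' + q) (k' - p) 0 0 (by push_cast; linarith)
      simp only [hcomp, Function.iterate_zero, id] at h3
      push_cast at h3
      linarith [hw.2, h2.1]
    · rw [abs_of_pos hs] at habs
      have := (abs_lt.1 habs).2
      have h3 := hgen q (-p) n' k' (by push_cast; linarith)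
      push_cast at h3
      linarith [hk'.2, h1.1]
  · have hlo : lo = G^[q] x - p := min_eq_right hle
    have hhi : hi = x := max_eq_left hle
    rw [hhi] at h1 h2 hw hk'
    rw [hlo] at hw hk'
    rcases le_or_gt (n' * α + k') 0 with hs | hs
    · rw [abs_of_nonpos hs] at habs
      have := (abs_lt.1 habs).1
      have h3 := hgen n' k' q (-p) (by push_cast; linarith)
      push_cast at h3
      linarith [hk'.1, h1.2]
    · rw [abs_of_pos hs] at habs
      have := (abs_lt.1 habs).1
      have h3 := hgen 0 0 (n' + q) (k' - p) (by push_cast; linarith)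
      simp only [hcomp, Function.iterate_zero, id] at h3
      push_cast at h3
      linarith [hw.1, h2.2]

end SmoothLift

/-! ### Pullback sums of densities -/

/-- The sum over `j < n` of the pullbacks of the density `f` by the iterates of a lift `G` whose
logarithmic derivative is `φ`. -/
noncomputable def pullbackSum (G φ : ℝ → ℝ) (n : ℕ) (f : ℝ → ℝ) (x : ℝ) : ℝ :=
  ∑ j ∈ Finset.range n, f (G^[j] x) * Real.exp (birkhoffSum G φ j x)

theorem exists_forall_abs_sub_lt_of_periodic {u : ℝ → ℝ} (hu : Continuous u)
    (hper : Function.Periodic u 1) {ε : ℝ} (hε : 0 < ε) :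
    ∃ δ > 0, ∀ s t, |s - t| < δ → |u s - u t| < ε := by
  have huc := isCompact_Icc.uniformContinuousOn_of_continuous (hu.continuousOn (s := Icc (-1) 2))
  obtain ⟨δ, hδ, h⟩ := Metric.uniformContinuousOn_iff.1 huc ε hε
  refine ⟨min δ 1, by positivity, fun s t hst => ?_⟩
  have hst1 := abs_lt.1 (hst.trans_le (min_le_right _ _))
  have hf1 := Int.floor_le s
  have hf2 := Int.lt_floor_add_one s
  have hs : ∀ x, u (x - ⌊s⌋) = u x := fun x => by simpa using hper.sub_int_mul_eq ⌊s⌋ (x := x)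
  rw [← hs s, ← hs t, ← Real.dist_eq]
  refine h _ ⟨by linarith, by linarith⟩ _ ⟨by linarith, by linarith⟩ ?_
  rw [Real.dist_eq, sub_sub_sub_cancel_right]
  exact hst.trans_le (min_le_left _ _)

namespace SmoothLift

variable {G : ℝ ≃o ℝ} {φ : ℝ → ℝ} {α : ℝ}

theorem continuous_birkhoffSum (h : SmoothLift G φ) (n : ℕ) : Continuous (birkhoffSum G φ n) :=
  continuous_finsetSum _ fun i _ =>
    h.contDiff.continuous.comp (continuous_iterate_orderIso G i)

theorem continuous_pullback (h : SmoothLift G φ) {f : ℝ → ℝ} (hf : Continuous f) (j : ℕ) :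
    Continuous fun x => f (G^[j] x) * Real.exp (birkhoffSum G φ j x) :=
  (hf.comp (continuous_iterate_orderIso G j)).mul
    (Real.continuous_exp.comp (h.continuous_birkhoffSum j))

theorem continuous_pullbackSum (h : SmoothLift G φ) {f : ℝ → ℝ} (hf : Continuous f) (n : ℕ) :
    Continuous (pullbackSum G φ n f) :=
  continuous_finsetSum _ fun j _ => h.continuous_pullback hf j

theorem periodic_pullback (h : SmoothLift G φ) {f : ℝ → ℝ} (hf : Function.Periodic f 1) (j : ℕ) :
    Function.Periodic (fun x => f (G^[j] x) * Real.exp (birkhoffSum G φ j x)) 1 := fun x => by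
  have h1 := iterate_add_int h.add_one j x 1
  have h2 := h.birkhoffSum_add_int h.periodic j x 1
  rw [Int.cast_one] at h1 h2
  simp only [h1, h2, hf (G^[j] x)]

theorem periodic_pullbackSum (h : SmoothLift G φ) {f : ℝ → ℝ} (hf : Function.Periodic f 1)
    (n : ℕ) : Function.Periodic (pullbackSum G φ n f) 1 := fun x =>
  Finset.sum_congr rfl fun j _ => h.periodic_pullback hf j x

theorem integral_pullback (h : SmoothLift G φ) {f : ℝ → ℝ} (hf : Continuous f) (j : ℕ)
    (a b : ℝ) :
    ∫ x in a..b, f (G^[j] x) * Real.exp (birkhoffSum G φ j x) =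
      ∫ x in G^[j] a..G^[j] b, f x :=
  intervalIntegral.integral_comp_mul_deriv (fun x _ => h.hasDerivAt_iterate j x)
    (Real.continuous_exp.comp (h.continuous_birkhoffSum j)).continuousOn hf

theorem integral_pullback_period (h : SmoothLift G φ) {f : ℝ → ℝ} (hf : Continuous f)
    (hper : Function.Periodic f 1) (j : ℕ) :
    ∫ x in (0 : ℝ)..1, f (G^[j] x) * Real.exp (birkhoffSum G φ j x) =
      ∫ x in (0 : ℝ)..1, f x := by
  have h1 := iterate_add_int h.add_one j 0 1
  rw [Int.cast_one, zero_add] at h1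
  rw [h.integral_pullback hf, h1, hper.intervalIntegral_add_eq (G^[j] 0) 0, zero_add]

theorem integral_pullbackSum (h : SmoothLift G φ) {f : ℝ → ℝ} (hf : Continuous f)
    (hper : Function.Periodic f 1) (n : ℕ) :
    ∫ x in (0 : ℝ)..1, pullbackSum G φ n f x = n * ∫ x in (0 : ℝ)..1, f x := by
  simp only [pullbackSum]
  rw [intervalIntegral.integral_finsetSum fun j _ =>
    (h.continuous_pullback hf j).intervalIntegrable _ _]
  simp [h.integral_pullback_period hf hper]

/-- A covering of the circle by the first `N` images of an arc, of bounded total length and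
distortion and on which `f` is almost constant, bounds pullback sums of `f` on the arc below. -/
theorem le_mul_pullbackSum (h : SmoothLift G φ) {f : ℝ → ℝ} (hf : Continuous f)
    (hper : Function.Periodic f 1) (hf0 : ∀ x, 0 ≤ f x) {y z : ℝ} (hyz : y < z) {N : ℕ}
    {W ε : ℝ}
    (hdist : ∀ j < N, ∀ s ∈ Icc y z, ∀ t ∈ Icc y z,
      birkhoffSum G φ j s - birkhoffSum G φ j t ≤ W)
    (hlen : ∑ j ∈ Finset.range N, (G^[j] z - G^[j] y) ≤ 2)
    (hcover : ∀ t : ℝ, ∃ i < N, ∃ k : ℤ, t + k ∈ Icc (G^[i] y) (G^[i] z))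
    (hε : 0 ≤ ε)
    (hosc : ∀ j < N, ∀ s ∈ Icc (G^[j] y) (G^[j] z), ∀ t ∈ Icc (G^[j] y) (G^[j] z),
      f s ≤ f t + ε)
    {x : ℝ} (hx : x ∈ Icc y z) :
    Real.exp (-W) * ((∫ t in (0 : ℝ)..1, f t) - 2 * ε) ≤ (z - y) * pullbackSum G φ N f x := by
  have hmono : ∀ j, Monotone G^[j] := fun j => (strictMono_iterate_orderIso G j).monotone
  have hpiece : ∀ j < N, ∫ t in G^[j] y..G^[j] z, f t ≤
      Real.exp W * (z - y) * (f (G^[j] x) * Real.exp (birkhoffSum G φ j x)) +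
        ε * (G^[j] z - G^[j] y) := fun j hj => by
    have hle : G^[j] y ≤ G^[j] z := hmono j hyz.le
    have h1 : ∫ t in G^[j] y..G^[j] z, f t ≤ ∫ t in G^[j] y..G^[j] z, (f (G^[j] x) + ε) :=
      intervalIntegral.integral_mono_on hle (hf.intervalIntegrable _ _)
        (continuous_const.intervalIntegrable _ _) fun t ht =>
          hosc j hj t ht _ ⟨hmono j hx.1, hmono j hx.2⟩
    rw [intervalIntegral.integral_const, smul_eq_mul] at h1
    obtain ⟨c, hc, hce⟩ := h.exists_length_eq j hyz
    have h2 : G^[j] z - G^[j] y ≤ Real.exp W * Real.exp (birkhoffSum G φ j x) * (z - y) := by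
      rw [hce, ← Real.exp_add]
      refine mul_le_mul_of_nonneg_right (Real.exp_le_exp.2 ?_) (sub_pos.2 hyz).le
      linarith [hdist j hj c (Ioo_subset_Icc_self hc) x hx]
    have h3 := mul_le_mul_of_nonneg_right h2 (hf0 (G^[j] x))
    nlinarith
  have htotal := (integral_le_sum_of_covering hf hf0 hper (t := Finset.range N)
    (y := fun i => G^[i] y) (z := fun i => G^[i] z) (fun i => hmono i hyz.le) (fun t => by
      obtain ⟨i, hi, k, hk⟩ := hcover t
      exact ⟨i, Finset.mem_range.2 hi, k, hk⟩)).trans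
    (Finset.sum_le_sum fun j hj => hpiece j (Finset.mem_range.1 hj))
  rw [Finset.sum_add_distrib, ← Finset.mul_sum, ← Finset.mul_sum] at htotal
  have h4 : (∫ t in (0 : ℝ)..1, f t) - 2 * ε ≤ Real.exp W * ((z - y) * pullbackSum G φ N f x) := by
    have := mul_le_mul_of_nonneg_left hlen hε
    rw [pullbackSum, ← mul_assoc]
    linarith
  calc _ ≤ Real.exp (-W) * (Real.exp W * ((z - y) * pullbackSum G φ N f x)) := by gcongr
    _ = _ := by rw [← mul_assoc, ← Real.exp_add, neg_add_cancel, Real.exp_zero, one_mul]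

theorem exp_mul_pullbackSum_le (f : ℝ → ℝ) (hf0 : ∀ x, 0 ≤ f x) {l N n : ℕ} (hn : l + N ≤ n)
    (x : ℝ) :
    Real.exp (birkhoffSum G φ l x) * pullbackSum G φ N f (G^[l] x) ≤ pullbackSum G φ n f x := by
  have hnn : ∀ j, 0 ≤ f (G^[j] x) * Real.exp (birkhoffSum G φ j x) := fun j =>
    mul_nonneg (hf0 _) (Real.exp_pos _).le
  calc _ = ∑ j ∈ Finset.range N, f (G^[l + j] x) * Real.exp (birkhoffSum G φ (l + j) x) := by
        rw [pullbackSum, Finset.mul_sum]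
        refine Finset.sum_congr rfl fun j _ => ?_
        rw [birkhoffSum_add, Real.exp_add, add_comm l j, Function.iterate_add_apply]
        ring
    _ ≤ ∑ j ∈ Finset.range (l + N), f (G^[j] x) * Real.exp (birkhoffSum G φ j x) := by
        rw [Finset.sum_range_add]
        exact le_add_of_nonneg_left (Finset.sum_nonneg fun j _ => hnn j)
    _ ≤ _ := Finset.sum_le_sum_of_subset_of_nonneg (Finset.range_subset_range.2 hn)
        fun j _ _ => hnn j

theorem exists_dynamicalPartition (h : SmoothLift G φ)
    (hα : ∀ j : ℕ, 0 < j → ∀ k : ℤ, j * α ≠ k)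
    (hord : ∀ x, RotationOrdered α fun i k => G^[i] x + k) {η : ℝ} (hη : 0 < η) :
    ∃ (y z : ℝ) (q q' : ℕ), y < z ∧ 0 < q' ∧ q ≤ q' ∧ Packed G y z q' ∧
      (∀ j < q + q', ∀ s ∈ Icc (G^[q'] y) (G^[q'] z), ∀ t ∈ Icc (G^[q'] y) (G^[q'] z),
        birkhoffSum G φ j s - birkhoffSum G φ j t ≤ 2 * periodVar φ) ∧
      (∑ j ∈ Finset.range (q + q'), (G^[j] (G^[q'] z) - G^[j] (G^[q'] y)) ≤ 2) ∧
      (∀ t : ℝ, ∃ i < q + q', ∃ k : ℤ, t + k ∈ Icc (G^[i] (G^[q'] y)) (G^[i] (G^[q'] z))) ∧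
      ∀ j, G^[j] z - G^[j] y < η := by
  obtain ⟨ε, hε, hsmall⟩ := h.exists_forall_abs_return_lt hα hord hη
  obtain ⟨q, q', p, p', hr, hqε⟩ := exists_closestReturn hα hε
  have hq := hr.lt
  have h1 := h.add_one
  have hL := fun i => iterate_returnLeft' h1 i q p 0
  have hR := fun i => iterate_returnRight' h1 i q p 0
  have hlt := hr.returnLeft_lt hord
  have hpk : ∀ x, Packed G (returnLeft G q p x) (returnRight G q p x) q' := hr.packed h1 hord
  have hpk' : ∀ x, Packed G (returnLeft G q p x) (returnRight G q p x) q := fun x i hi j hj =>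
    hpk x i (hi.trans hq) j (hj.trans hq)
  have hV : 0 ≤ periodVar φ := intervalIntegral.integral_nonneg zero_le_one fun _ _ => abs_nonneg _
  refine ⟨returnLeft G q p 0, returnRight G q p 0, q, q', hlt 0, by omega, hq.le, hpk 0,
    fun j hj s hs t ht => ?_, ?_, fun t => ?_, fun j => ?_⟩
  · rw [hL, hR] at hs ht
    have hshort : ∀ i ≤ q', ∀ x, ∀ s ∈ Icc (returnLeft G q p x) (returnRight G q p x),
        ∀ t ∈ Icc (returnLeft G q p x) (returnRight G q p x),
        birkhoffSum G φ i s - birkhoffSum G φ i t ≤ periodVar φ := fun i hi x s hs t ht =>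
      (le_abs_self _).trans (Packed.abs_birkhoffSum_sub_le (fun a ha b hb =>
        hpk x a (ha.trans_le hi) b (hb.trans_le hi)) h.contDiff h.periodic hs ht)
    rcases le_total j q' with hjq | hjq
    · linarith [hshort j hjq _ s hs t ht]
    · obtain ⟨r, rfl⟩ := Nat.exists_eq_add_of_le hjq
      rw [birkhoffSum_add, birkhoffSum_add]
      have hmem : ∀ s ∈ Icc (returnLeft G q p (G^[q'] 0)) (returnRight G q p (G^[q'] 0)),
          G^[q'] s ∈ Icc (returnLeft G q p (G^[q'] (G^[q'] 0)))
            (returnRight G q p (G^[q'] (G^[q'] 0))) := fun s hs => by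
        rw [← iterate_returnLeft' h1, ← iterate_returnRight' h1]
        exact ⟨(strictMono_iterate_orderIso G q').monotone hs.1,
          (strictMono_iterate_orderIso G q').monotone hs.2⟩
      linarith [hshort q' le_rfl _ s hs t ht,
        hshort r (by omega) _ _ (hmem s hs) _ (hmem t ht)]
  · rw [hL, hR, Finset.sum_range_add]
    have e : ∀ j, G^[q + j] (returnRight G q p (G^[q'] 0)) -
        G^[q + j] (returnLeft G q p (G^[q'] 0)) =
        G^[j] (returnRight G q p (G^[q] (G^[q'] 0))) -
          G^[j] (returnLeft G q p (G^[q] (G^[q'] 0))) := fun j => by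
      rw [← iterate_returnLeft' h1 q, ← iterate_returnRight' h1 q, ← Function.iterate_add_apply,
        ← Function.iterate_add_apply, add_comm j q]
    simp only [e]
    linarith [(hpk' (G^[q'] 0)).sum_length_le (hlt _).le,
      (hpk (G^[q] (G^[q'] 0))).sum_length_le (hlt _).le]
  · rw [hL, hR]
    exact hr.covering h1 hord _ t
  · rw [hL, hR, returnLeft, returnRight, max_sub_min_eq_abs]
    exact hsmall q p hqε _

/-- Pullback sums of a density of zero mean contract the `L¹` norm by a definite factor. -/
theorem exists_integral_abs_pullbackSum_le (h : SmoothLift G φ)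
    (hα : ∀ j : ℕ, 0 < j → ∀ k : ℤ, j * α ≠ k)
    (hord : ∀ x, RotationOrdered α fun i k => G^[i] x + k) {u : ℝ → ℝ} (hu : Continuous u)
    (hper : Function.Periodic u 1) (hu0 : ∫ x in (0 : ℝ)..1, u x = 0) {ε : ℝ} (hε : 0 < ε) :
    ∃ n : ℕ, 0 < n ∧ ∫ x in (0 : ℝ)..1, |pullbackSum G φ n u x| ≤
      n * ((1 - Real.exp (-(2 * periodVar φ)) / 3) * (∫ x in (0 : ℝ)..1, |u x|) + 2 * ε) := by
  obtain ⟨η, hη, hosc⟩ := exists_forall_abs_sub_lt_of_periodic hu hper hε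
  obtain ⟨y, z, q, q', hyz, hq', hqq', hpk, hdist, hlen, hcover, hsmall⟩ :=
    h.exists_dynamicalPartition hα hord hη
  set W := 2 * periodVar φ
  have hW : 0 ≤ W := mul_nonneg zero_le_two
    (intervalIntegral.integral_nonneg zero_le_one fun _ _ => abs_nonneg _)
  set δ := Real.exp (-W)
  have hδ1 : δ ≤ 1 := Real.exp_le_one_iff.2 (by linarith)
  have hδ0 : 0 < δ := Real.exp_pos _
  set a : ℝ → ℝ := fun x => max (u x) 0
  set b : ℝ → ℝ := fun x => max (-u x) 0
  have ha : Continuous a := hu.max continuous_const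
  have hb : Continuous b := hu.neg.max continuous_const
  have ha0 : ∀ x, 0 ≤ a x := fun x => le_max_right _ _
  have hb0 : ∀ x, 0 ≤ b x := fun x => le_max_right _ _
  have hap : Function.Periodic a 1 := fun x => by simp only [a, hper x]
  have hbp : Function.Periodic b 1 := fun x => by simp only [b, hper x]
  have hab : ∀ x, u x = a x - b x := fun x => by
    simp only [a, b]
    rcases le_total (u x) 0 with hx | hx
    · rw [max_eq_right hx, max_eq_left (by linarith)]; ring
    · rw [max_eq_left hx, max_eq_right (by linarith)]; ring
  have habs : ∀ x, |u x| = a x + b x := fun x => by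
    simp only [a, b]
    rcases le_total (u x) 0 with hx | hx
    · rw [max_eq_right hx, max_eq_left (by linarith), abs_of_nonpos hx]; ring
    · rw [max_eq_left hx, max_eq_right (by linarith), abs_of_nonneg hx]; ring
  have haosc : ∀ s t, |s - t| < η → a s ≤ a t + ε := fun s t hst => by
    have := (abs_lt.1 (hosc s t hst)).2
    exact max_le (by linarith [le_max_left (u t) 0]) (by linarith [ha0 t])
  have hbosc : ∀ s t, |s - t| < η → b s ≤ b t + ε := fun s t hst => by
    have := (abs_lt.1 (hosc s t hst)).1
    exact max_le (by linarith [le_max_left (-u t) 0]) (by linarith [hb0 t])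
  set m := ∫ x in (0 : ℝ)..1, a x with hm
  have hbm : ∫ x in (0 : ℝ)..1, b x = m := by
    have : ∫ x in (0 : ℝ)..1, u x = m - ∫ x in (0 : ℝ)..1, b x := by
      simp only [hab]
      exact intervalIntegral.integral_sub (ha.intervalIntegrable _ _) (hb.intervalIntegrable _ _)
    linarith
  have hum : ∫ x in (0 : ℝ)..1, |u x| = 2 * m := by
    simp only [habs]
    rw [intervalIntegral.integral_add (ha.intervalIntegrable _ _) (hb.intervalIntegrable _ _),
      hbm, two_mul]
  set n := q' + (q + q')
  set A := pullbackSum G φ n a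
  set B := pullbackSum G φ n b
  have hA : Continuous A := h.continuous_pullbackSum ha n
  have hB : Continuous B := h.continuous_pullbackSum hb n
  have hnn : ∀ {f : ℝ → ℝ}, (∀ x, 0 ≤ f x) → ∀ x, 0 ≤ pullbackSum G φ n f x := fun hf x =>
    Finset.sum_nonneg fun j _ => mul_nonneg (hf _) (Real.exp_pos _).le
  set E := δ * (m - 2 * ε)
  have hyz' : G^[q'] y < G^[q'] z := strictMono_iterate_orderIso G q' hyz
  have hz0 : 0 < G^[q'] z - G^[q'] y := sub_pos.2 hyz'
  have hclose : ∀ j, ∀ s ∈ Icc (G^[j] (G^[q'] y)) (G^[j] (G^[q'] z)),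
      ∀ t ∈ Icc (G^[j] (G^[q'] y)) (G^[j] (G^[q'] z)), |s - t| < η := fun j s hs t ht => by
    rw [← Function.iterate_add_apply, ← Function.iterate_add_apply] at hs ht
    have := hsmall (j + q')
    rw [abs_lt]
    constructor <;> linarith [hs.1, hs.2, ht.1, ht.2]
  have hmin : q' * E ≤ ∫ x in (0 : ℝ)..1, min (A x) (B x) := by
    set κ := E / (G^[q'] z - G^[q'] y)
    have hκ : ∀ x ∈ Icc (G^[q'] y) (G^[q'] z), κ ≤ pullbackSum G φ (q + q') a x ∧
        κ ≤ pullbackSum G φ (q + q') b x := fun x hx => by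
      simp only [κ]
      rw [div_le_iff₀' hz0, div_le_iff₀' hz0]
      constructor
      · exact h.le_mul_pullbackSum ha hap ha0 hyz' hdist hlen hcover hε.le
          (fun j _ s hs t ht => haosc s t (hclose j s hs t ht)) hx
      · have := h.le_mul_pullbackSum hb hbp hb0 hyz' hdist hlen hcover hε.le
          (fun j _ s hs t ht => hbosc s t (hclose j s hs t ht)) hx
        rwa [hbm] at this
    refine le_trans ?_ (hpk.sum_le hyz.le (hA.min hB) (fun x => le_min (hnn ha0 x) (hnn hb0 x))
      fun x => by
        simp only [A, B, h.periodic_pullbackSum hap n x, h.periodic_pullbackSum hbp n x])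
    have hterm : ∀ i ∈ Finset.range q', E ≤ ∫ x in G^[i] y..G^[i] z, min (A x) (B x) := by
      intro i hi
      obtain ⟨l, hl⟩ := Nat.exists_eq_add_of_le (Finset.mem_range.1 hi).le
      have hmono := (strictMono_iterate_orderIso G l).monotone
      have hcomp : ∀ x, G^[l] (G^[i] x) = G^[q'] x := fun x => by
        rw [hl, add_comm, Function.iterate_add_apply]
      have hint : ∫ x in G^[i] y..G^[i] z, κ * Real.exp (birkhoffSum G φ l x) = E := by
        have := h.integral_pullback (continuous_const (y := κ)) l (G^[i] y) (G^[i] z)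
        rw [this, intervalIntegral.integral_const, smul_eq_mul, hcomp, hcomp]
        simp only [κ]
        field_simp
      rw [← hint]
      refine intervalIntegral.integral_mono_on ((strictMono_iterate_orderIso G i).monotone hyz.le)
        ((h.continuous_pullback (continuous_const (y := κ)) l).intervalIntegrable _ _)
        ((hA.min hB).intervalIntegrable _ _) fun x hx => ?_
      have hxl : G^[l] x ∈ Icc (G^[q'] y) (G^[q'] z) := by
        rw [← hcomp, ← hcomp]; exact ⟨hmono hx.1, hmono hx.2⟩
      rw [mul_comm]
      refine le_min ?_ ?_
      · exact (mul_le_mul_of_nonneg_left (hκ _ hxl).1 (Real.exp_pos _).le).trans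
          (exp_mul_pullbackSum_le a ha0 (by omega) x)
      · exact (mul_le_mul_of_nonneg_left (hκ _ hxl).2 (Real.exp_pos _).le).trans
          (exp_mul_pullbackSum_le b hb0 (by omega) x)
    calc _ = ∑ i ∈ Finset.range q', E := by simp
      _ ≤ _ := Finset.sum_le_sum hterm
  have hmin0 : 0 ≤ ∫ x in (0 : ℝ)..1, min (A x) (B x) :=
    intervalIntegral.integral_nonneg zero_le_one fun x _ => le_min (hnn ha0 x) (hnn hb0 x)
  have hnorm : ∫ x in (0 : ℝ)..1, |pullbackSum G φ n u x| =
      2 * (n * m) - 2 * ∫ x in (0 : ℝ)..1, min (A x) (B x) := by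
    have hpt : ∀ x, |pullbackSum G φ n u x| = A x + B x - 2 * min (A x) (B x) := fun x => by
      have : pullbackSum G φ n u x = A x - B x := by
        simp only [A, B, pullbackSum, ← Finset.sum_sub_distrib, ← sub_mul, hab]
      rw [this, ← max_sub_min_eq_abs', ← min_add_max (A x) (B x)]
      ring
    simp only [hpt]
    have hi1 : IntervalIntegrable (fun x => A x + B x) volume 0 1 :=
      (hA.add hB).intervalIntegrable _ _
    have hi2 : IntervalIntegrable (fun x => 2 * min (A x) (B x)) volume 0 1 :=
      (continuous_const.mul (hA.min hB)).intervalIntegrable _ _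
    rw [intervalIntegral.integral_sub hi1 hi2,
      intervalIntegral.integral_add (hA.intervalIntegrable _ _) (hB.intervalIntegrable _ _),
      intervalIntegral.integral_const_mul, h.integral_pullbackSum ha hap,
      h.integral_pullbackSum hb hbp, hbm]
    ring
  refine ⟨n, by omega, ?_⟩
  rw [hnorm, hum]
  have hn0 : (0 : ℝ) ≤ n := n.cast_nonneg
  have hn3 : (n : ℝ) ≤ 3 * q' := by
    have : n ≤ 3 * q' := by omega
    exact_mod_cast this
  rcases le_or_gt 0 (m - 2 * ε) with hE | hE
  · have h1 : n / 3 * E ≤ q' * E :=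
      mul_le_mul_of_nonneg_right (by linarith) (mul_nonneg hδ0.le hE)
    have h2 : 2 * (n * m) - 2 * (n / 3 * E) ≤ n * ((1 - δ / 3) * (2 * m) + 2 * ε) := by
      have : (n : ℝ) * (ε * δ) ≤ n * ε := by
        gcongr
        exact mul_le_of_le_one_right hε.le hδ1
      have h0 : 0 ≤ (n : ℝ) * ε := by positivity
      simp only [E]
      nlinarith
    linarith
  · have h2 : 2 * (n * m) ≤ n * ((1 - δ / 3) * (2 * m) + 2 * ε) := by
      have h3 : δ * m ≤ 2 * ε := by
        rcases le_or_gt m 0 with hm0 | hm0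
        · exact (mul_nonpos_of_nonneg_of_nonpos hδ0.le hm0).trans (by positivity)
        · exact (mul_le_of_le_one_left hm0.le hδ1).trans (by linarith)
      calc 2 * (n * m) = n * (2 * m) := by ring
        _ ≤ _ := by
          gcongr
          linarith
    linarith

end SmoothLift

/-! ### Contractions with contracting averages -/

section Abstract

variable {E : Type*} [AddCommGroup E] [Module ℝ E] (N : Seminorm ℝ E) {U : Module.End ℝ E}

theorem seminorm_pow_le (hU : ∀ v, N (U v) ≤ N v) (j : ℕ) (v : E) : N ((U ^ j) v) ≤ N v := by
  induction j with
  | zero => simp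
  | succ j ih => rw [pow_succ', Module.End.mul_apply]; exact (hU _).trans ih

theorem seminorm_geomSum_le (hU : ∀ v, N (U v) ≤ N v) (n : ℕ) (v : E) :
    N ((∑ j ∈ Finset.range n, U ^ j) v) ≤ n * N v := by
  rw [LinearMap.sum_apply]
  calc _ ≤ ∑ j ∈ Finset.range n, N ((U ^ j) v) :=
        Finset.le_sum_of_subadditive N (map_zero N).le (map_add_le_add N) _ _
    _ ≤ ∑ j ∈ Finset.range n, N v := Finset.sum_le_sum fun j _ => seminorm_pow_le N hU j v
    _ = _ := by simp

theorem subadditive_seminorm_geomSum (hU : ∀ v, N (U v) ≤ N v) (u : E) :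
    Subadditive fun n => N ((∑ j ∈ Finset.range n, U ^ j) u) := fun m n => by
  have : ∑ j ∈ Finset.range (m + n), U ^ j =
      ∑ j ∈ Finset.range m, U ^ j + U ^ m * ∑ j ∈ Finset.range n, U ^ j := by
    rw [Finset.sum_range_add, Finset.mul_sum]
    simp only [pow_add]
  dsimp only
  rw [this, LinearMap.add_apply, Module.End.mul_apply]
  exact (map_add_le_add N _ _).trans (add_le_add le_rfl (seminorm_pow_le N hU m _))

theorem mul_seminorm_geomSum_le (hU : ∀ v, N (U v) ≤ N v) (m k : ℕ) (u : E) :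
    m * N ((∑ j ∈ Finset.range k, U ^ j) u) ≤
      N ((∑ j ∈ Finset.range k, U ^ j) ((∑ j ∈ Finset.range m, U ^ j) u)) +
        m * (2 * m * N u) := by
  set S : ℕ → Module.End ℝ E := fun n => ∑ j ∈ Finset.range n, U ^ j
  have hcomm : ∀ a b, S a * S b = S b * S a := fun a b =>
    (Commute.sum_left _ _ _ fun i _ => Commute.sum_right _ _ _ fun j _ =>
      (Commute.refl U).pow_pow i j)
  have hgeom : ∀ j, (U ^ j - 1) * S k = (U ^ k - 1) * S j := fun j => by
    have h1 : U ^ j - 1 = S j * (U - 1) := (geom_sum_mul U j).symm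
    have h2 : U ^ k - 1 = (U - 1) * S k := (mul_geom_sum U k).symm
    have h3 : (U - 1) * S k = S k * (U - 1) := by
      rw [mul_geom_sum U k, geom_sum_mul U k]
    rw [h1, h2, h3, mul_assoc, h3, ← mul_assoc, hcomm, mul_assoc, mul_assoc]
    congr 1
    rw [mul_geom_sum U j, geom_sum_mul U j]
  have hdiff : S k * S m - (m : ℝ) • S k = ∑ j ∈ Finset.range m, (U ^ k - 1) * S j := by
    rw [hcomm]
    simp only [← hgeom]
    rw [← Finset.sum_mul, Finset.sum_sub_distrib, sub_mul]
    congr 1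
    simp [Nat.cast_smul_eq_nsmul]
  have hterm : ∀ j ∈ Finset.range m, N (((U ^ k - 1) * S j) u) ≤ 2 * m * N u := fun j hj => by
    rw [Module.End.mul_apply, LinearMap.sub_apply, Module.End.one_apply]
    have h1 := seminorm_pow_le N hU k (S j u)
    have h2 := seminorm_geomSum_le N hU j u
    have h3 : (j : ℝ) * N u ≤ m * N u := by
      have : (j : ℝ) ≤ m := by exact_mod_cast (Finset.mem_range.1 hj).le
      exact mul_le_mul_of_nonneg_right this (apply_nonneg N u)
    have h4 := map_sub_le_add N ((U ^ k) (S j u)) (S j u)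
    linarith
  have hsum : N ((S k * S m - (m : ℝ) • S k) u) ≤ m * (2 * m * N u) := by
    rw [hdiff, LinearMap.sum_apply]
    calc _ ≤ ∑ j ∈ Finset.range m, N (((U ^ k - 1) * S j) u) :=
          Finset.le_sum_of_subadditive N (map_zero N).le (map_add_le_add N) _ _
      _ ≤ ∑ j ∈ Finset.range m, 2 * m * N u := Finset.sum_le_sum hterm
      _ = _ := by simp
  rw [LinearMap.sub_apply, Module.End.mul_apply, LinearMap.smul_apply] at hsum
  have h5 : N ((m : ℝ) • S k u) = m * N (S k u) := by
    rw [map_smul_eq_mul]; simp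
  have h6 := map_sub_le_add N (S k (S m u)) (S k (S m u) - (m : ℝ) • S k u)
  rw [sub_sub_cancel, h5] at h6
  exact h6.trans (add_le_add le_rfl hsum)

theorem tendsto_seminorm_average (hU : ∀ v, N (U v) ≤ N v) {δ : ℝ} (hδ : 0 < δ)
    (hc : ∀ v, ∀ ε > 0, ∃ n : ℕ, 0 < n ∧
      N ((∑ j ∈ Finset.range n, U ^ j) v) ≤ n * ((1 - δ) * N v + ε)) (u : E) :
    Tendsto (fun n : ℕ => N ((∑ j ∈ Finset.range n, U ^ j) u) / n) atTop (𝓝 0) := by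
  have hsub := subadditive_seminorm_geomSum N hU u
  have hbdd : BddBelow (range fun n : ℕ => N ((∑ j ∈ Finset.range n, U ^ j) u) / n) :=
    ⟨0, by rintro _ ⟨n, rfl⟩; exact div_nonneg (apply_nonneg N _) n.cast_nonneg⟩
  have hlim := hsub.tendsto_lim hbdd
  set c := hsub.lim
  have hc0 : 0 ≤ c := ge_of_tendsto' hlim fun n => div_nonneg (apply_nonneg N _) n.cast_nonneg
  have hm : ∀ m : ℕ, m * c ≤ (1 - δ) * N ((∑ j ∈ Finset.range m, U ^ j) u) := fun m => by
    refine le_of_forall_pos_le_add fun ε hε => ?_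
    set v := (∑ j ∈ Finset.range m, U ^ j) u
    obtain ⟨n, hn, hnv⟩ := hc v ε hε
    have hsubv := subadditive_seminorm_geomSum N hU v
    have hn' : (0 : ℝ) < n := by exact_mod_cast hn
    have hnr : Tendsto (fun r : ℕ => n * r) atTop atTop := tendsto_id.const_mul_atTop' hn
    have h1 : Tendsto (fun r : ℕ => (1 - δ) * N v + ε + m * (2 * m * N u) / ((n * r : ℕ) : ℝ))
        atTop (𝓝 ((1 - δ) * N v + ε + 0)) :=
      tendsto_const_nhds.add ((tendsto_const_nhds.div_atTop tendsto_natCast_atTop_atTop).comp hnr)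
    rw [add_zero] at h1
    refine le_of_tendsto_of_tendsto ((hlim.comp hnr).const_mul (m : ℝ)) h1 ?_
    filter_upwards [eventually_gt_atTop 0] with r hr
    have hr' : (0 : ℝ) < r := by exact_mod_cast hr
    have h2 := mul_seminorm_geomSum_le N hU m (n * r) u
    have h3 := hsubv.apply_mul_add_le r n 0
    simp only [add_zero, Finset.range_zero, Finset.sum_empty, LinearMap.zero_apply, map_zero] at h3
    rw [mul_comm r n] at h3
    have h4 : r * N ((∑ j ∈ Finset.range n, U ^ j) v) ≤ r * (n * ((1 - δ) * N v + ε)) := by gcongr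
    have hpos : (0 : ℝ) < ((n * r : ℕ) : ℝ) := by push_cast; positivity
    simp only [Function.comp]
    rw [← mul_div_assoc, div_le_iff₀ hpos, add_mul, div_mul_cancel₀ _ hpos.ne', Nat.cast_mul]
    linarith
  have hcδ : c ≤ (1 - δ) * c := by
    refine ge_of_tendsto (hlim.const_mul (1 - δ)) ?_
    filter_upwards [eventually_gt_atTop 0] with m hm0
    have hm' : (0 : ℝ) < m := by exact_mod_cast hm0
    rw [← mul_div_assoc, le_div_iff₀ hm', mul_comm]
    exact hm m
  have : c = 0 := by nlinarith
  rwa [this] at hlim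

end Abstract

/-! ### Diffeomorphisms without periodic points -/

/-- Continuous densities of zero mean on the circle. -/
def zeroMean : Submodule ℝ (ℝ → ℝ) where
  carrier := {u | Continuous u ∧ Function.Periodic u 1 ∧ ∫ x in (0 : ℝ)..1, u x = 0}
  add_mem' {u v} hu hv := ⟨hu.1.add hv.1, hu.2.1.add hv.2.1, by
    have := intervalIntegral.integral_add (hu.1.intervalIntegrable 0 1)
      (hv.1.intervalIntegrable 0 1) (μ := volume)
    rw [hu.2.2, hv.2.2, add_zero] at this
    exact this⟩
  zero_mem' := ⟨continuous_const, fun _ => rfl, by simp⟩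
  smul_mem' c u hu := ⟨hu.1.const_smul c, hu.2.1.smul c, by
    simp only [Pi.smul_apply, intervalIntegral.integral_smul, hu.2.2, smul_zero]⟩

/-- The `L¹` seminorm on densities of zero mean. -/
noncomputable def zeroMeanNorm : Seminorm ℝ zeroMean :=
  Seminorm.of (fun u => ∫ x in (0 : ℝ)..1, |u.1 x|)
    (fun u v => by
      rw [← intervalIntegral.integral_add (u.2.1.abs.intervalIntegrable _ _)
        (v.2.1.abs.intervalIntegrable _ _)]
      exact intervalIntegral.integral_mono_on zero_le_one
        ((u + v).2.1.abs.intervalIntegrable _ _)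
        ((u.2.1.abs.add v.2.1.abs).intervalIntegrable _ _) fun x _ => abs_add_le _ _)
    (fun c u => by
      rw [← intervalIntegral.integral_const_mul]
      simp [abs_mul])

namespace SmoothLift

variable {G : ℝ ≃o ℝ} {φ : ℝ → ℝ}

/-- The action of a lift on densities of zero mean by pullback. -/
noncomputable def pullback (h : SmoothLift G φ) : Module.End ℝ zeroMean where
  toFun u := ⟨fun x => u.1 (G x) * Real.exp (φ x), by
    have e : (fun x => u.1 (G x) * Real.exp (φ x)) =
        fun x => u.1 (G^[1] x) * Real.exp (birkhoffSum G φ 1 x) := by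
      simp [birkhoffSum_one]
    rw [e]
    refine ⟨h.continuous_pullback u.2.1 1, h.periodic_pullback u.2.2.1 1, ?_⟩
    rw [h.integral_pullback_period u.2.1 u.2.2.1, u.2.2.2]⟩
  map_add' u v := Subtype.ext (funext fun x => add_mul _ _ _)
  map_smul' c u := Subtype.ext (funext fun x => mul_assoc _ _ _)

theorem pullback_pow_apply (h : SmoothLift G φ) (j : ℕ) (u : zeroMean) (x : ℝ) :
    ((h.pullback ^ j) u).1 x = u.1 (G^[j] x) * Real.exp (birkhoffSum G φ j x) := by
  induction j generalizing x with
  | zero => simp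
  | succ j ih =>
    rw [pow_succ', Module.End.mul_apply]
    change ((h.pullback ^ j) u).1 (G x) * Real.exp (φ x) = _
    rw [ih, birkhoffSum_succ', Real.exp_add, Function.iterate_succ_apply]
    ring

theorem geomSum_pullback_apply (h : SmoothLift G φ) (n : ℕ) (u : zeroMean) (x : ℝ) :
    ((∑ j ∈ Finset.range n, h.pullback ^ j) u).1 x = pullbackSum G φ n u.1 x := by
  rw [LinearMap.sum_apply, AddSubmonoidClass.coe_finsetSum, Finset.sum_apply]
  exact Finset.sum_congr rfl fun j _ => h.pullback_pow_apply j u x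

theorem zeroMeanNorm_pullback_le (h : SmoothLift G φ) (u : zeroMean) :
    zeroMeanNorm (h.pullback u) ≤ zeroMeanNorm u := by
  have := h.integral_pullback_period (f := fun x => |u.1 x|) u.2.1.abs
    (fun x => by simp only [u.2.2.1 x]) 1
  refine le_of_eq (Eq.trans ?_ this)
  refine intervalIntegral.integral_congr fun x _ => ?_
  change |u.1 (G x) * Real.exp (φ x)| = _
  rw [abs_mul, abs_of_pos (Real.exp_pos _), birkhoffSum_one]
  rfl

theorem hasDerivAt_birkhoffSum (h : SmoothLift G φ) (n : ℕ) (x : ℝ) :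
    HasDerivAt (birkhoffSum G φ n) (pullbackSum G φ n (deriv φ) x) x := by
  have : birkhoffSum G φ n = ∑ j ∈ Finset.range n, φ ∘ G^[j] := by
    ext x; simp [birkhoffSum]
  rw [this]
  exact HasDerivAt.sum fun j _ =>
    ((h.contDiff.differentiable one_ne_zero _).hasDerivAt).comp x (h.hasDerivAt_iterate j x)

/-- The logarithmic derivatives of the iterates of a smooth circle diffeomorphism without periodic
points have sublinear variation. -/
theorem tendsto_eVariationOn_birkhoffSum_div (h : SmoothLift G φ)
    (haper : ∀ n : ℕ, 0 < n → ∀ (x : ℝ) (k : ℤ), G^[n] x ≠ x + k) :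
    Tendsto (fun n : ℕ => eVariationOn (birkhoffSum G φ n) (Icc 0 1) / n) atTop (𝓝 0) := by
  obtain ⟨α, hα, hord⟩ := exists_rotationOrdered h.add_one haper
  have hd : Continuous (deriv φ) := h.contDiff.continuous_deriv le_rfl
  have hdp : Function.Periodic (deriv φ) 1 := fun x => by
    rw [← deriv_comp_add_const, funext h.periodic]
  have hmean : ∫ x in (0 : ℝ)..1, deriv φ x = 0 := by
    rw [intervalIntegral.integral_deriv_eq_sub
      (fun x _ => (h.contDiff.differentiable one_ne_zero).differentiableAt)
      (hd.intervalIntegrable _ _)]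
    have := h.periodic 0
    rw [zero_add] at this
    rw [this, sub_self]
  let u : zeroMean := ⟨deriv φ, hd, hdp, hmean⟩
  have hnorm : ∀ (n : ℕ) (v : zeroMean), zeroMeanNorm ((∑ j ∈ Finset.range n, h.pullback ^ j) v) =
      ∫ x in (0 : ℝ)..1, |pullbackSum G φ n v.1 x| := fun n v =>
    intervalIntegral.integral_congr fun x _ => by
      simp only [h.geomSum_pullback_apply]
  have hlim := tendsto_seminorm_average zeroMeanNorm h.zeroMeanNorm_pullback_le
    (δ := Real.exp (-(2 * periodVar φ)) / 3) (by positivity)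
    (fun v ε hε => by
      obtain ⟨n, hn, hle⟩ := h.exists_integral_abs_pullbackSum_le hα hord v.2.1 v.2.2.1 v.2.2.2
        (half_pos hε)
      refine ⟨n, hn, ?_⟩
      rw [hnorm]
      rwa [mul_div_cancel₀ _ two_ne_zero] at hle) u
  have hlim' := ENNReal.tendsto_ofReal hlim
  rw [ENNReal.ofReal_zero] at hlim'
  refine tendsto_of_tendsto_of_tendsto_of_le_of_le' tendsto_const_nhds hlim'
    (Eventually.of_forall fun _ => zero_le) ?_
  filter_upwards [eventually_gt_atTop 0] with n hn
  rw [ENNReal.ofReal_div_of_pos (by exact_mod_cast hn), ENNReal.ofReal_natCast, hnorm]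
  gcongr
  have hderiv : deriv (birkhoffSum G φ n) = pullbackSum G φ n (deriv φ) :=
    funext fun x => (h.hasDerivAt_birkhoffSum n x).deriv
  have hC1 : ContDiff ℝ 1 (birkhoffSum G φ n) := contDiff_one_iff_deriv.2
    ⟨fun x => (h.hasDerivAt_birkhoffSum n x).differentiableAt, by
      rw [hderiv]; exact h.continuous_pullbackSum hd n⟩
  have := eVariationOn_le_integral_abs_deriv hC1 0 1
  rwa [hderiv] at this

end SmoothLift

/-! ### Comparison of asymptotic distortions -/

theorem exists_common_limit {v v' w : ℕ → ℝ≥0∞} {m : ℕ} (hm : 0 < m)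
    (h0 : v 0 ≠ ∞) (h1 : v 1 ≠ ∞) (hv : ∀ m n, v (m + n) ≤ v m + v n)
    (h0' : v' 0 ≠ ∞) (h1' : v' 1 ≠ ∞) (hv' : ∀ m n, v' (m + n) ≤ v' m + v' n)
    (hw : Tendsto (fun n : ℕ => w n / n) atTop (𝓝 0))
    (hle : ∀ j, v (m * j) ≤ v' (m * j) + w j) (hle' : ∀ j, v' (m * j) ≤ v (m * j) + w j) :
    ∃ L : ℝ≥0∞, L ≠ ∞ ∧ Tendsto (fun n : ℕ => v n / n) atTop (𝓝 L) ∧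
      Tendsto (fun n : ℕ => v' n / n) atTop (𝓝 L) := by
  obtain ⟨L, hL, hlim⟩ := exists_tendsto_div_of_subadditive h0 h1 hv
  obtain ⟨L', -, hlim'⟩ := exists_tendsto_div_of_subadditive h0' h1' hv'
  have : L = L' := le_antisymm (le_of_tendsto_div_of_le_add hm hlim hlim' hw hle)
    (le_of_tendsto_div_of_le_add hm hlim' hlim hw hle')
  exact ⟨L, hL, hlim, this ▸ hlim'⟩

theorem eVariationOn_ne_top_of_lipschitzOnWith {f : ℝ → ℝ} {L : NNReal} {a b : ℝ}
    (hf : LipschitzOnWith L f (Icc a b)) : eVariationOn f (Icc a b) ≠ ∞ := by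
  have h := hf.comp_eVariationOn_le (g := id) (s := Icc a b) (fun _ hx => hx)
  rw [eVariationOn_id_Icc] at h
  exact ne_top_of_le_ne_top (ENNReal.mul_ne_top ENNReal.coe_ne_top ENNReal.ofReal_ne_top) h

theorem iterate_eqOn_of_mapsTo {F G : ℝ → ℝ} {s : Set ℝ} (h : EqOn F G s) (hs : MapsTo F s s)
    (n : ℕ) : EqOn F^[n] G^[n] s := by
  intro x hx
  induction n with
  | zero => rfl
  | succ n ih =>
    rw [Function.iterate_succ_apply', Function.iterate_succ_apply', ← ih]
    exact h (hs.iterate n hx)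

/-! ### Diffeomorphisms of the interval -/

theorem intervalFun_of_mem (f : I → I) {x : ℝ} (hx : x ∈ Icc (0 : ℝ) 1) :
    intervalFun f x = f ⟨x, hx⟩ := by
  rw [intervalFun, IccExtend_of_mem _ _ hx]

theorem intervalFun_mem (f : I → I) (x : ℝ) : intervalFun f x ∈ Icc (0 : ℝ) 1 :=
  (f (projIcc 0 1 zero_le_one x)).2

theorem intervalFun_mul (f g : Equiv.Perm I) :
    intervalFun ⇑(f * g) = intervalFun f ∘ intervalFun g := by
  ext x
  rw [Function.comp_apply, intervalFun_of_mem f (intervalFun_mem g x)]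
  rfl

theorem intervalFun_one {x : ℝ} (hx : x ∈ Icc (0 : ℝ) 1) :
    intervalFun ⇑(1 : Equiv.Perm I) x = x := intervalFun_of_mem _ hx

theorem intervalFun_pow (f : Equiv.Perm I) (n : ℕ) {x : ℝ} (hx : x ∈ Icc (0 : ℝ) 1) :
    intervalFun ⇑(f ^ n) x = (intervalFun f)^[n] x := by
  induction n generalizing x with
  | zero => exact intervalFun_one hx
  | succ n ih =>
    rw [pow_succ, intervalFun_mul, Function.comp_apply, ih (intervalFun_mem f x),
      Function.iterate_succ_apply]

theorem intervalFun_inv_apply (f : Equiv.Perm I) {x : ℝ} (hx : x ∈ Icc (0 : ℝ) 1) :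
    intervalFun f (intervalFun ⇑f⁻¹ x) = x := by
  rw [← Function.comp_apply (f := intervalFun f), ← intervalFun_mul, mul_inv_cancel,
    intervalFun_one hx]

namespace IsIntervalDiffeo

variable {r : WithTop ℕ∞} {f g : Equiv.Perm I}

theorem mul (hf : IsIntervalDiffeo r f) (hg : IsIntervalDiffeo r g) :
    IsIntervalDiffeo r (f * g) := by
  constructor
  · rw [intervalFun_mul]
    exact hf.1.comp hg.1 fun x _ => intervalFun_mem g x
  · rw [mul_inv_rev, intervalFun_mul]
    exact hg.2.comp hf.2 fun x _ => intervalFun_mem _ x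

theorem one : IsIntervalDiffeo r (1 : Equiv.Perm I) := by
  have : ContDiffOn ℝ r (intervalFun ⇑(1 : Equiv.Perm I)) (Icc 0 1) :=
    contDiffOn_id.congr fun x hx => intervalFun_one hx
  exact ⟨this, by rwa [inv_one]⟩

theorem pow (hf : IsIntervalDiffeo r f) (n : ℕ) : IsIntervalDiffeo r (f ^ n) := by
  induction n with
  | zero => exact one
  | succ n ih => rw [pow_succ]; exact ih.mul hf

theorem inv (hf : IsIntervalDiffeo r f) : IsIntervalDiffeo r f⁻¹ :=
  ⟨hf.2, by rw [inv_inv]; exact hf.1⟩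

theorem of_le {s : WithTop ℕ∞} (hf : IsIntervalDiffeo r f) (h : s ≤ r) : IsIntervalDiffeo s f :=
  ⟨hf.1.of_le h, hf.2.of_le h⟩

theorem derivWithin_mul (hf : IsIntervalDiffeo 1 f) (hg : IsIntervalDiffeo 1 g) {x : ℝ}
    (hx : x ∈ Icc (0 : ℝ) 1) :
    derivWithin (intervalFun ⇑(f * g)) (Icc 0 1) x =
      derivWithin (intervalFun f) (Icc 0 1) (intervalFun g x) *
        derivWithin (intervalFun g) (Icc 0 1) x := by
  rw [intervalFun_mul]
  exact derivWithin_comp x (hf.1.differentiableOn one_ne_zero _ (intervalFun_mem g x))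
    (hg.1.differentiableOn one_ne_zero _ hx) fun y _ => intervalFun_mem g y

theorem derivWithin_one {x : ℝ} (hx : x ∈ Icc (0 : ℝ) 1) :
    derivWithin (intervalFun ⇑(1 : Equiv.Perm I)) (Icc 0 1) x = 1 := by
  have h : derivWithin (intervalFun ⇑(1 : Equiv.Perm I)) (Icc 0 1) x =
      derivWithin (id : ℝ → ℝ) (Icc 0 1) x :=
    derivWithin_congr (fun y hy => intervalFun_one hy) (intervalFun_one hx)
  rw [h, derivWithin_id _ _ (uniqueDiffOn_Icc zero_lt_one x hx)]

theorem derivWithin_ne_zero (hf : IsIntervalDiffeo 1 f) {x : ℝ} (hx : x ∈ Icc (0 : ℝ) 1) :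
    derivWithin (intervalFun f) (Icc 0 1) x ≠ 0 := by
  have h := hf.inv.derivWithin_mul hf hx
  rw [inv_mul_cancel, derivWithin_one hx] at h
  exact right_ne_zero_of_mul (h ▸ one_ne_zero)

end IsIntervalDiffeo

/-- The logarithm of the absolute derivative of an interval map. -/
noncomputable def intervalLog (f : Equiv.Perm I) (x : ℝ) : ℝ :=
  Real.log |derivWithin (intervalFun f) (Icc 0 1) x|

theorem intervalLog_eq (f : Equiv.Perm I) :
    intervalLog f = fun x => Real.log (derivWithin (intervalFun f) (Icc 0 1) x) :=
  funext fun _ => Real.log_abs _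

namespace IsIntervalDiffeo

variable {f g : Equiv.Perm I}

theorem intervalLog_mul (hf : IsIntervalDiffeo 1 f) (hg : IsIntervalDiffeo 1 g) {x : ℝ}
    (hx : x ∈ Icc (0 : ℝ) 1) :
    intervalLog (f * g) x = intervalLog f (intervalFun g x) + intervalLog g x := by
  simp only [intervalLog]
  rw [hf.derivWithin_mul hg hx, abs_mul, Real.log_mul
    (abs_ne_zero.2 (hf.derivWithin_ne_zero (intervalFun_mem g x)))
    (abs_ne_zero.2 (hg.derivWithin_ne_zero hx))]

theorem continuousOn_intervalLog (hf : IsIntervalDiffeo 1 f) :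
    ContinuousOn (intervalLog f) (Icc 0 1) := by
  rw [intervalLog_eq]
  exact (hf.1.continuousOn_derivWithin (uniqueDiffOn_Icc zero_lt_one) le_rfl).log
    fun x hx => hf.derivWithin_ne_zero hx

theorem exists_lipschitzOnWith (hf : IsIntervalDiffeo 1 f) :
    ∃ L, LipschitzOnWith L (intervalFun f) (Icc 0 1) :=
  hf.1.exists_lipschitzOnWith one_ne_zero (convex_Icc _ _) isCompact_Icc

theorem exists_lipschitzOnWith_intervalLog (hf : IsIntervalDiffeo 2 f) :
    ∃ L, LipschitzOnWith L (intervalLog f) (Icc 0 1) := by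
  have h1 : IsIntervalDiffeo 1 f := hf.of_le one_le_two
  have h2 : ContDiffOn ℝ 1 (intervalLog f) (Icc 0 1) := by
    rw [intervalLog_eq]
    exact (hf.1.derivWithin (m := 1) (uniqueDiffOn_Icc zero_lt_one)
      (by rw [one_add_one_eq_two])).log fun x hx => h1.derivWithin_ne_zero hx
  exact h2.exists_lipschitzOnWith one_ne_zero (convex_Icc _ _) isCompact_Icc

theorem injOn_intervalFun (f : Equiv.Perm I) : InjOn (intervalFun f) (Icc 0 1) := by
  intro x hx y hy h
  have := congrArg (intervalFun ⇑f⁻¹) h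
  have e : ∀ z ∈ Icc (0 : ℝ) 1, intervalFun ⇑f⁻¹ (intervalFun f z) = z := fun z hz => by
    simpa using intervalFun_inv_apply f⁻¹ hz
  rwa [e x hx, e y hy] at this

theorem image_intervalFun (f : Equiv.Perm I) : intervalFun f '' Icc 0 1 = Icc 0 1 :=
  Subset.antisymm (image_subset_iff.2 fun x _ => intervalFun_mem f x) fun x hx =>
    ⟨intervalFun ⇑f⁻¹ x, intervalFun_mem _ x, intervalFun_inv_apply f hx⟩

theorem strictMonoOn_or_strictAntiOn (hf : IsIntervalDiffeo 1 f) :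
    StrictMonoOn (intervalFun f) (Icc 0 1) ∨ StrictAntiOn (intervalFun f) (Icc 0 1) :=
  (le_total (intervalFun f 0) (intervalFun f 1)).imp
    (fun h => hf.1.continuousOn.strictMonoOn_of_injOn_Icc zero_le_one h (injOn_intervalFun f))
    (fun h => hf.1.continuousOn.strictAntiOn_of_injOn_Icc zero_le_one h (injOn_intervalFun f))

theorem eVariationOn_comp (hf : IsIntervalDiffeo 1 f) (φ : ℝ → ℝ) :
    eVariationOn (fun x => φ (intervalFun f x)) (Icc 0 1) = eVariationOn φ (Icc 0 1) := by
  conv_rhs => rw [← image_intervalFun f]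
  rcases hf.strictMonoOn_or_strictAntiOn with h | h
  · exact eVariationOn.comp_eq_of_monotoneOn φ _ h.monotoneOn
  · exact eVariationOn.comp_eq_of_antitoneOn φ _ h.antitoneOn

theorem intervalVarLog_ne_top (hf : IsIntervalDiffeo 2 f) : intervalVarLog f ≠ ∞ := by
  obtain ⟨L, hL⟩ := hf.exists_lipschitzOnWith_intervalLog
  exact eVariationOn_ne_top_of_lipschitzOnWith hL

theorem intervalVarLog_mul_le (hf : IsIntervalDiffeo 1 f) (hg : IsIntervalDiffeo 1 g) :
    intervalVarLog (f * g) ≤ intervalVarLog f + intervalVarLog g := by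
  have h : eVariationOn (intervalLog (f * g)) (Icc 0 1) =
      eVariationOn (fun x => intervalLog f (intervalFun g x) + intervalLog g x) (Icc 0 1) :=
    eVariationOn.congr fun x hx => hf.intervalLog_mul hg hx
  refine h.trans_le ((eVariationOn_add_le _).trans_eq ?_)
  rw [hg.eVariationOn_comp]
  rfl

theorem intervalVarLog_pow_add_le (hf : IsIntervalDiffeo 1 f) (m n : ℕ) :
    intervalVarLog (f ^ (m + n)) ≤ intervalVarLog (f ^ m) + intervalVarLog (f ^ n) := by
  rw [pow_add]
  exact (hf.pow m).intervalVarLog_mul_le (hf.pow n)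

/-- The increasing homeomorphism of the line extending an increasing diffeomorphism of the interval
by the identity. -/
theorem exists_orderIso_of_strictMonoOn
    (hmono : StrictMonoOn (intervalFun f) (Icc 0 1)) :
    ∃ K : ℝ ≃o ℝ, K 0 = 0 ∧ K 1 = 1 ∧ EqOn (intervalFun f) K (Icc 0 1) := by
  classical
  let k : ℝ → ℝ := fun x => if x ∈ Icc (0 : ℝ) 1 then intervalFun f x else x
  have hin : ∀ x ∈ Icc (0 : ℝ) 1, k x = intervalFun f x := fun x hx => if_pos hx
  have hout : ∀ x ∉ Icc (0 : ℝ) 1, k x = x := fun x hx => if_neg hx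
  have hk : StrictMono k := fun x y hxy => by
    by_cases hx : x ∈ Icc (0 : ℝ) 1 <;> by_cases hy : y ∈ Icc (0 : ℝ) 1
    · rw [hin x hx, hin y hy]; exact hmono hx hy hxy
    · rw [hin x hx, hout y hy]
      have : 1 < y := by
        by_contra! hcon
        exact hy ⟨hx.1.trans hxy.le, hcon⟩
      exact (intervalFun_mem f x).2.trans_lt this
    · rw [hout x hx, hin y hy]
      have : x < 0 := by
        by_contra! hcon
        exact hx ⟨hcon, hxy.le.trans hy.2⟩
      exact this.trans_le (intervalFun_mem f y).1
    · rwa [hout x hx, hout y hy]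
  have hsurj : Function.Surjective k := fun y => by
    by_cases hy : y ∈ Icc (0 : ℝ) 1
    · exact ⟨intervalFun ⇑f⁻¹ y, by rw [hin _ (intervalFun_mem _ y), intervalFun_inv_apply f hy]⟩
    · exact ⟨y, hout y hy⟩
  have himg := image_intervalFun f
  have h0 : (0 : ℝ) ∈ Icc (0 : ℝ) 1 := ⟨le_rfl, zero_le_one⟩
  have h1 : (1 : ℝ) ∈ Icc (0 : ℝ) 1 := ⟨zero_le_one, le_rfl⟩
  refine ⟨hk.orderIsoOfSurjective k hsurj, ?_, ?_, fun x hx => (hin x hx).symm⟩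
  · change k 0 = 0
    rw [hin 0 h0]
    obtain ⟨x, hx, hx0⟩ := himg.symm.subset h0
    exact le_antisymm (hx0 ▸ hmono.monotoneOn h0 hx hx.1) (intervalFun_mem f 0).1
  · change k 1 = 1
    rw [hin 1 h1]
    obtain ⟨x, hx, hx1⟩ := himg.symm.subset h1
    refine le_antisymm (intervalFun_mem f 1).2 ?_
    calc (1 : ℝ) = intervalFun f x := hx1.symm
      _ ≤ _ := hmono.monotoneOn hx h1 hx.2

end IsIntervalDiffeo

theorem intervalLog_conj {f g h : Equiv.Perm I} (hf : IsIntervalDiffeo 1 f)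
    (hg : IsIntervalDiffeo 1 g) (hh : IsIntervalDiffeo 1 h) (hfg : f = h * g * h⁻¹) {x : ℝ}
    (hx : x ∈ Icc (0 : ℝ) 1) :
    intervalLog f (intervalFun h x) =
      intervalLog g x + (intervalLog h (intervalFun g x) - intervalLog h x) := by
  have e : f * h = h * g := by rw [hfg]; group
  have h1 := hf.intervalLog_mul hh hx
  have h2 := hh.intervalLog_mul hg hx
  rw [e] at h1
  linarith

theorem intervalDist_conj (f g h : Equiv.Perm I) (hf : IsIntervalDiffeo 2 f)
    (hg : IsIntervalDiffeo 2 g) (hh : IsIntervalDiffeo 1 h) (hfg : f = h * g * h⁻¹) :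
    ∃ L : ℝ≥0∞, L ≠ ∞ ∧ Tendsto (fun n : ℕ => intervalVarLog (f ^ n) / n) atTop (𝓝 L) ∧
      Tendsto (fun n : ℕ => intervalVarLog (g ^ n) / n) atTop (𝓝 L) := by
  have hf1 : IsIntervalDiffeo 1 f := hf.of_le one_le_two
  have hg1 : IsIntervalDiffeo 1 g := hg.of_le one_le_two
  have hpow : ∀ n, f ^ n = h * g ^ n * h⁻¹ := fun n => by rw [hfg, conj_pow]
  have hmono : StrictMonoOn (intervalFun ⇑(g ^ 2)) (Icc 0 1) := by
    rw [pow_two, intervalFun_mul]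
    have hmaps : MapsTo (intervalFun g) (Icc 0 1) (Icc 0 1) := fun x _ => intervalFun_mem g x
    rcases hg1.strictMonoOn_or_strictAntiOn with hm | hm
    · exact hm.comp hm hmaps
    · exact hm.comp hm hmaps
  obtain ⟨K, hK0, hK1, hK⟩ := IsIntervalDiffeo.exists_orderIso_of_strictMonoOn hmono
  have hiter : ∀ j, EqOn (intervalFun ⇑(g ^ (2 * j))) K^[j] (Icc 0 1) := fun j x hx => by
    rw [pow_mul, intervalFun_pow _ _ hx]
    exact iterate_eqOn_of_mapsTo hK (fun y _ => intervalFun_mem _ y) j hx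
  obtain ⟨L₁, hL₁⟩ := (hf.pow 2).exists_lipschitzOnWith_intervalLog
  obtain ⟨L₂, hL₂⟩ := (hg.pow 2).exists_lipschitzOnWith_intervalLog
  obtain ⟨L₃, hL₃⟩ := hh.exists_lipschitzOnWith
  have hθ : LipschitzOnWith (L₁ * L₃ + L₂)
      (fun z => intervalLog h (K z) - intervalLog h z) (Icc 0 1) := by
    have heq : ∀ x ∈ Icc (0 : ℝ) 1, intervalLog h (K x) - intervalLog h x =
        (intervalLog (f ^ 2) ∘ intervalFun h) x - intervalLog (g ^ 2) x := fun x hx => by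
      have := intervalLog_conj (hf1.pow 2) (hg1.pow 2) hh (hpow 2) hx
      rw [hK hx] at this
      simp only [Function.comp_apply]
      linarith
    intro x hx y hy
    simp only [heq x hx, heq y hy]
    exact (hL₁.comp hL₃ fun x _ => intervalFun_mem h x).sub hL₂ hx hy
  have hw := tendsto_eVariationOn_coboundary_div zero_le_one hK0 hK1
    hh.continuousOn_intervalLog hθ
  have hconj : ∀ j, EqOn (fun x => intervalLog (f ^ (2 * j)) (intervalFun h x))
      (fun x => intervalLog (g ^ (2 * j)) x + (intervalLog h (K^[j] x) - intervalLog h x))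
      (Icc 0 1) := fun j x hx => by
    have := intervalLog_conj (hf1.pow (2 * j)) (hg1.pow (2 * j)) hh (hpow (2 * j)) hx
    rwa [hiter j hx] at this
  refine exists_common_limit (m := 2) two_pos (hf.pow 0).intervalVarLog_ne_top
    (hf.pow 1).intervalVarLog_ne_top hf1.intervalVarLog_pow_add_le
    (hg.pow 0).intervalVarLog_ne_top (hg.pow 1).intervalVarLog_ne_top
    hg1.intervalVarLog_pow_add_le hw (fun j => ?_) (fun j => ?_)
  · calc intervalVarLog (f ^ (2 * j)) = eVariationOn (intervalLog (f ^ (2 * j))) (Icc 0 1) := rfl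
      _ = _ := (hh.eVariationOn_comp _).symm
      _ = _ := eVariationOn.congr (hconj j)
      _ ≤ _ := eVariationOn_add_le _
  · calc intervalVarLog (g ^ (2 * j)) = eVariationOn (fun x =>
          intervalLog (f ^ (2 * j)) (intervalFun h x) -
            (intervalLog h (K^[j] x) - intervalLog h x)) (Icc 0 1) :=
          eVariationOn.congr fun x hx => by
            have := hconj j hx
            simp only at this ⊢
            rw [this, add_sub_cancel_right]
            rfl
      _ ≤ _ := eVariationOn_sub_le _
      _ = _ := by rw [hh.eVariationOn_comp]; rfl

/-! ### Lifts of circle diffeomorphisms -/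

theorem coe_add_intCast (x : ℝ) (k : ℤ) : ((x + k : ℝ) : UnitAddCircle) = x := by
  have h : ((k : ℝ) : UnitAddCircle) = 0 := (AddCircle.coe_eq_zero_iff (1 : ℝ)).2 ⟨k, by simp⟩
  rw [AddCircle.coe_add, h, add_zero]

theorem exists_add_intCast_of_coe_eq {x y : ℝ} (h : (x : UnitAddCircle) = y) :
    ∃ k : ℤ, x = y + k := by
  obtain ⟨k, hk⟩ := (AddCircle.coe_eq_zero_iff (1 : ℝ)).1
    (show ((x - y : ℝ) : UnitAddCircle) = 0 by rw [AddCircle.coe_sub, h, sub_self])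
  exact ⟨k, by simp at hk; linarith⟩

theorem IsLift.exists_eq_add_intCast {f : UnitAddCircle → UnitAddCircle} {F F' : ℝ → ℝ}
    (hF : Continuous F) (hF' : Continuous F') (h : IsLift f F) (h' : IsLift f F') :
    ∃ k : ℤ, ∀ x, F' x = F x + k := by
  choose k hk using fun y => exists_add_intCast_of_coe_eq ((h' y).trans (h y).symm)
  have hc : Continuous k := by
    rw [Int.isClosedEmbedding_coe_real.isEmbedding.continuous_iff]
    have : (Int.cast ∘ k : ℝ → ℝ) = fun y => F' y - F y := funext fun y => by simp [hk y]
    rw [this]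
    exact hF'.sub hF
  refine ⟨k 0, fun x => ?_⟩
  rw [hk x, PreconnectedSpace.constant inferInstance hc (x := x) (y := 0)]

theorem IsLift.mul {f g : Equiv.Perm UnitAddCircle} {F G : ℝ → ℝ} (hF : IsLift f F)
    (hG : IsLift g G) : IsLift ⇑(f * g) (F ∘ G) := fun x => by
  rw [Function.comp_apply, hF, hG]; rfl

theorem IsLift.one : IsLift ⇑(1 : Equiv.Perm UnitAddCircle) id := fun _ => rfl

namespace IsCircleDiffeo

variable {r : WithTop ℕ∞} {f g : Equiv.Perm UnitAddCircle}

theorem mul (hf : IsCircleDiffeo r f) (hg : IsCircleDiffeo r g) : IsCircleDiffeo r (f * g) := by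
  obtain ⟨⟨F, hF, hFl⟩, F', hF', hFl'⟩ := hf
  obtain ⟨⟨G, hG, hGl⟩, G', hG', hGl'⟩ := hg
  exact ⟨⟨F ∘ G, hF.comp hG, hFl.mul hGl⟩, G' ∘ F', hG'.comp hF', by
    rw [mul_inv_rev]; exact hGl'.mul hFl'⟩

theorem one : IsCircleDiffeo r (1 : Equiv.Perm UnitAddCircle) :=
  ⟨⟨id, contDiff_id, IsLift.one⟩, id, contDiff_id, by rw [inv_one]; exact IsLift.one⟩

theorem pow (hf : IsCircleDiffeo r f) (n : ℕ) : IsCircleDiffeo r (f ^ n) := by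
  induction n with
  | zero => exact one
  | succ n ih => rw [pow_succ]; exact ih.mul hf

theorem inv (hf : IsCircleDiffeo r f) : IsCircleDiffeo r f⁻¹ := ⟨hf.2, by rw [inv_inv]; exact hf.1⟩

theorem of_le {s : WithTop ℕ∞} (hf : IsCircleDiffeo r f) (h : s ≤ r) : IsCircleDiffeo s f := by
  obtain ⟨⟨F, hF, hFl⟩, F', hF', hFl'⟩ := hf
  exact ⟨⟨F, hF.of_le h, hFl⟩, F', hF'.of_le h, hFl'⟩

theorem circleLift_spec (hf : IsCircleDiffeo r f) :
    Continuous (circleLift f) ∧ IsLift f (circleLift f) := by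
  obtain ⟨⟨F, hF, hFl⟩, -⟩ := hf
  have h : ∃ F : ℝ → ℝ, Continuous F ∧ IsLift f F := ⟨F, hF.continuous, hFl⟩
  unfold circleLift
  rw [dif_pos h]
  exact h.choose_spec

theorem contDiff_circleLift (hf : IsCircleDiffeo r f) : ContDiff ℝ r (circleLift f) := by
  have hs := hf.circleLift_spec
  obtain ⟨⟨F, hF, hFl⟩, -⟩ := hf
  obtain ⟨k, hk⟩ := hFl.exists_eq_add_intCast hF.continuous hs.1 hs.2
  rw [funext hk]
  exact hF.add contDiff_const

theorem exists_circleLift_mul (hf : IsCircleDiffeo r f) (hg : IsCircleDiffeo r g) :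
    ∃ k : ℤ, ∀ x, circleLift (f * g : Equiv.Perm UnitAddCircle) x =
      circleLift f (circleLift g x) + k := by
  have hfg := (hf.mul hg).circleLift_spec
  have hfs := hf.circleLift_spec
  have hgs := hg.circleLift_spec
  exact (hfs.2.mul hgs.2).exists_eq_add_intCast (hfs.1.comp hgs.1) hfg.1 hfg.2

theorem exists_circleLift_inv (hf : IsCircleDiffeo r f) :
    ∃ k : ℤ, ∀ x, circleLift ⇑f⁻¹ (circleLift f x) = x + k := by
  have hfs := hf.circleLift_spec
  have hgs := hf.inv.circleLift_spec
  have := hgs.2.mul hfs.2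
  rw [inv_mul_cancel] at this
  exact IsLift.one.exists_eq_add_intCast continuous_id (hgs.1.comp hfs.1) this

theorem injective_circleLift (hf : IsCircleDiffeo r f) : Function.Injective (circleLift f) := by
  obtain ⟨k, hk⟩ := hf.exists_circleLift_inv
  intro x y hxy
  have := congrArg (circleLift ⇑f⁻¹) hxy
  rw [hk, hk] at this
  linarith

theorem exists_circleLift_add_int (hf : IsCircleDiffeo r f) :
    ∃ d : ℤ, ∀ x, circleLift f (x + 1) = circleLift f x + d := by
  have hs := hf.circleLift_spec
  have : IsLift f fun x => circleLift f (x + 1) := fun x => by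
    rw [hs.2, ← coe_add_intCast x 1, Int.cast_one]
  exact hs.2.exists_eq_add_intCast hs.1 (hs.1.comp (continuous_id.add continuous_const)) this

theorem circleLift_add_intCast {d : ℤ} (hd : ∀ x, circleLift f (x + 1) = circleLift f x + d)
    (k : ℤ) (x : ℝ) : circleLift f (x + k) = circleLift f x + k * d := by
  have h : Function.Periodic (fun x => circleLift f x - x * d) 1 := fun x => by
    simp only [hd]; ring
  have := h.int_mul k x
  simp only [mul_one] at this
  linarith

theorem circleLift_add_one (hf : IsCircleDiffeo r f) :
    (∀ x, circleLift f (x + 1) = circleLift f x + 1) ∨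
      ∀ x, circleLift f (x + 1) = circleLift f x - 1 := by
  obtain ⟨d, hd⟩ := hf.exists_circleLift_add_int
  obtain ⟨e, he⟩ := hf.inv.exists_circleLift_add_int
  obtain ⟨k, hk⟩ := hf.exists_circleLift_inv
  have h1 := hk (0 + 1)
  rw [hd, circleLift_add_intCast he, hk] at h1
  have h2 : d * e = 1 := by
    have : (d : ℝ) * e = 1 := by linarith
    exact_mod_cast this
  rcases Int.eq_one_or_neg_one_of_mul_eq_one h2 with rfl | rfl
  · exact Or.inl fun x => by simpa using hd x
  · exact Or.inr fun x => by simpa [sub_eq_add_neg] using hd x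

theorem surjective_circleLift (hf : IsCircleDiffeo r f) : Function.Surjective (circleLift f) := by
  obtain ⟨k, hk⟩ := hf.inv.exists_circleLift_inv
  rw [inv_inv] at hk
  intro y
  refine ⟨circleLift ⇑f⁻¹ (y - k), ?_⟩
  rw [hk, sub_add_cancel]

theorem deriv_circleLift_ne_zero (hf : IsCircleDiffeo 1 f) (x : ℝ) :
    deriv (circleLift f) x ≠ 0 := by
  obtain ⟨k, hk⟩ := hf.exists_circleLift_inv
  have h1 := (hf.inv.contDiff_circleLift.differentiable one_ne_zero (circleLift f x)).hasDerivAt.comp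
    x (hf.contDiff_circleLift.differentiable one_ne_zero x).hasDerivAt
  have h2 : HasDerivAt (circleLift ⇑f⁻¹ ∘ circleLift f) 1 x := by
    rw [show circleLift ⇑f⁻¹ ∘ circleLift f = fun x => x + (k : ℝ) from funext hk]
    exact (hasDerivAt_id x).add_const _
  exact right_ne_zero_of_mul (h1.unique h2 ▸ one_ne_zero)

theorem strictMono_or_strictAnti (hf : IsCircleDiffeo r f) :
    StrictMono (circleLift f) ∨ StrictAnti (circleLift f) :=
  hf.circleLift_spec.1.strictMono_of_inj hf.injective_circleLift

theorem strictMono_circleLift_mul_self (hf : IsCircleDiffeo r f) :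
    StrictMono (circleLift (f * f : Equiv.Perm UnitAddCircle)) := by
  obtain ⟨k, hk⟩ := hf.exists_circleLift_mul hf
  rw [funext hk]
  rcases hf.strictMono_or_strictAnti with h | h
  · exact (h.comp h).add_const _
  · exact (h.comp h).add_const _

theorem circleLift_mul_self_add_one (hf : IsCircleDiffeo r f) (x : ℝ) :
    circleLift (f * f : Equiv.Perm UnitAddCircle) (x + 1) =
      circleLift (f * f : Equiv.Perm UnitAddCircle) x + 1 := by
  obtain ⟨k, hk⟩ := hf.exists_circleLift_mul hf
  rw [hk, hk]
  rcases hf.circleLift_add_one with h | h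
  · rw [h, h]; ring
  · have := h (circleLift f x - 1)
    rw [sub_add_cancel] at this
    rw [h]
    linarith

/-- A lift of the square of a circle diffeomorphism, as an increasing homeomorphism of the line. -/
theorem exists_orderIso_mul_self (hf : IsCircleDiffeo r f) (k : ℤ) :
    ∃ K : ℝ ≃o ℝ, ∀ x, K x = circleLift (f * f : Equiv.Perm UnitAddCircle) x + k := by
  have hsurj := (hf.mul hf).surjective_circleLift
  refine ⟨StrictMono.orderIsoOfSurjective
    (fun x => circleLift (f * f : Equiv.Perm UnitAddCircle) x + k)
    (hf.strictMono_circleLift_mul_self.add_const _) fun y => ?_, fun x => rfl⟩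
  obtain ⟨x, hx⟩ := hsurj (y - k)
  exact ⟨x, by simp only [hx, sub_add_cancel]⟩

end IsCircleDiffeo

/-- The logarithm of the absolute derivative of a circle map. -/
noncomputable def circleLog (f : Equiv.Perm UnitAddCircle) (x : ℝ) : ℝ :=
  Real.log |circleDeriv f x|

theorem circleLog_eq (f : Equiv.Perm UnitAddCircle) :
    circleLog f = fun x => Real.log (deriv (circleLift f) x) :=
  funext fun _ => Real.log_abs _

theorem eVariationOn_add_one_of_periodic {φ : ℝ → ℝ} (hφ : Function.Periodic φ 1) (a : ℝ) :
    eVariationOn φ (Icc a (a + 1)) = eVariationOn φ (Icc 0 1) := by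
  have hshift : ∀ (k : ℤ) (x y : ℝ), eVariationOn φ (Icc (x + k) (y + k)) =
      eVariationOn φ (Icc x y) := fun k x y => by
    have h := eVariationOn.comp_eq_of_monotoneOn φ (t := Icc x y) (fun z : ℝ => z + k)
      (fun _ _ _ _ h => by simpa using h)
    rw [image_add_const_Icc] at h
    rw [← h]
    exact congrArg (eVariationOn · _) (funext fun z => by simpa using hφ.int_mul k z)
  have h1 : a ≤ ⌈a⌉ := Int.le_ceil a
  have h2 : (⌈a⌉ : ℝ) ≤ a + 1 := (Int.ceil_lt_add_one a).le
  have h3 := hshift 1 a ⌈a⌉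
  have h4 := hshift ⌈a⌉ 0 1
  rw [Int.cast_one] at h3
  rw [zero_add, add_comm 1] at h4
  have e1 := eVariationOn_Icc_add φ h1 h2
  have e2 := eVariationOn_Icc_add φ h2 (show a + 1 ≤ (⌈a⌉ : ℝ) + 1 by linarith)
  rw [← h4, ← e1, ← e2, h3, add_comm]

namespace IsCircleDiffeo

variable {f g : Equiv.Perm UnitAddCircle}

theorem periodic_circleLog {r : WithTop ℕ∞} (hf : IsCircleDiffeo r f) :
    Function.Periodic (circleLog f) 1 := fun x => by
  obtain ⟨d, hd⟩ := hf.exists_circleLift_add_int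
  rw [circleLog_eq]
  simp only
  rw [← deriv_comp_add_const, funext hd, deriv_add_const]

theorem circleLog_mul (hf : IsCircleDiffeo 1 f) (hg : IsCircleDiffeo 1 g) (x : ℝ) :
    circleLog (f * g) x = circleLog f (circleLift g x) + circleLog g x := by
  have hfs := hf.circleLift_spec
  have hgs := hg.circleLift_spec
  have h := ((hf.contDiff_circleLift.differentiable one_ne_zero _).hasDerivAt.comp x
    (hg.contDiff_circleLift.differentiable one_ne_zero x).hasDerivAt).deriv
  rw [circleLog, circleDeriv_eq (hfs.1.comp hgs.1) (hfs.2.mul hgs.2), h, abs_mul, Real.log_mul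
    (abs_ne_zero.2 (hf.deriv_circleLift_ne_zero _))
    (abs_ne_zero.2 (hg.deriv_circleLift_ne_zero _))]
  rfl

theorem circleLog_one (x : ℝ) : circleLog 1 x = 0 := by
  rw [circleLog, circleDeriv_eq continuous_id IsLift.one, deriv_id, abs_one, Real.log_one]

theorem continuous_circleLog (hf : IsCircleDiffeo 1 f) : Continuous (circleLog f) := by
  rw [circleLog_eq]
  exact (hf.contDiff_circleLift.continuous_deriv le_rfl).log hf.deriv_circleLift_ne_zero

theorem contDiff_circleLog (hf : IsCircleDiffeo 2 f) : ContDiff ℝ 1 (circleLog f) := by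
  rw [circleLog_eq]
  have h : ContDiff ℝ (1 + 1) (circleLift f) := by
    rw [one_add_one_eq_two]; exact hf.contDiff_circleLift
  exact h.deriv'.log (hf.of_le one_le_two).deriv_circleLift_ne_zero

theorem eVariationOn_comp {r : WithTop ℕ∞} (hf : IsCircleDiffeo r f) {φ : ℝ → ℝ}
    (hφ : Function.Periodic φ 1) :
    eVariationOn (fun x => φ (circleLift f x)) (Icc 0 1) = eVariationOn φ (Icc 0 1) := by
  have hc : ContinuousOn (circleLift f) (Icc 0 1) := hf.circleLift_spec.1.continuousOn
  rcases hf.strictMono_or_strictAnti with h | h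
  · have h1 : circleLift f 1 = circleLift f 0 + 1 := by
      rcases hf.circleLift_add_one with h' | h'
      · simpa using h' 0
      · have h0 := h' 0
        rw [zero_add] at h0
        linarith [h zero_lt_one]
    have himg : circleLift f '' Icc 0 1 = Icc (circleLift f 0) (circleLift f 0 + 1) := by
      rw [← h1]
      refine Subset.antisymm (image_subset_iff.2 fun x hx =>
        ⟨h.monotone hx.1, h.monotone hx.2⟩) (intermediate_value_Icc zero_le_one hc)
    rw [← eVariationOn_add_one_of_periodic hφ (circleLift f 0), ← himg]
    exact eVariationOn.comp_eq_of_monotoneOn φ _ (h.monotone.monotoneOn _)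
  · have h1 : circleLift f 0 = circleLift f 1 + 1 := by
      rcases hf.circleLift_add_one with h' | h'
      · have h0 := h' 0
        rw [zero_add] at h0
        linarith [h zero_lt_one]
      · have h0 := h' 0
        rw [zero_add] at h0
        linarith
    have himg : circleLift f '' Icc 0 1 = Icc (circleLift f 1) (circleLift f 1 + 1) := by
      rw [← h1]
      refine Subset.antisymm (image_subset_iff.2 fun x hx =>
        ⟨h.antitone hx.2, h.antitone hx.1⟩) (intermediate_value_Icc' zero_le_one hc)
    rw [← eVariationOn_add_one_of_periodic hφ (circleLift f 1), ← himg]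
    exact eVariationOn.comp_eq_of_antitoneOn φ _ (h.antitone.antitoneOn _)

theorem circleVarLog_ne_top (hf : IsCircleDiffeo 2 f) : circleVarLog f ≠ ∞ := by
  obtain ⟨L, hL⟩ := hf.contDiff_circleLog.contDiffOn.exists_lipschitzOnWith one_ne_zero
    (convex_Icc (0 : ℝ) 1) isCompact_Icc
  exact eVariationOn_ne_top_of_lipschitzOnWith hL

theorem circleVarLog_pow_add_le (hf : IsCircleDiffeo 1 f) (m n : ℕ) :
    circleVarLog (f ^ (m + n)) ≤ circleVarLog (f ^ m) + circleVarLog (f ^ n) := by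
  have h : eVariationOn (circleLog (f ^ (m + n))) (Icc 0 1) =
      eVariationOn (fun x => circleLog (f ^ m) (circleLift ⇑(f ^ n) x) + circleLog (f ^ n) x)
        (Icc 0 1) := by
    rw [pow_add]
    exact congrArg (eVariationOn · _) (funext ((hf.pow m).circleLog_mul (hf.pow n)))
  refine h.trans_le ((eVariationOn_add_le _).trans_eq ?_)
  rw [(hf.pow n).eVariationOn_comp (hf.pow m).periodic_circleLog]
  rfl

theorem smoothLift (hf : IsCircleDiffeo 2 f) {K : ℝ ≃o ℝ}
    (hK : ∀ x, K x = circleLift (f * f : Equiv.Perm UnitAddCircle) x) :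
    SmoothLift K (circleLog (f * f)) := by
  have h2 := hf.mul hf
  have h1 : IsCircleDiffeo 1 (f * f) := h2.of_le one_le_two
  refine ⟨fun x => ?_, fun x => ?_, h2.contDiff_circleLog, h2.periodic_circleLog⟩
  · rw [hK, hK, hf.circleLift_mul_self_add_one]
  · have hpos : 0 < deriv (circleLift (f * f : Equiv.Perm UnitAddCircle)) x :=
      lt_of_le_of_ne (hf.strictMono_circleLift_mul_self.monotone.deriv_nonneg)
        (h1.deriv_circleLift_ne_zero x).symm
    rw [circleLog_eq, Real.exp_log hpos, show ⇑K = _ from funext hK]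
    exact (h1.contDiff_circleLift.differentiable one_ne_zero x).hasDerivAt

theorem circleLog_pow_eq_birkhoffSum (hf : IsCircleDiffeo 1 f) (n : ℕ) (x : ℝ) :
    circleLog (f ^ n) x = birkhoffSum (circleLift f) (circleLog f) n x := by
  induction n generalizing x with
  | zero => simp [circleLog_one]
  | succ n ih =>
    rw [pow_succ, (hf.pow n).circleLog_mul hf, ih, birkhoffSum_succ', add_comm]

theorem isLift_iterate {F : ℝ → ℝ} (hF : IsLift f F) (n : ℕ) : IsLift ⇑(f ^ n) F^[n] := by
  induction n with
  | zero => exact IsLift.one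
  | succ n ih => rw [pow_succ, Function.iterate_succ]; exact ih.mul hF

theorem tendsto_circleVarLog_of_aperiodic (hf : IsCircleDiffeo 2 f)
    (haper : ∀ n : ℕ, 0 < n → ∀ p, (f ^ (2 * n)) p ≠ p) :
    Tendsto (fun j : ℕ => circleVarLog (f ^ (2 * j)) / j) atTop (𝓝 0) := by
  obtain ⟨K, hK⟩ := hf.exists_orderIso_mul_self 0
  simp only [Int.cast_zero, add_zero] at hK
  have hsmooth := hf.smoothLift hK
  have hKf : ⇑K = circleLift (f * f : Equiv.Perm UnitAddCircle) := funext hK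
  refine (hsmooth.tendsto_eVariationOn_birkhoffSum_div fun n hn x k h => ?_).congr fun j => ?_
  · refine haper n hn x ?_
    have hl := isLift_iterate (hf.mul hf).circleLift_spec.2 n x
    rw [← hKf, h, coe_add_intCast, ← pow_two, ← pow_mul] at hl
    exact hl.symm
  · have h1 : IsCircleDiffeo 1 (f * f) := (hf.mul hf).of_le one_le_two
    rw [pow_mul, pow_two, hKf, ← funext (h1.circleLog_pow_eq_birkhoffSum j)]
    rfl

end IsCircleDiffeo

theorem circleLog_conj {f g h : Equiv.Perm UnitAddCircle} (hf : IsCircleDiffeo 1 f)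
    (hg : IsCircleDiffeo 1 g) (hh : IsCircleDiffeo 1 h) (hfg : f = h * g * h⁻¹) {G : ℝ → ℝ}
    (hG : Continuous G) (hGl : IsLift g G) (x : ℝ) :
    circleLog f (circleLift h x) = circleLog g x + (circleLog h (G x) - circleLog h x) := by
  have e : f * h = h * g := by rw [hfg]; group
  have h1 := hf.circleLog_mul hh x
  have h2 := hh.circleLog_mul hg x
  have hgs := hg.circleLift_spec
  obtain ⟨k, hk⟩ := hgs.2.exists_eq_add_intCast hgs.1 hG hGl
  have h3 : circleLog h (G x) = circleLog h (circleLift g x) := by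
    rw [hk]; simpa using hh.periodic_circleLog.int_mul k (circleLift g x)
  rw [e] at h1
  linarith

theorem circleDist_conj (f g h : Equiv.Perm UnitAddCircle) (hf : IsCircleDiffeo 2 f)
    (hg : IsCircleDiffeo 2 g) (hh : IsCircleDiffeo 1 h) (hfg : f = h * g * h⁻¹) :
    ∃ L : ℝ≥0∞, L ≠ ∞ ∧ Tendsto (fun n : ℕ => circleVarLog (f ^ n) / n) atTop (𝓝 L) ∧
      Tendsto (fun n : ℕ => circleVarLog (g ^ n) / n) atTop (𝓝 L) := by
  have hf1 : IsCircleDiffeo 1 f := hf.of_le one_le_two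
  have hg1 : IsCircleDiffeo 1 g := hg.of_le one_le_two
  have hpow : ∀ n, f ^ n = h * g ^ n * h⁻¹ := fun n => by rw [hfg, conj_pow]
  have key := fun (m : ℕ) (hm : 0 < m) (w : ℕ → ℝ≥0∞) => exists_common_limit (m := m) (w := w) hm
    (hf.pow 0).circleVarLog_ne_top (hf.pow 1).circleVarLog_ne_top hf1.circleVarLog_pow_add_le
    (hg.pow 0).circleVarLog_ne_top (hg.pow 1).circleVarLog_ne_top hg1.circleVarLog_pow_add_le
  by_cases haper : ∀ n : ℕ, 0 < n → ∀ p, (g ^ (2 * n)) p ≠ p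
  · have haper' : ∀ n : ℕ, 0 < n → ∀ p, (f ^ (2 * n)) p ≠ p := fun n hn p hp => by
      refine haper n hn (h⁻¹ p) (h.injective ?_)
      rw [hpow] at hp
      simpa using hp
    have hlim := (hf.tendsto_circleVarLog_of_aperiodic haper').add
      (hg.tendsto_circleVarLog_of_aperiodic haper)
    rw [add_zero] at hlim
    refine key 2 two_pos (fun j => circleVarLog (f ^ (2 * j)) + circleVarLog (g ^ (2 * j)))
      (hlim.congr fun j => ENNReal.add_div.symm) (fun j => ?_) (fun j => ?_)
    · exact le_add_of_nonneg_of_le zero_le le_self_add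
    · exact le_add_of_nonneg_of_le zero_le le_add_self
  push Not at haper
  obtain ⟨n, hn, p, hp⟩ := haper
  obtain ⟨x₀, rfl⟩ := QuotientAddGroup.mk_surjective p
  have hgn : IsCircleDiffeo 2 (g ^ n) := hg.pow n
  have e2 : g ^ n * g ^ n = g ^ (2 * n) := by rw [← pow_add, two_mul]
  have hl := (hgn.mul hgn).circleLift_spec
  obtain ⟨k, hk⟩ := exists_add_intCast_of_coe_eq ((hl.2 x₀).trans (by rw [e2]; exact hp))
  obtain ⟨K, hK⟩ := hgn.exists_orderIso_mul_self (-k)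
  have hKc : Continuous K := K.continuous
  have hK0 : K x₀ = x₀ := by rw [hK, hk]; push_cast; ring
  have hK1 : K (x₀ + 1) = x₀ + 1 := by
    have := hK x₀
    rw [hK0] at this
    rw [hK, hgn.circleLift_mul_self_add_one]
    linarith
  have hKl : IsLift ⇑(g ^ (2 * n)) K := fun x => by rw [hK, coe_add_intCast, hl.2, e2]
  have hKj : ∀ j, IsLift ⇑(g ^ (2 * n * j)) K^[j] := fun j => by
    rw [pow_mul]; exact IsCircleDiffeo.isLift_iterate hKl j
  have hKp : ∀ j x, ∃ d : ℤ, K^[j] (x + 1) = K^[j] x + d := fun j x => by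
    have h1 : ((x + 1 : ℝ) : UnitAddCircle) = x := by simp
    exact exists_add_intCast_of_coe_eq (by rw [hKj j, hKj j, h1])
  have hconj := fun j => circleLog_conj (hf1.pow (2 * n * j)) (hg1.pow (2 * n * j)) hh
    (hpow (2 * n * j)) (continuous_iterate_orderIso K j) (hKj j)
  have hψ := hh.periodic_circleLog
  obtain ⟨L, hL⟩ : ∃ L, LipschitzOnWith L (fun z => circleLog h (K z) - circleLog h z)
      (Icc x₀ (x₀ + 1)) := by
    have heq : (fun z => circleLog h (K z) - circleLog h z) = fun z =>
        circleLog (f ^ (2 * n)) (circleLift h z) - circleLog (g ^ (2 * n)) z := funext fun z => by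
      rw [circleLog_conj (hf1.pow (2 * n)) (hg1.pow (2 * n)) hh (hpow (2 * n)) hKc hKl]
      ring
    rw [heq]
    exact (((hf.pow (2 * n)).contDiff_circleLog.comp hh.contDiff_circleLift).sub
      (hg.pow (2 * n)).contDiff_circleLog).contDiffOn.exists_lipschitzOnWith one_ne_zero
      (convex_Icc _ _) isCompact_Icc
  have hw := tendsto_eVariationOn_coboundary_div (by linarith : x₀ ≤ x₀ + 1) hK0 hK1
    hh.continuous_circleLog.continuousOn hL
  have hper : ∀ j : ℕ, Function.Periodic (fun z => circleLog h (K^[j] z) - circleLog h z) 1 :=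
    fun j x => by
      obtain ⟨d, hd⟩ := hKp j x
      have : circleLog h (K^[j] x + d) = circleLog h (K^[j] x) := by
        simpa using hψ.int_mul d (K^[j] x)
      simp only [hψ x, hd, this]
  refine key (2 * n) (by omega) _ (hw.congr fun j => by
    rw [eVariationOn_add_one_of_periodic (hper j)]) (fun j => ?_) (fun j => ?_)
  · calc circleVarLog (f ^ (2 * n * j)) = eVariationOn (circleLog (f ^ (2 * n * j))) (Icc 0 1) := rfl
      _ = _ := (hh.eVariationOn_comp (hf.pow _).periodic_circleLog).symm
      _ = _ := congrArg (eVariationOn · _) (funext (hconj j))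
      _ ≤ _ := eVariationOn_add_le _
  · calc circleVarLog (g ^ (2 * n * j)) = eVariationOn (fun x =>
          circleLog (f ^ (2 * n * j)) (circleLift h x) -
            (circleLog h (K^[j] x) - circleLog h x)) (Icc 0 1) := by
          simp only [hconj j, add_sub_cancel_right]
          rfl
      _ ≤ _ := eVariationOn_sub_le _
      _ = _ := by rw [hh.eVariationOn_comp (hf.pow _).periodic_circleLog]; rfl

end AsympDist

theorem theoremG :
    (∀ f g h : Equiv.Perm unitInterval,
      AsympDist.IsIntervalDiffeo 2 f → AsympDist.IsIntervalDiffeo 2 g →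
      AsympDist.IsIntervalDiffeo 1 h → f = h * g * h⁻¹ →
        Tendsto (fun n : ℕ => AsympDist.intervalVarLog (f ^ n) / n) atTop
          (𝓝 (AsympDist.intervalDist f)) ∧
        Tendsto (fun n : ℕ => AsympDist.intervalVarLog (g ^ n) / n) atTop
          (𝓝 (AsympDist.intervalDist g)) ∧
        AsympDist.intervalDist f ≠ ∞ ∧
        AsympDist.intervalDist f = AsympDist.intervalDist g) ∧
    (∀ f g h : Equiv.Perm UnitAddCircle,
      AsympDist.IsCircleDiffeo 2 f → AsympDist.IsCircleDiffeo 2 g →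
      AsympDist.IsCircleDiffeo 1 h → f = h * g * h⁻¹ →
        Tendsto (fun n : ℕ => AsympDist.circleVarLog (f ^ n) / n) atTop
          (𝓝 (AsympDist.circleDist f)) ∧
        Tendsto (fun n : ℕ => AsympDist.circleVarLog (g ^ n) / n) atTop
          (𝓝 (AsympDist.circleDist g)) ∧
        AsympDist.circleDist f ≠ ∞ ∧
        AsympDist.circleDist f = AsympDist.circleDist g) := by
  refine ⟨fun f g h hf hg hh hfg => ?_, fun f g h hf hg hh hfg => ?_⟩
  · obtain ⟨L, hL, h1, h2⟩ := AsympDist.intervalDist_conj f g h hf hg hh hfg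
    have e1 : AsympDist.intervalDist f = L := h1.limUnder_eq
    have e2 : AsympDist.intervalDist g = L := h2.limUnder_eq
    rw [e1, e2]
    exact ⟨h1, h2, hL, rfl⟩
  · obtain ⟨L, hL, h1, h2⟩ := AsympDist.circleDist_conj f g h hf hg hh hfg
    have e1 : AsympDist.circleDist f = L := h1.limUnder_eq
    have e2 : AsympDist.circleDist g = L := h2.limUnder_eq
    rw [e1, e2]
    exact ⟨h1, h2, hL, rfl⟩
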